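/- Let $d\ge 1$. Let $\varphi_0\in C^\infty(\mathbb R^d)$ satisfy $\varphi_0(x)=1$ for $|x|\le 1$ and $\varphi_0(x)=0$ for $|x|\ge \tfrac32$, put $\varphi_j(x)=\varphi_0(2^{-j}x)-\varphi_0(2^{-j+1}x)$ for $j\ge1$, and for $\gamma\in\mathbb R$ let $\mathcal C^\gamma=B^\gamma_{\infty,\infty}(\mathbb R^d)$ be the space of real tempered distributions $f$ with $\|f\|_\gamma:=\sup_{j\ge0}2^{\gamma j}\|(\varphi_j\hat f)^\vee\|_{L^\infty}<\infty$. Assume: * $F:\mathbb R^d\to\mathbb R$ is $C^1$ with Lipschitz partial derivatives; * $0<\alpha<1$, $\beta<0$ and $\max\{-\alpha,\alpha-1\}<\beta$; * $T>0$ and $b\in L^\infty(0,T;\mathcal C^\beta)$; * $u_0\in\mathcal C^{\alpha+1}$. Let $P_t=e^{t\Delta}$ be the heat semigroup, and for $f\in\mathcal C^\alpha$, $g\in\mathcal C^\beta$ let $fg=\sum_{j,k}(\varphi_j\hat f)^\vee(\varphi_k\hat g)^\vee$ be the product of distributions (limit in $\mathcal S'$ of the sums over $j,k\le n$). For an interval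 $I$ with $0\in I\subseteq[0,T]$, a mild solution on $I$ of $$\partial_t u=\Delta u+F(\nabla u)\,b,\qquad u(0)=u_0,$$ is a function $u:I\to\mathcal C^{\alpha+1}$ that is norm continuous on $I\setminus\{0\}$, norm bounded near $t=0$, and satisfies $$u(t)=P_tu_0+\int_0^tP_{t-s}\bigl(F(\nabla u(s))\,b(s)\bigr)\,ds,\qquad t\in I .$$ Then there is a unique maximal mild solution $u$, with domain an interval $I$, $0\in I\subseteq[0,T]$ (that is, $u$ is a mild solution on $I$, and every mild solution on an interval $J$ with $0\in J\subseteq[0,T]$ is a restriction of $u$), and one of the following statements holds: * (a) there is a time $t^*\in(0,T]$ such that $I=[0,t^*)$ and $\lim_{s\to t^*}\|u(s)\|_{\alpha+1}=\infty$; or * (b) $I=[0,T]$, that is, the solution exists for all $t\in[0,T]$. Moreover, if $t^*\in(0,T]$, $[0,t^*)\subseteq I$ and $\limsup_{s\uparrow t^*}\|u(s)\|_{\alpha+1}=\infty$, then $\lim_{s\uparrow t^*}\|u(s)\|_{\alpha+1}=\infty$. Finally, if $\|P_tu_0-u_0\|_{\alpha+1}\to0$ as $t\downarrow0$, then $u$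 is norm continuous on all of $I$, including $t=0$. -/

import Mathlib

open MeasureTheory Filter Topology Set
open scoped SchwartzMap ENNReal LineDeriv

namespace RoughHeat

noncomputable section

/-- Euclidean space `ℝ^d`. -/
abbrev Space (d : ℕ) : Type := EuclideanSpace ℝ (Fin d)

/-- (Complex) tempered distributions on `ℝ^d`; the real ones are singled out by `IsReal`. -/
abbrev Distr (d : ℕ) : Type := 𝓢'(Space d, ℂ)

variable {d : ℕ}

/-- A tempered distribution is real if it is real on real test functions. -/
def IsReal (f : Distr d) : Prop :=
  ∀ ψ : 𝓢(Space d, ℂ), (∀ x, (ψ x).im = 0) → (f ψ).im = 0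

/-- The zeroth element `φ₀` of a dyadic partition of unity. -/
structure IsDyadicGenerator (φ₀ : Space d → ℝ) : Prop where
  smooth : ContDiff ℝ (⊤ : ℕ∞) φ₀
  eq_one : ∀ x, ‖x‖ ≤ 1 → φ₀ x = 1
  eq_zero : ∀ x, 3 / 2 ≤ ‖x‖ → φ₀ x = 0

/-- The dyadic partition of unity `φ_j (x) = φ₀ (2^{-j} x) - φ₀ (2^{-j+1} x)`, `j ≥ 1`. -/
def dyadic (φ₀ : Space d → ℝ) : ℕ → Space d → ℝ
  | 0 => φ₀
  | j + 1 => fun x => φ₀ ((2 : ℝ)⁻¹ ^ (j + 1) • x) - φ₀ ((2 : ℝ)⁻¹ ^ j • x)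

/-- The Littlewood–Paley block `(φ_j f̂)^∨`. -/
def block (φ₀ : Space d → ℝ) (j : ℕ) (f : Distr d) : Distr d :=
  TemperedDistribution.fourierMultiplierCLM ℂ (fun ξ => (dyadic φ₀ j ξ : ℂ)) f

/-- The `L^∞` norm of a tempered distribution: the norm of the `L^∞` function that
represents it, and `∞` if there is none. -/
def linftyNorm (f : Distr d) : ℝ≥0∞ :=
  ⨅ (g : Lp ℂ ∞ (volume : Measure (Space d))) (_ : Lp.toTemperedDistribution g = f), ‖g‖ₑ

/-- The norm of `𝒞^γ = B^γ_{∞,∞}`, with value `∞` off that space. -/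
def besovNorm (φ₀ : Space d → ℝ) (γ : ℝ) (f : Distr d) : ℝ≥0∞ :=
  ⨆ j : ℕ, ENNReal.ofReal ((2 : ℝ) ^ (γ * j)) * linftyNorm (block φ₀ j f)

/-- The space `𝒞^γ = B^γ_{∞,∞}` of real tempered distributions. -/
def besovSpace (φ₀ : Space d → ℝ) (γ : ℝ) : Set (Distr d) :=
  {f | IsReal f ∧ besovNorm φ₀ γ f < ∞}

/-- The heat semigroup `P_t = e^{tΔ}`. (The Fourier transform is
`∫ e^{-2πi x·ξ} f(x) dx`, so that `Δ` has the symbol `-(2π)²|ξ|²`.) -/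
def heat (t : ℝ) (f : Distr d) : Distr d :=
  TemperedDistribution.fourierMultiplierCLM ℂ
    (fun ξ => (Real.exp (-t * (2 * Real.pi) ^ 2 * ‖ξ‖ ^ 2) : ℂ)) f

/-- The low-frequency cut-off `S_n f = ∑_{j ≤ n} (φ_j f̂)^∨`. -/
def lowFreq (φ₀ : Space d → ℝ) (n : ℕ) (f : Distr d) : Distr d :=
  ∑ j ∈ Finset.range (n + 1), block φ₀ j f

/-- `h` is the product of the distributions `f` and `g`, in the sense of Littlewood–Paley
theory: `h = ∑_{j,k} (φ_j f̂)^∨ (φ_k ĝ)^∨`, that is, `S_n f · S_n g → h` in `𝓢'`. The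
distribution `S_n f` is a smooth function of temperate growth, which multiplies `𝓢'`. -/
def IsProduct (φ₀ : Space d → ℝ) (f g h : Distr d) : Prop :=
  ∃ f' : ℕ → Space d → ℂ,
    (∀ n, ∃ hf : (f' n).HasTemperateGrowth,
      Function.HasTemperateGrowth.toTemperedDistribution volume hf = lowFreq φ₀ n f) ∧
    ∀ ψ : 𝓢(Space d, ℂ),
      Tendsto (fun n => TemperedDistribution.smulLeftCLM ℂ (f' n) (lowFreq φ₀ n g) ψ)
        atTop (𝓝 (h ψ))

/-- `w` is the function `x ↦ F (∇u(x))`, where the distributional derivatives of the real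
distribution `u` are bounded functions. -/
def IsFGrad (F : Space d → ℝ) (u w : Distr d) : Prop :=
  ∃ (v : Fin d → Lp ℂ ∞ (volume : Measure (Space d)))
    (f : Lp ℂ ∞ (volume : Measure (Space d))),
    (∀ i, Lp.toTemperedDistribution (v i) = ∂_{EuclideanSpace.single i (1 : ℝ)} u) ∧
    (∀ᵐ x, f x = (F (WithLp.toLp 2 fun i => (v i x).re) : ℂ)) ∧
    w = Lp.toTemperedDistribution f

/-- `F` is continuously differentiable with Lipschitz partial derivatives. -/
def IsC1LipschitzPartials (F : Space d → ℝ) : Prop :=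
  ContDiff ℝ 1 F ∧ ∃ L : NNReal, ∀ i : Fin d,
    LipschitzWith L fun x => fderiv ℝ F x (EuclideanSpace.single i (1 : ℝ))

/-- `b ∈ L^∞(0,T; 𝒞^β)`. Measurability is only asked for after pairing with test functions,
which every strongly measurable `b` satisfies. -/
def IsLinfty (φ₀ : Space d → ℝ) (β T : ℝ) (b : ℝ → Distr d) : Prop :=
  (∀ ψ : 𝓢(Space d, ℂ),
    AEStronglyMeasurable (fun s => b s ψ) (volume.restrict (Icc 0 T))) ∧
  ∃ M : NNReal, ∀ᵐ s ∂(volume.restrict (Icc 0 T)),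
    b s ∈ besovSpace φ₀ β ∧ besovNorm φ₀ β (b s) ≤ M

/-- `u : I → 𝒞^γ` is norm continuous at the point `t` of `I`. -/
def NormContinuousAt (φ₀ : Space d → ℝ) (γ : ℝ) (I : Set ℝ) (u : ℝ → Distr d) (t : ℝ) :
    Prop :=
  Tendsto (fun s => besovNorm φ₀ γ (u s - u t)) (𝓝[I] t) (𝓝 0)

/-- `u` is a mild solution on the time interval `I ∋ 0`, `I ⊆ [0,∞)`: it takes values in
`𝒞^{α+1}`, is norm continuous at positive times and norm bounded near time `0`, and
`u(t) = P_t u₀ + ∫₀ᵗ P_{t-s} (F(∇u(s)) b(s)) ds` for `t ∈ I`. Here `N s` is the product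
`F(∇u(s)) b(s)`, and the integral is evaluated against test functions. -/
structure IsMildSolution (φ₀ : Space d → ℝ) (α : ℝ) (F : Space d → ℝ) (b : ℝ → Distr d)
    (u₀ : Distr d) (I : Set ℝ) (u : ℝ → Distr d) : Prop where
  mem : ∀ t ∈ I, u t ∈ besovSpace φ₀ (α + 1)
  continuous : ∀ t ∈ I, 0 < t → NormContinuousAt φ₀ (α + 1) I u t
  bounded : ∃ δ > (0 : ℝ), ∃ M : NNReal, ∀ t ∈ I, t < δ → besovNorm φ₀ (α + 1) (u t) ≤ M
  equation : ∃ N : ℝ → Distr d,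
    (∀ᵐ s ∂(volume.restrict I), ∃ w, IsFGrad F (u s) w ∧ IsProduct φ₀ w (b s) (N s)) ∧
    ∀ t ∈ I, ∀ ψ : 𝓢(Space d, ℂ),
      IntervalIntegrable (fun s => heat (t - s) (N s) ψ) volume 0 t ∧
      u t ψ = heat t u₀ ψ + ∫ s in (0 : ℝ)..t, heat (t - s) (N s) ψ

/-- `I` is an interval with `0 ∈ I ⊆ [0,T]`. -/
def IsTimeInterval (T : ℝ) (I : Set ℝ) : Prop :=
  0 ∈ I ∧ I.OrdConnected ∧ I ⊆ Icc 0 T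

/-- `u`, with domain `I`, is the solution up to time `T`: it is a mild solution on `I`, and
every mild solution on a subinterval of `[0,T]` that contains `0` is a restriction of it. -/
def IsTheSolution (φ₀ : Space d → ℝ) (α : ℝ) (F : Space d → ℝ) (b : ℝ → Distr d)
    (u₀ : Distr d) (T : ℝ) (I : Set ℝ) (u : ℝ → Distr d) : Prop :=
  IsTimeInterval T I ∧ IsMildSolution φ₀ α F b u₀ I u ∧
  ∀ (J : Set ℝ) (v : ℝ → Distr d), IsTimeInterval T J →
    IsMildSolution φ₀ α F b u₀ J v → J ⊆ I ∧ EqOn v u J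

end

end RoughHeat

namespace RoughHeat

noncomputable section

open scoped FourierTransform

variable {d : ℕ}

/-! The equation is solved by Picard iteration in `𝒞^{α+1}`. For `u` in this space `∇u` is bounded
and `a`-Hölder for every positive `a < α`, and so is `F(∇u)`. Since `-α < β`, one can choose `a`
with `a + β > 0`, and then `F(∇u) b` is a well-defined element of `𝒞^β` (`exists_hol_fgrad`,
`exists_bb_prd`). Lipschitz derivatives of `F` make it locally Lipschitz in `u` (`exists_adm_nl`).
The heat semigroup maps `𝒞^β` to `𝒞^{α+1}` with norm of order `t^{-θ}`, `θ = (α+1-β)/2`, and `α - 1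
< β` says exactly that `θ < 1`. So the Duhamel integral converges and has size `t^{1-θ}`
(`exists_bb_duh`).

Hence the fixed point map contracts a ball on a time interval whose length depends only on bounds
for the initial value and for `b` (`exists_mild`). The same contraction, repeated on short steps,
gives uniqueness (`Mild.unique`). Solutions on compact intervals therefore fit together to a maximal
one (`exists_maximal`). A solution of norm at most `R` at time `t₀` lives on `[t₀, t₀ + h(R)]`, up
to time `T`. So near a time at which the solution ceases to exist the norm must eventually exceed
every `R`, which gives a limit and not only an upper limit (`tendsto_besovNorm_top`).

The harmonic analysis is done by duality. A bound of a Littlewood–Paley block in `L^∞` is a bound of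
`f ∘ lp hφ j` by the `L¹` norm of test functions (`BB`, `besovNorm_le_iff`). Blocks and heat flow
are moved to the test function, where they are convolutions with dilated Schwartz kernels, and
`exists_dil_bounds` estimates these uniformly in the scale. The product is a series in the blocks of
`b`, each paired with the `L¹` function `F(∇u) ψ` (`prd`). `IsMildSolution.mild` and
`isMildSolution_of_mild` translate between this formulation and the one in the statement. -/

/-- Test functions. -/
abbrev Test (d : ℕ) : Type := 𝓢(Space d, ℂ)

/-! ### The `L¹` norm on test functions, and its invariance under translations. -/

/-- The `L¹` norm of a test function. -/
def l1 (ψ : Test d) : ℝ := ∫ x, ‖ψ x‖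

/-- Translation of test functions. -/
abbrev tr (z : Space d) : Test d →L[ℂ] Test d := SchwartzMap.compSubConstCLM ℂ z

/-- The action on test functions of the Fourier multiplier with symbol `m` (the transpose of the
one on tempered distributions). -/
def mult (m : Space d → ℂ) (u : Test d) : Test d := 𝓕 (SchwartzMap.smulLeftCLM ℂ m (𝓕⁻ u))

lemma l1_eq (ψ : Test d) : l1 ψ = ‖ψ.toLp 1 (volume : Measure (Space d))‖ :=
  SchwartzMap.norm_toLp_one.symm

lemma l1_nonneg (ψ : Test d) : 0 ≤ l1 ψ := integral_nonneg fun _ => norm_nonneg _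

lemma toLp_sub (φ ψ : Test d) :
    (φ - ψ).toLp 1 (volume : Measure (Space d)) = φ.toLp 1 volume - ψ.toLp 1 volume :=
  map_sub (SchwartzMap.toLpCLM ℂ ℂ 1 (volume : Measure (Space d))) φ ψ

lemma l1_sub_le (φ ψ : Test d) : l1 (φ - ψ) ≤ l1 φ + l1 ψ := by
  simp only [l1_eq, toLp_sub]; exact norm_sub_le _ _

lemma l1_smul (c : ℂ) (ψ : Test d) : l1 (c • ψ) = ‖c‖ * l1 ψ := by
  simp [l1, integral_const_mul]

lemma l1_neg (ψ : Test d) : l1 (-ψ) = l1 ψ := by simp [l1]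

lemma continuous_l1 : Continuous (l1 : Test d → ℝ) := by
  have : (l1 : Test d → ℝ) = fun ψ => ‖ψ.toLp 1 (volume : Measure (Space d))‖ := funext l1_eq
  rw [this]
  fun_prop

lemma l1_tr (z : Space d) (ψ : Test d) : l1 (tr z ψ) = l1 ψ := by
  simpa [l1] using integral_sub_right_eq_self (fun x => ‖ψ x‖) z

/-! ### Multipliers -/

lemma mult_apply_sub (m : Space d → ℂ) (u v : Test d) :
    mult m (u - v) = mult m u - mult m v := by
  have h : ∀ w, mult m w = (FourierTransform.fourierCLM ℂ (Test d) ∘L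
      SchwartzMap.smulLeftCLM ℂ m ∘L FourierTransform.fourierInvCLM ℂ (Test d)) w := fun _ => rfl
  rw [h, h, h, map_sub]

lemma mult_mult {m n : Space d → ℂ} (hm : m.HasTemperateGrowth) (hn : n.HasTemperateGrowth)
    (u : Test d) : mult m (mult n u) = mult (fun x => m x * n x) u := by
  simp only [mult, FourierTransform.fourierInv_fourier_eq]
  rw [SchwartzMap.smulLeftCLM_smulLeftCLM_apply hm hn]
  rfl

lemma mult_comm {m n : Space d → ℂ} (hm : m.HasTemperateGrowth) (hn : n.HasTemperateGrowth)
    (u : Test d) : mult m (mult n u) = mult n (mult m u) := by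
  rw [mult_mult hm hn, mult_mult hn hm]
  simp only [mul_comm]

/-- Both sides are the convolution of `𝓕 m` and `u`. The symmetry lets increments be taken on the
kernel instead of on `u`. -/
lemma mult_swap (m u : Test d) : mult m u = mult (𝓕⁻ u : Test d) (𝓕 m) := by
  unfold mult
  congr 1
  ext x
  rw [FourierTransform.fourierInv_fourier_eq,
    SchwartzMap.smulLeftCLM_apply_apply m.hasTemperateGrowth,
    SchwartzMap.smulLeftCLM_apply_apply (𝓕⁻ u : Test d).hasTemperateGrowth, smul_eq_mul, smul_eq_mul,
    mul_comm]

lemma mult_eq_integral (m u : Test d) (x : Space d) :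
    mult m u x = ∫ z, 𝓕 m z * u (x - z) := by
  -- Reflection turns the outer `𝓕` into `𝓕⁻`, which cancels the `𝓕` from the convolution theorem.
  -- The reflections in `h3` and `h4` disappear under `z ↦ -z`.
  have h1 : mult m u x = 𝓕⁻ (SchwartzMap.smulLeftCLM ℂ m (𝓕⁻ u)) (-x) := by
    rw [SchwartzMap.fourierInv_apply_eq]
    simp [mult]
  have h2 : SchwartzMap.smulLeftCLM ℂ m (𝓕⁻ u) =
      𝓕 (SchwartzMap.convolution (ContinuousLinearMap.mul ℂ ℂ) (𝓕⁻ m) (𝓕⁻ (𝓕⁻ u))) := by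
    rw [SchwartzMap.fourier_convolution]
    ext y
    simp [SchwartzMap.smulLeftCLM_apply_apply m.hasTemperateGrowth]
  have h3 : ∀ y, 𝓕⁻ (𝓕⁻ u) y = u (-y) := by
    intro y
    rw [SchwartzMap.fourierInv_apply_eq]
    simp
  have h4 : ∀ y, 𝓕⁻ m y = 𝓕 m (-y) := by
    intro y
    rw [SchwartzMap.fourierInv_apply_eq]
    simp
  rw [h1, h2, FourierTransform.fourierInv_fourier_eq, SchwartzMap.convolution_apply,
    convolution_def, ← integral_neg_eq_self]
  refine integral_congr_ae (Eventually.of_forall fun z => ?_)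
  simp only [ContinuousLinearMap.mul_apply', h3, h4, neg_neg]
  congr 2
  abel

lemma tr_mult (m u : Test d) (z : Space d) : tr z (mult m u) = mult m (tr z u) := by
  ext x
  simp only [SchwartzMap.compSubConstCLM_apply, mult_eq_integral]
  refine integral_congr_ae (Eventually.of_forall fun y => ?_)
  simp only
  congr 2
  abel

/-- Fourier inversion at the origin. A symbol with `m 0 = 1` thus gives an approximate identity, and
one with `m 0 = 0` a kernel that kills constants. -/
lemma integral_fourier (m : Test d) : ∫ z, 𝓕 m z = m 0 := by
  have h : 𝓕⁻ (𝓕 m) 0 = m 0 := by simp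
  rw [← h, SchwartzMap.fourierInv_coe, Real.fourierInv_eq]
  simp

/-- Minkowski's inequality for integrals, in `L¹`. -/
lemma integral_norm_integral_le {ι : Type*} [MeasurableSpace ι] {μ : Measure ι} [SFinite μ]
    {v : ι → Space d → ℂ} (hv : AEStronglyMeasurable (Function.uncurry v) (μ.prod volume))
    {c : ι → ℝ} (hc : Integrable c μ) (hcv : ∀ z, ∫⁻ x, ‖v z x‖ₑ ≤ ENNReal.ofReal (c z))
    (hc0 : ∀ z, 0 ≤ c z) :
    ∫ x, ‖∫ z, v z x ∂μ‖ ≤ ∫ z, c z ∂μ := by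
  have h1 : ∫⁻ x, ‖∫ z, v z x ∂μ‖ₑ ≤ ENNReal.ofReal (∫ z, c z ∂μ) := calc
    _ ≤ ∫⁻ x, ∫⁻ z, ‖v z x‖ₑ ∂μ := lintegral_mono fun x => enorm_integral_le_lintegral_enorm _
    _ = ∫⁻ z, (∫⁻ x, ‖v z x‖ₑ) ∂μ := (lintegral_lintegral_swap hv.enorm).symm
    _ ≤ ∫⁻ z, ENNReal.ofReal (c z) ∂μ := lintegral_mono hcv
    _ = _ := (ofReal_integral_eq_lintegral_ofReal hc (Eventually.of_forall hc0)).symm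
  have h0 : 0 ≤ ∫ z, c z ∂μ := integral_nonneg hc0
  have h2 : AEStronglyMeasurable (fun x => ∫ z, v z x ∂μ) volume :=
    hv.prod_swap.integral_prod_right'
  rw [integral_norm_eq_lintegral_enorm h2]
  exact ENNReal.toReal_le_of_le_ofReal h0 h1

lemma lintegral_enorm_test (ψ : Test d) : ∫⁻ x, ‖ψ x‖ₑ = ENNReal.ofReal (l1 ψ) := by
  rw [l1, ofReal_integral_norm_eq_lintegral_enorm ψ.integrable]

lemma integrable_pow_norm_mul_kernel (κ : Test d) {a : ℝ} (ha : 0 ≤ a) :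
    Integrable fun z => ‖κ z‖ * ‖z‖ ^ a := by
  obtain ⟨n, hn⟩ := exists_nat_ge a
  have h1 := (SchwartzMap.integrable_pow_mul volume κ n)
  have h0 := κ.integrable (μ := (volume : Measure (Space d))).norm
  refine (h0.add h1).mono' ?_ (Eventually.of_forall fun z => ?_)
  · exact (κ.continuous.norm.mul (continuous_norm.rpow_const fun _ => Or.inr ha)).aestronglyMeasurable
  · rw [Real.norm_of_nonneg (by positivity)]
    simp only [Pi.add_apply]
    have : ‖z‖ ^ a ≤ 1 + ‖z‖ ^ n := by
      rcases le_total ‖z‖ 1 with h | h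
      · have := Real.rpow_le_one (norm_nonneg z) h ha
        have := pow_nonneg (norm_nonneg z) n
        linarith
      · have := Real.rpow_le_rpow_of_exponent_le h hn
        rw [Real.rpow_natCast] at this
        linarith
    nlinarith [norm_nonneg (κ z)]

lemma l1_mult_le (m u : Test d) : l1 (mult m u) ≤ l1 (𝓕 m) * l1 u := by
  have := integral_norm_integral_le (μ := (volume : Measure (Space d)))
    (v := fun z x => 𝓕 m z * u (x - z)) (c := fun z => ‖𝓕 m z‖ * l1 u) ?_
    ((𝓕 m).integrable.norm.mul_const _) ?_ (fun z => mul_nonneg (norm_nonneg _) (l1_nonneg _))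
  · rw [integral_mul_const] at this
    simpa only [l1, mult_eq_integral] using this
  · exact Continuous.aestronglyMeasurable (by
      simp only [Function.uncurry_def]
      exact ((𝓕 m).continuous.comp continuous_fst).mul
        (u.continuous.comp (continuous_snd.sub continuous_fst)))
  · intro z
    simp only [enorm_mul]
    rw [lintegral_const_mul' _ _ enorm_ne_top, ENNReal.ofReal_mul (norm_nonneg _),
      ofReal_norm]
    have := lintegral_enorm_test (tr z u)
    rw [l1_tr] at this
    simp only [SchwartzMap.compSubConstCLM_apply] at this
    rw [this]

lemma mult_sub_eq_integral (m u : Test d) (x : Space d) :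
    (mult m u - m 0 • u) x = ∫ z, 𝓕 m z * (u (x - z) - u x) := by
  simp only [sub_apply, smul_apply, mult_eq_integral, mul_sub]
  rw [integral_sub, integral_mul_const, integral_fourier, smul_eq_mul]
  · obtain ⟨C, hC⟩ : ∃ C, ∀ y, ‖u y‖ ≤ C := ⟨_, fun y => u.norm_le_seminorm ℂ y⟩
    exact (𝓕 m).integrable.mul_bdd
      (u.continuous.comp (continuous_const.sub continuous_id)).aestronglyMeasurable
      (Eventually.of_forall fun z => hC _)
  · exact (𝓕 m).integrable.mul_const _

/-- The moment of order `a` of the kernel absorbs the `L¹` Hölder modulus of `u`. After dilation the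
moment scales like `r ^ a`, which is the source of every gain of decay below. -/
lemma l1_mult_sub_le (m u : Test d) {a D : ℝ} (ha : 0 ≤ a) (hD : 0 ≤ D)
    (h : ∀ z, l1 (tr z u - u) ≤ D * ‖z‖ ^ a) :
    l1 (mult m u - m 0 • u) ≤ (∫ z, ‖𝓕 m z‖ * ‖z‖ ^ a) * D := by
  have := integral_norm_integral_le (μ := (volume : Measure (Space d)))
    (v := fun z x => 𝓕 m z * (u (x - z) - u x)) (c := fun z => ‖𝓕 m z‖ * ‖z‖ ^ a * D) ?_
    ((integrable_pow_norm_mul_kernel _ ha).mul_const _) ?_ (fun z => by positivity)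
  · rw [integral_mul_const] at this
    rw [l1]
    simpa only [mult_sub_eq_integral] using this
  · exact Continuous.aestronglyMeasurable (by
      simp only [Function.uncurry_def]
      exact ((𝓕 m).continuous.comp continuous_fst).mul
        ((u.continuous.comp (continuous_snd.sub continuous_fst)).sub
          (u.continuous.comp continuous_snd)))
  · intro z
    simp only [enorm_mul]
    rw [lintegral_const_mul' _ _ enorm_ne_top, mul_assoc, ENNReal.ofReal_mul (norm_nonneg _),
      ofReal_norm]
    gcongr
    have := lintegral_enorm_test (tr z u - u)
    simp only [SchwartzMap.compSubConstCLM_apply, sub_apply] at this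
    rw [this, mul_comm]
    exact ENNReal.ofReal_le_ofReal (h z)

/-! ### Translations in `L¹` -/

/-- The `L¹` norm of the gradient. -/
def l1grad (u : Test d) : ℝ := ∫ x, ‖SchwartzMap.fderivCLM ℂ (Space d) ℂ u x‖

lemma l1grad_nonneg (u : Test d) : 0 ≤ l1grad u := integral_nonneg fun _ => norm_nonneg _

lemma l1_tr_sub_le_grad (u : Test d) (z : Space d) : l1 (tr z u - u) ≤ ‖z‖ * l1grad u := by
  set u' := SchwartzMap.fderivCLM ℂ (Space d) ℂ u with hu'
  have key : ∀ x, (tr z u - u) x = ∫ s in Icc (0:ℝ) 1, - (u' (x - s • z) z) := by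
    intro x
    have hd : ∀ s ∈ uIcc (0:ℝ) 1, HasDerivAt (fun s : ℝ => u (x - s • z)) (-(u' (x - s • z) z)) s := by
      intro s _
      have h1 : HasDerivAt (fun s : ℝ => x - s • z) (-z) s := by
        simpa using ((hasDerivAt_id s).smul_const z).const_sub x
      have h2 := (u.hasFDerivAt (x - s • z)).comp_hasDerivAt s h1
      simpa [hu', Function.comp_def] using h2
    rw [integral_Icc_eq_integral_Ioc, ← intervalIntegral.integral_of_le zero_le_one,
      intervalIntegral.integral_eq_sub_of_hasDerivAt hd]
    · simp
    · apply Continuous.intervalIntegrable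
      exact (((u'.continuous.comp (continuous_const.sub (continuous_id.smul continuous_const)))).clm_apply
        continuous_const).neg
  have := integral_norm_integral_le (μ := (volume : Measure ℝ).restrict (Icc 0 1))
    (v := fun s x => - (u' (x - s • z) z)) (c := fun s => ‖z‖ * l1grad u) ?_
    (integrable_const _) ?_ (fun _ => mul_nonneg (norm_nonneg _) (l1grad_nonneg _))
  · rw [l1]
    simp only [key]
    simpa using this
  · exact Continuous.aestronglyMeasurable (by
      simp only [Function.uncurry_def]
      exact ((u'.continuous.comp (continuous_snd.sub (continuous_fst.smul continuous_const))).clm_apply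
        continuous_const).neg)
  · intro s
    calc ∫⁻ x, ‖-(u' (x - s • z) z)‖ₑ ≤ ∫⁻ x, ENNReal.ofReal ‖z‖ * ‖u' (x - s • z)‖ₑ := by
          refine lintegral_mono fun x => ?_
          rw [enorm_neg, ofReal_norm, mul_comm]
          exact ContinuousLinearMap.le_opENorm _ _
      _ = ENNReal.ofReal ‖z‖ * ∫⁻ x, ‖u' x‖ₑ := by
          rw [lintegral_const_mul' _ _ ENNReal.ofReal_ne_top,
            lintegral_sub_right_eq_self (fun x => ‖u' x‖ₑ) (s • z)]
      _ = _ := by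
          rw [ENNReal.ofReal_mul (norm_nonneg _), l1grad,
            ofReal_integral_norm_eq_lintegral_enorm u'.integrable]

lemma l1_tr_sub_le_two (u : Test d) (z : Space d) : l1 (tr z u - u) ≤ 2 * l1 u := by
  have := l1_sub_le (tr z u) u
  rw [l1_tr] at this
  linarith

/-- Interpolation: `t ≤ t ^ a` when `t ≤ 1`, and `1 ≤ t ^ a` when `t ≥ 1`. -/
lemma le_rpow_mul_of_le_of_le_mul {x A B t a : ℝ} (ht : 0 ≤ t) (hA : 0 ≤ A) (hB : 0 ≤ B)
    (ha0 : 0 ≤ a) (ha1 : a ≤ 1) (h1 : x ≤ A) (h2 : x ≤ t * B) : x ≤ (A + B) * t ^ a := by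
  rcases le_total t 1 with h | h
  · rcases eq_or_lt_of_le ht with rfl | ht'
    · rw [zero_mul] at h2
      exact h2.trans (by positivity)
    · have : t ≤ t ^ a := by
        simpa using Real.rpow_le_rpow_of_exponent_ge ht' h ha1
      nlinarith
  · have : 1 ≤ t ^ a := Real.one_le_rpow h ha0
    nlinarith

lemma l1_tr_sub_le (u : Test d) (z : Space d) {a : ℝ} (ha0 : 0 ≤ a) (ha1 : a ≤ 1) :
    l1 (tr z u - u) ≤ (2 * l1 u + l1grad u) * ‖z‖ ^ a :=
  le_rpow_mul_of_le_of_le_mul (norm_nonneg _) (by linarith [l1_nonneg u]) (l1grad_nonneg u)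
    ha0 ha1 (l1_tr_sub_le_two u z) (l1_tr_sub_le_grad u z)

/-! ### Scaled multipliers -/

/-- The symbol `m (λ ·)` as a test function. -/
def dil (m : Test d) (r : ℝ) : Test d :=
  if h : r = 0 then 0 else SchwartzMap.compCLMOfContinuousLinearEquiv ℂ
    (ContinuousLinearEquiv.smulLeft (Units.mk0 r h)) m

lemma dil_apply (m : Test d) {r : ℝ} (hr : r ≠ 0) (x : Space d) : dil m r x = m (r • x) := by
  simp only [dil, hr, dif_neg, not_false_eq_true,
    SchwartzMap.compCLMOfContinuousLinearEquiv_apply, Function.comp_apply]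
  rfl

lemma dil_zero (m : Test d) {r : ℝ} (hr : r ≠ 0) : dil m r 0 = m 0 := by
  simp [dil_apply m hr]

lemma fourier_dil (m : Test d) {r : ℝ} (hr : 0 < r) (x : Space d) :
    𝓕 (dil m r) x = ((r ^ d)⁻¹ : ℝ) • 𝓕 m (r⁻¹ • x) := by
  have h := Measure.integral_comp_smul (volume : Measure (Space d))
    (fun v : Space d => 𝐞 (-inner ℝ v (r⁻¹ • x)) • m v) r
  rw [SchwartzMap.fourier_coe, SchwartzMap.fourier_coe, Real.fourier_eq, Real.fourier_eq]
  simp only [finrank_euclideanSpace, Fintype.card_fin] at h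
  rw [abs_of_pos (by positivity)] at h
  rw [← h]
  refine integral_congr_ae (Eventually.of_forall fun v => ?_)
  simp only [dil_apply m hr.ne', inner_smul_left, inner_smul_right]
  congr 3
  simp
  field_simp

lemma integral_comp_dil_kernel (f : Space d → ℝ) {r : ℝ} (hr : 0 < r) :
    ∫ x, ((r ^ d)⁻¹ : ℝ) * f (r⁻¹ • x) = ∫ x, f x := by
  rw [integral_const_mul, Measure.integral_comp_smul, finrank_euclideanSpace, Fintype.card_fin,
    abs_of_pos (by positivity), smul_eq_mul, ← mul_assoc, inv_pow, inv_inv,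
    inv_mul_cancel₀ (by positivity), one_mul]

lemma l1_fourier_dil (m : Test d) {r : ℝ} (hr : 0 < r) : l1 (𝓕 (dil m r)) = l1 (𝓕 m) := by
  rw [l1, l1, ← integral_comp_dil_kernel (fun x => ‖𝓕 m x‖) hr]
  refine integral_congr_ae (Eventually.of_forall fun x => ?_)
  simp only [fourier_dil m hr, norm_smul, Real.norm_eq_abs]
  rw [abs_of_pos (by positivity)]

lemma moment_fourier_dil (m : Test d) {r a : ℝ} (hr : 0 < r) :
    ∫ z, ‖𝓕 (dil m r) z‖ * ‖z‖ ^ a = r ^ a * ∫ z, ‖𝓕 m z‖ * ‖z‖ ^ a := by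
  rw [← integral_const_mul,
    ← integral_comp_dil_kernel (fun x => r ^ a * (‖𝓕 m x‖ * ‖x‖ ^ a)) hr]
  refine integral_congr_ae (Eventually.of_forall fun x => ?_)
  simp only [fourier_dil m hr, norm_smul, Real.norm_eq_abs, norm_inv]
  rw [abs_of_pos (by positivity), Real.mul_rpow (by positivity) (norm_nonneg _), abs_of_pos hr,
    Real.inv_rpow hr.le]
  have : r ^ a ≠ 0 := by positivity
  field_simp

lemma l1_tr_fourier_dil (m : Test d) {r : ℝ} (hr : 0 < r) (z : Space d) :
    l1 (tr z (𝓕 (dil m r)) - 𝓕 (dil m r)) = l1 (tr (r⁻¹ • z) (𝓕 m) - 𝓕 m) := by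
  rw [l1, l1, ← integral_comp_dil_kernel (fun x => ‖(tr (r⁻¹ • z) (𝓕 m) - 𝓕 m) x‖) hr]
  refine integral_congr_ae (Eventually.of_forall fun x => ?_)
  simp only [sub_apply, SchwartzMap.compSubConstCLM_apply, fourier_dil m hr,
    ← smul_sub, norm_smul, Real.norm_eq_abs]
  rw [abs_of_pos (by positivity)]

/-- Estimates for the multipliers `m (r ·)` that are uniform in the scale `r > 0`. -/
lemma exists_dil_bounds (m : Test d) {a : ℝ} (ha0 : 0 ≤ a) (ha1 : a ≤ 1) :
    ∃ C, 0 ≤ C ∧ ∀ r, 0 < r →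
      (∀ u, l1 (mult (dil m r) u) ≤ C * l1 u) ∧
      (∀ u D, 0 ≤ D → (∀ z, l1 (tr z u - u) ≤ D * ‖z‖ ^ a) →
        l1 (mult (dil m r) u - m 0 • u) ≤ C * r ^ a * D) ∧
      (∀ u z, l1 (tr z (mult (dil m r) u) - mult (dil m r) u) ≤
        C * (r ^ a)⁻¹ * l1 u * ‖z‖ ^ a) := by
  refine ⟨l1 (𝓕 m) + (∫ z, ‖𝓕 m z‖ * ‖z‖ ^ a) + (2 * l1 (𝓕 m) + l1grad (𝓕 m)), ?_, ?_⟩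
  · have := l1_nonneg (𝓕 m)
    have := l1grad_nonneg (𝓕 m)
    positivity
  · have e1 := l1_nonneg (𝓕 m)
    have e2 := l1grad_nonneg (𝓕 m)
    have e3 : 0 ≤ ∫ z, ‖𝓕 m z‖ * ‖z‖ ^ a := by positivity
    intro r hr
    refine ⟨fun u => ?_, fun u D hD h => ?_, fun u z => ?_⟩
    · have := l1_mult_le (dil m r) u
      rw [l1_fourier_dil m hr] at this
      nlinarith [l1_nonneg u]
    · have := l1_mult_sub_le (dil m r) u ha0 hD h
      rw [moment_fourier_dil m hr, dil_zero m hr.ne'] at this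
      have : 0 ≤ r ^ a * D := by positivity
      nlinarith
    -- The increment is moved from `u` to the kernel. In `L¹`, the increment of the dilated kernel
    -- by `z` is that of `𝓕 m` by `r⁻¹ • z`, whence the factor `(r ^ a)⁻¹`.
    · rw [mult_swap, tr_mult, ← mult_apply_sub]
      have h1 := l1_mult_le (𝓕⁻ u : Test d) (tr z (𝓕 (dil m r)) - 𝓕 (dil m r))
      rw [FourierTransform.fourier_fourierInv_eq, l1_tr_fourier_dil m hr] at h1
      have h2 := l1_tr_sub_le (𝓕 m) (r⁻¹ • z) ha0 ha1
      rw [norm_smul, Real.norm_eq_abs, abs_of_pos (by positivity),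
        Real.mul_rpow (by positivity) (norm_nonneg _), Real.inv_rpow hr.le] at h2
      have h3 : 0 ≤ (r ^ a)⁻¹ * ‖z‖ ^ a := by positivity
      have h4 := l1_nonneg u
      have h5 := mul_nonneg h3 h4
      nlinarith

/-! ### Distributions that are bounded in `L^∞` -/

/-- The distribution `f` is bounded by `C` in the dual of `L¹`. -/
def LB (f : Distr d) (C : ℝ) : Prop := ∀ ψ : Test d, ‖f ψ‖ ≤ C * l1 ψ

/-- The distribution `f` is Hölder continuous with exponent `a` and constant `H`. -/
def HB (a : ℝ) (f : Distr d) (H : ℝ) : Prop :=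
  ∀ (z : Space d) (ψ : Test d), ‖f (tr z ψ - ψ)‖ ≤ H * ‖z‖ ^ a * l1 ψ

abbrev L1 (d : ℕ) : Type := Lp ℂ 1 (volume : Measure (Space d))

/-- The inclusion of test functions in `L¹`. -/
def toL1 : Test d →L[ℂ] L1 d := SchwartzMap.toLpCLM ℂ ℂ 1 volume

lemma norm_toL1 (ψ : Test d) : ‖toL1 ψ‖ = l1 ψ := (l1_eq ψ).symm

lemma denseRange_toL1 : DenseRange (toL1 : Test d → L1 d) :=
  SchwartzMap.denseRange_toLpCLM (by simp)

/-- The extension of a bounded distribution to `L¹`. -/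
def ext (f : Distr d) : L1 d →L[ℂ] ℂ :=
  LinearMap.extendOfNorm (LinearMapClass.linearMap f : Test d →ₗ[ℂ] ℂ)
    (toL1 : Test d →L[ℂ] L1 d).toLinearMap

lemma ext_toL1 {f : Distr d} {C : ℝ} (hf : LB f C) (ψ : Test d) : ext f (toL1 ψ) = f ψ :=
  LinearMap.extendOfNorm_eq (f := (LinearMapClass.linearMap f : Test d →ₗ[ℂ] ℂ))
    (e := (toL1 : Test d →L[ℂ] L1 d).toLinearMap) denseRange_toL1
    ⟨C, fun ψ => by simpa [norm_toL1] using hf ψ⟩ ψ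

lemma norm_ext_le {f : Distr d} {C : ℝ} (hf : LB f C) (h : L1 d) : ‖ext f h‖ ≤ C * ‖h‖ :=
  LinearMap.norm_extendOfNorm_apply_le denseRange_toL1 C
    (fun ψ => by simpa [norm_toL1] using hf ψ) h

lemma continuous_toL1_tr (u : Test d) : Continuous fun z : Space d => toL1 (tr z u) := by
  have : LipschitzWith (Real.toNNReal (l1grad u)) fun z : Space d => toL1 (tr z u) := by
    refine LipschitzWith.of_dist_le_mul fun z w => ?_
    rw [dist_eq_norm, dist_eq_norm, ← map_sub, norm_toL1,
      Real.coe_toNNReal _ (l1grad_nonneg u)]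
    have : tr z u - tr w u = tr w (tr (z - w) u - u) := by
      ext x
      simp only [map_sub, sub_apply, SchwartzMap.compSubConstCLM_apply]
      congr 2
      abel
    rw [this, l1_tr, mul_comm]
    exact l1_tr_sub_le_grad u _
  exact this.continuous

lemma eq_of_forall_integral_eq {g h : L1 d}
    (H : ∀ φ : Test d, ∫ x, φ x * g x = ∫ x, φ x * h x) : g = h := by
  have h0 : g - h ∈ (Lp.toTemperedDistributionCLM ℂ (volume : Measure (Space d)) 1).ker := by
    rw [LinearMap.mem_ker, ContinuousLinearMap.coe_coe, map_sub, sub_eq_zero]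
    ext φ
    simpa using H φ
  rw [Lp.ker_toTemperedDistributionCLM_eq_bot] at h0
  exact sub_eq_zero.1 (by simpa using h0)

/-- The convolution as a Bochner integral in `L¹`: a distribution bounded on `L¹` can then be taken
under the integral, as `apply_mult` does. -/
lemma toL1_mult (m u : Test d) : toL1 (mult m u) = ∫ z, 𝓕 m z • toL1 (tr z u) := by
  have hint : Integrable fun z => 𝓕 m z • toL1 (tr z u) := by
    refine ((𝓕 m).integrable.norm.mul_const (l1 u)).mono'
      ((𝓕 m).continuous.smul (continuous_toL1_tr u)).aestronglyMeasurable
      (Eventually.of_forall fun z => ?_)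
    rw [norm_smul, norm_toL1, l1_tr]
  refine eq_of_forall_integral_eq fun φ => ?_
  let E : L1 d →L[ℂ] ℂ := PointwiseConvergenceCLM.evalCLM (RingHom.id ℂ) ℂ φ ∘L
    Lp.toTemperedDistributionCLM ℂ (volume : Measure (Space d)) 1
  have hE : ∀ g : L1 d, E g = ∫ x, φ x * g x := fun g => by
    change Lp.toTemperedDistribution g φ = _
    simp
  have hEt : ∀ ψ : Test d, E (toL1 ψ) = ∫ x, φ x * ψ x := fun ψ => by
    rw [hE]
    refine integral_congr_ae ?_
    filter_upwards [ψ.coeFn_toLp 1 (volume : Measure (Space d))] with x hx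
    rw [← hx]; rfl
  rw [← hE, ← hE, ← E.integral_comp_comm hint, hEt]
  simp only [map_smul, hEt, mult_eq_integral, smul_eq_mul, ← integral_const_mul,
    SchwartzMap.compSubConstCLM_apply]
  have hF : Integrable (Function.uncurry fun x z => φ x * (𝓕 m z * u (x - z)))
      ((volume : Measure (Space d)).prod volume) := by
    have h1 := (φ.integrable (μ := (volume : Measure (Space d)))).mul_prod
      ((𝓕 m).integrable (μ := (volume : Measure (Space d))))
    have h2 := h1.mul_bdd (g := fun p : Space d × Space d => u (p.1 - p.2))
      (u.continuous.comp (continuous_fst.sub continuous_snd)).aestronglyMeasurable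
      (Eventually.of_forall fun p => u.norm_le_seminorm ℂ (p.1 - p.2))
    refine h2.congr (Eventually.of_forall fun p => ?_)
    simp only [Function.uncurry]
    ring
  rw [integral_integral_swap hF]
  refine integral_congr_ae (Eventually.of_forall fun z => integral_congr_ae
    (Eventually.of_forall fun x => ?_))
  simp only
  ring

lemma apply_mult {f : Distr d} {C : ℝ} (hf : LB f C) (m u : Test d) :
    f (mult m u) = ∫ z, 𝓕 m z * f (tr z u) := by
  have hint : Integrable fun z => 𝓕 m z • toL1 (tr z u) := by
    refine ((𝓕 m).integrable.norm.mul_const (l1 u)).mono'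
      ((𝓕 m).continuous.smul (continuous_toL1_tr u)).aestronglyMeasurable
      (Eventually.of_forall fun z => ?_)
    rw [norm_smul, norm_toL1, l1_tr]
  rw [← ext_toL1 hf, toL1_mult, ← (ext f).integral_comp_comm hint]
  simp only [map_smul, ext_toL1 hf, smul_eq_mul]

lemma continuous_apply_tr {f : Distr d} {C : ℝ} (hf : LB f C) (u : Test d) :
    Continuous fun z => f (tr z u) := by
  simp only [← ext_toL1 hf]
  exact (ext f).continuous.comp (continuous_toL1_tr u)

/-- The dual of `l1_mult_sub_le`: here the Hölder modulus belongs to the distribution and not to the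
test function. -/
lemma norm_apply_mult_sub_le {f : Distr d} {C H a : ℝ} (hf : LB f C) (ha : 0 ≤ a)
    (hH : HB a f H) (m u : Test d) :
    ‖f (mult m u) - m 0 * f u‖ ≤ (∫ z, ‖𝓕 m z‖ * ‖z‖ ^ a) * (H * l1 u) := by
  have hb : ∀ z, ‖f (tr z u)‖ ≤ C * l1 u := fun z => by simpa [l1_tr] using hf (tr z u)
  rw [apply_mult hf, ← integral_fourier, ← integral_mul_const, ← integral_sub,
    ← integral_mul_const]
  · refine (norm_integral_le_of_norm_le (g := fun z => ‖𝓕 m z‖ * ‖z‖ ^ a * (H * l1 u))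
      ((integrable_pow_norm_mul_kernel _ ha).mul_const _) (Eventually.of_forall fun z => ?_))
    rw [← mul_sub, ← map_sub, norm_mul, mul_assoc]
    gcongr
    refine (hH z u).trans_eq ?_
    ring
  · exact (𝓕 m).integrable.mul_bdd (continuous_apply_tr hf u).aestronglyMeasurable
      (Eventually.of_forall hb)
  · exact (𝓕 m).integrable.mul_const _

/-! ### The Gaussian -/

lemma exists_pow_mul_exp_le (n k : ℕ) : ∃ C : ℝ, ∀ r : ℝ, 0 ≤ r →
    r ^ k * (1 + r) ^ n * Real.exp (-((2 * Real.pi) ^ 2) * r ^ 2) ≤ C := by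
  refine ⟨(k + n).factorial * Real.exp 2, fun r hr => ?_⟩
  have h1 : r ^ k * (1 + r) ^ n ≤ (1 + r) ^ (k + n) := by
    rw [pow_add]; gcongr; linarith
  have h2 : (1 + r) ^ (k + n) ≤ (k + n).factorial * Real.exp (1 + r) := by
    have := Real.pow_div_factorial_le_exp (1 + r) (by positivity) (k + n)
    rw [div_le_iff₀ (by positivity)] at this
    linarith
  calc _ ≤ (k + n).factorial * Real.exp (1 + r) * Real.exp (-((2 * Real.pi) ^ 2) * r ^ 2) := by
        exact mul_le_mul_of_nonneg_right (h1.trans h2) (Real.exp_pos _).le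
    _ = (k + n).factorial * Real.exp (1 + r - (2 * Real.pi) ^ 2 * r ^ 2) := by
        rw [mul_assoc, ← Real.exp_add]; congr 2; ring
    _ ≤ _ := by
        gcongr
        have : 1 ≤ (2 * Real.pi) ^ 2 := by nlinarith [Real.pi_gt_three]
        nlinarith [sq_nonneg (r - 1), mul_le_mul_of_nonneg_right this (sq_nonneg r)]

lemma hasTemperateGrowth_heatExponent (c : ℝ) :
    Function.HasTemperateGrowth fun x : Space d => c * ‖x‖ ^ 2 :=
  (Function.HasTemperateGrowth.const c).mul
    (Function.hasTemperateGrowth_norm_sq (H := Space d))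

/-- The symbol of the heat semigroup at time `1`. -/
def gauss : Test d where
  toFun x := (Real.exp (-((2 * Real.pi) ^ 2) * ‖x‖ ^ 2) : ℂ)
  smooth' := by
    have : ContDiff ℝ (⊤ : ℕ∞) fun x : Space d => Real.exp (-((2 * Real.pi) ^ 2) * ‖x‖ ^ 2) :=
      Real.contDiff_exp.comp (contDiff_const.mul (contDiff_norm_sq ℝ))
    exact Complex.ofRealCLM.contDiff.comp this
  decay' k n := by
    obtain ⟨p, B, hB0, hB⟩ := (hasTemperateGrowth_heatExponent (d := d)
      (-((2 * Real.pi) ^ 2))).norm_iteratedFDeriv_le_uniform n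
    obtain ⟨C, hC⟩ := exists_pow_mul_exp_le (p * n) k
    refine ⟨n.factorial * (B + 1) ^ n * C, fun x => ?_⟩
    have h1 := Complex.ofRealLI.norm_iteratedFDeriv_comp_left
      (f := fun x : Space d => Real.exp (-((2 * Real.pi) ^ 2) * ‖x‖ ^ 2)) (x := x) (n := ((⊤ : ℕ∞) : WithTop ℕ∞)) (i := n)
      (Real.contDiff_exp.comp (contDiff_const.mul (contDiff_norm_sq ℝ))).contDiffAt
      (by exact_mod_cast le_top)
    -- All derivatives of `exp` have the same value, which serves as the constant `C`. The inner
    -- derivative of order `i ≥ 1` must be bounded by `D ^ i`; taking `B + 1` for `B` makes `D ≥ 1`,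
    -- so that `D ≤ D ^ i`.
    have h2 := norm_iteratedFDeriv_comp_le (𝕜 := ℝ) (g := Real.exp) (N := ((⊤ : ℕ∞) : WithTop ℕ∞)) (n := n)
      (f := fun x : Space d => -((2 * Real.pi) ^ 2) * ‖x‖ ^ 2)
      Real.contDiff_exp (contDiff_const.mul (contDiff_norm_sq ℝ)) (by exact_mod_cast le_top) x
      (C := Real.exp (-((2 * Real.pi) ^ 2) * ‖x‖ ^ 2)) (D := (B + 1) * (1 + ‖x‖) ^ p)
      (fun i _ => by
        rw [norm_iteratedFDeriv_eq_norm_iteratedDeriv, iteratedDeriv_eq_iterate,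
          Real.iter_deriv_exp, Real.norm_of_nonneg (Real.exp_pos _).le])
      (fun i hi1 hi => by
        have h3 : 1 ≤ (1 + ‖x‖) ^ p := one_le_pow₀ (by linarith [norm_nonneg x])
        refine (hB i hi x).trans ?_
        calc B * (1 + ‖x‖) ^ p ≤ (B + 1) * (1 + ‖x‖) ^ p := by gcongr; linarith
          _ ≤ ((B + 1) * (1 + ‖x‖) ^ p) ^ i :=
            le_self_pow₀ (by nlinarith) (by omega))
    change ‖x‖ ^ k * ‖iteratedFDeriv ℝ n (Complex.ofRealLI ∘
      fun x : Space d => Real.exp (-((2 * Real.pi) ^ 2) * ‖x‖ ^ 2)) x‖ ≤ _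
    rw [h1]
    calc _ ≤ ‖x‖ ^ k * (n.factorial * Real.exp (-((2 * Real.pi) ^ 2) * ‖x‖ ^ 2) *
          ((B + 1) * (1 + ‖x‖) ^ p) ^ n) := by gcongr; exact h2
      _ = n.factorial * (B + 1) ^ n * (‖x‖ ^ k * (1 + ‖x‖) ^ (p * n) *
          Real.exp (-((2 * Real.pi) ^ 2) * ‖x‖ ^ 2)) := by
          rw [mul_pow _ _ n, ← pow_mul]; ring
      _ ≤ _ := by gcongr; exact hC _ (norm_nonneg x)

lemma gauss_apply (x : Space d) :
    gauss x = (Real.exp (-((2 * Real.pi) ^ 2) * ‖x‖ ^ 2) : ℂ) := rfl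

lemma gauss_zero : gauss (0 : Space d) = 1 := by simp [gauss_apply]

/-- Positivity makes the `L¹` norm of the heat kernel equal to its mass `gauss 0 = 1`, so that the
heat flow contracts `L¹`. Reality of the kernel preserves real distributions. -/
lemma fourier_gauss_nonneg : ∃ G : Space d → ℝ, (∀ x, 0 ≤ G x) ∧ ∀ x, 𝓕 gauss x = (G x : ℂ) := by
  refine ⟨fun w => (Real.pi / (2 * Real.pi) ^ 2) ^ ((d : ℝ) / 2) *
    Real.exp (-Real.pi ^ 2 * ‖w‖ ^ 2 / (2 * Real.pi) ^ 2), fun w => by positivity, fun w => ?_⟩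
  have hb : 0 < (((2 * Real.pi) ^ 2 : ℝ) : ℂ).re := by
    rw [Complex.ofReal_re]; positivity
  have h := fourier_gaussian_innerProductSpace hb w
  rw [SchwartzMap.fourier_coe]
  have e : (gauss : Space d → ℂ) =
      fun v => Complex.exp (-(((2 * Real.pi) ^ 2 : ℝ) : ℂ) * (‖v‖ : ℂ) ^ 2) := by
    funext v
    rw [gauss_apply]
    push_cast
    rfl
  rw [e, h]
  simp only [finrank_euclideanSpace, Fintype.card_fin]
  rw [Complex.ofReal_mul, Complex.ofReal_cpow (by positivity)]
  push_cast
  rfl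

/-- The heat kernel. -/
def heatKernel (r : ℝ) : Test d := 𝓕 (dil gauss r)

lemma heatKernel_nonneg {r : ℝ} (hr : 0 < r) :
    ∃ G : Space d → ℝ, (∀ x, 0 ≤ G x) ∧ ∀ x, heatKernel r x = (G x : ℂ) := by
  obtain ⟨G, hG, h⟩ := fourier_gauss_nonneg (d := d)
  refine ⟨fun x => (r ^ d)⁻¹ * G (r⁻¹ • x), fun x => mul_nonneg (by positivity) (hG _),
    fun x => ?_⟩
  rw [heatKernel, fourier_dil _ hr, h]
  simp

lemma heatKernel_im {r : ℝ} (hr : 0 < r) (x : Space d) : (heatKernel r x).im = 0 := by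
  obtain ⟨G, -, h⟩ := heatKernel_nonneg (d := d) hr
  simp [h]

lemma l1_heatKernel {r : ℝ} (hr : 0 < r) : l1 (heatKernel r : Test d) = 1 := by
  obtain ⟨G, hG, h⟩ := heatKernel_nonneg (d := d) hr
  have h1 : ∫ x : Space d, heatKernel r x = (1 : ℂ) := by
    rw [heatKernel, integral_fourier, dil_zero _ hr.ne', gauss_zero]
  simp only [l1, h, Complex.norm_real, Real.norm_of_nonneg (hG _)]
  simp only [h] at h1
  rw [integral_complex_ofReal] at h1
  exact_mod_cast h1

lemma mult_heatKernel (r s : ℝ) :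
    mult (dil gauss r) (heatKernel s : Test d) = mult (dil gauss s) (heatKernel r) := by
  rw [mult_swap, heatKernel, FourierTransform.fourierInv_fourier_eq, heatKernel]

/-! ### Representing functions -/

/-- The continuous function that represents a Hölder continuous distribution. -/
def rep (f : Distr d) (x : Space d) : ℂ :=
  limUnder atTop fun n : ℕ => f (tr x (heatKernel ((1 / 2) ^ n)))

section rep

variable {f : Distr d} {C H a : ℝ}

lemma norm_apply_heat_sub_le (hf : LB f C) (ha : 0 ≤ a) (hH : HB a f H) {r : ℝ} (hr : 0 < r)
    (u : Test d) : ‖f (mult (dil gauss r) u) - f u‖ ≤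
      r ^ a * ((∫ z : Space d, ‖𝓕 gauss z‖ * ‖z‖ ^ a) * (H * l1 u)) := by
  have := norm_apply_mult_sub_le hf ha hH (dil gauss r) u
  rw [dil_zero _ hr.ne', gauss_zero, one_mul, moment_fourier_dil _ hr] at this
  linarith

lemma tendsto_half_pow_rpow (ha : 0 < a) :
    Tendsto (fun n : ℕ => ((1 / 2 : ℝ) ^ n) ^ a) atTop (𝓝 0) := by
  have h := (tendsto_pow_atTop_nhds_zero_of_lt_one (r := (1 / 2 : ℝ)) (by norm_num)
    (by norm_num)).rpow_const (p := a) (Or.inr ha.le)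
  rwa [Real.zero_rpow ha.ne'] at h

/-- Heat averages at the scales `r` and `s` are both compared with the average smoothed at both
scales, which is symmetric in `r` and `s` (`mult_heatKernel`). They differ by `O(r ^ a + s ^ a)`, so
dyadic scales give a Cauchy sequence. -/
lemma tendsto_rep (hf : LB f C) (ha : 0 < a) (hH : HB a f H) (x : Space d) :
    Tendsto (fun n : ℕ => f (tr x (heatKernel ((1 / 2) ^ n)))) atTop (𝓝 (rep f x)) := by
  refine CauchySeq.tendsto_limUnder ?_
  set M := (∫ z : Space d, ‖𝓕 gauss z‖ * ‖z‖ ^ a) * H with hM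
  have h1 : ∀ r s : ℝ, 0 < r → 0 < s →
      ‖f (mult (dil gauss r) (tr x (heatKernel s))) - f (tr x (heatKernel s))‖ ≤ r ^ a * M := by
    intro r s hr hs
    have := norm_apply_heat_sub_le hf ha.le hH hr (tr x (heatKernel s))
    rw [l1_tr, l1_heatKernel hs, mul_one] at this
    exact this
  have h2 : ∀ r s : ℝ, 0 < r → 0 < s →
      ‖f (tr x (heatKernel r)) - f (tr x (heatKernel s))‖ ≤ r ^ a * M + s ^ a * M := by
    intro r s hr hs
    have e : mult (dil gauss r) (tr x (heatKernel s : Test d)) =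
        mult (dil gauss s) (tr x (heatKernel r)) := by
      rw [← tr_mult, ← tr_mult, mult_heatKernel]
    have h3 := h1 r s hr hs
    have h4 := h1 s r hs hr
    rw [← e] at h4
    have := norm_sub_le_norm_sub_add_norm_sub (f (tr x (heatKernel r)))
      (f (mult (dil gauss r) (tr x (heatKernel s)))) (f (tr x (heatKernel s)))
    rw [norm_sub_rev (f (tr x (heatKernel r))) (f (mult _ _))] at this
    linarith
  have hM0 : 0 ≤ M := by
    have := (norm_nonneg _).trans (h1 1 1 one_pos one_pos)
    simpa using this
  refine cauchySeq_of_le_tendsto_0 (fun n : ℕ => 2 * (((1 / 2 : ℝ) ^ n) ^ a * M)) ?_ ?_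
  · intro n m N hn hm
    rw [dist_eq_norm]
    refine (h2 _ _ (by positivity) (by positivity)).trans ?_
    have e1 : ((1 / 2 : ℝ) ^ n) ^ a ≤ ((1 / 2 : ℝ) ^ N) ^ a :=
      Real.rpow_le_rpow (by positivity) (pow_le_pow_of_le_one (by norm_num) (by norm_num) hn) ha.le
    have e2 : ((1 / 2 : ℝ) ^ m) ^ a ≤ ((1 / 2 : ℝ) ^ N) ^ a :=
      Real.rpow_le_rpow (by positivity) (pow_le_pow_of_le_one (by norm_num) (by norm_num) hm) ha.le
    nlinarith
  · simpa using ((tendsto_half_pow_rpow ha).mul_const M).const_mul 2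

lemma norm_rep_le (hf : LB f C) (ha : 0 < a) (hH : HB a f H) (x : Space d) : ‖rep f x‖ ≤ C := by
  refine le_of_tendsto (tendsto_rep hf ha hH x).norm (Eventually.of_forall fun n => ?_)
  have := hf (tr x (heatKernel ((1 / 2) ^ n)))
  rwa [l1_tr, l1_heatKernel (by positivity), mul_one] at this

lemma norm_rep_sub_le (hf : LB f C) (ha : 0 < a) (hH : HB a f H) (x y : Space d) :
    ‖rep f x - rep f y‖ ≤ H * ‖x - y‖ ^ a := by
  refine le_of_tendsto ((tendsto_rep hf ha hH x).sub (tendsto_rep hf ha hH y)).norm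
    (Eventually.of_forall fun n => ?_)
  have := hH (x - y) (tr y (heatKernel ((1 / 2) ^ n)))
  rw [l1_tr, l1_heatKernel (by positivity), mul_one] at this
  rw [← map_sub]
  rwa [SchwartzMap.compSubConstCLM_comp, add_sub_cancel] at this

lemma continuous_of_holder {E F : Type*} [NormedAddCommGroup E] [NormedAddCommGroup F]
    {w : E → F} {H a : ℝ} (ha : 0 < a)
    (h : ∀ x y, ‖w x - w y‖ ≤ H * ‖x - y‖ ^ a) : Continuous w := by
  refine continuous_iff_continuousAt.2 fun x => ?_
  rw [ContinuousAt, tendsto_iff_norm_sub_tendsto_zero]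
  have h1 : Tendsto (fun y => H * ‖y - x‖ ^ a) (𝓝 x) (𝓝 (H * ‖x - x‖ ^ a)) :=
    (((continuous_id.sub continuous_const).norm.rpow_const fun _ => Or.inr ha.le).const_mul
      H).tendsto x
  rw [sub_self, norm_zero, Real.zero_rpow ha.ne', mul_zero] at h1
  exact squeeze_zero (fun _ => norm_nonneg _) (fun y => h y x) h1

lemma continuous_rep (hf : LB f C) (ha : 0 < a) (hH : HB a f H) : Continuous (rep f) :=
  continuous_of_holder ha (norm_rep_sub_le hf ha hH)

/-- Smoothing `ψ` by the heat kernel changes `f ψ` by a vanishing amount, and `f` of the smoothed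
`ψ` is the integral of `ψ` against the heat averages of `f`. These are bounded by `C` and converge
to `rep f`. -/
lemma apply_eq_integral_rep (hf : LB f C) (ha : 0 < a) (hH : HB a f H) (ψ : Test d) :
    f ψ = ∫ x, ψ x * rep f x := by
  have h1 : Tendsto (fun n : ℕ => f (mult (dil gauss ((1 / 2) ^ n)) ψ)) atTop (𝓝 (f ψ)) := by
    rw [tendsto_iff_norm_sub_tendsto_zero]
    refine squeeze_zero (fun _ => norm_nonneg _)
      (fun n => norm_apply_heat_sub_le hf ha.le hH (by positivity) ψ) ?_
    simpa using (tendsto_half_pow_rpow ha).mul_const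
      ((∫ z : Space d, ‖𝓕 gauss z‖ * ‖z‖ ^ a) * (H * l1 ψ))
  refine tendsto_nhds_unique h1 ?_
  have h2 : ∀ n : ℕ, f (mult (dil gauss ((1 / 2) ^ n)) ψ) =
      ∫ x, ψ x * f (tr x (heatKernel ((1 / 2) ^ n))) := by
    intro n
    rw [mult_swap, apply_mult hf, FourierTransform.fourier_fourierInv_eq]
    rfl
  simp only [h2]
  refine tendsto_integral_of_dominated_convergence (fun x => ‖ψ x‖ * C) ?_
    (ψ.integrable.norm.mul_const C) ?_ ?_
  · intro n
    exact (ψ.continuous.mul (continuous_apply_tr hf _)).aestronglyMeasurable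
  · intro n
    refine Eventually.of_forall fun x => ?_
    rw [norm_mul]
    gcongr
    have := hf (tr x (heatKernel ((1 / 2) ^ n)))
    rwa [l1_tr, l1_heatKernel (by positivity), mul_one] at this
  · exact Eventually.of_forall fun x => (tendsto_rep hf ha hH x).const_mul _

lemma rep_sub {g : Distr d} {C' H' : ℝ} (hf : LB f C) (ha : 0 < a) (hH : HB a f H)
    (hg : LB g C') (hH' : HB a g H') (x : Space d) : rep (f - g) x = rep f x - rep g x :=
  Tendsto.limUnder_eq ((tendsto_rep hf ha hH x).sub (tendsto_rep hg ha hH' x))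

end rep

/-! ### Low frequency cut-offs converge -/

lemma norm_iteratedFDeriv_dil_le (m : Test d) {r : ℝ} (hr : 0 < r) (i : ℕ) (x : Space d) :
    ‖iteratedFDeriv ℝ i (dil m r) x‖ ≤ r ^ i * SchwartzMap.seminorm ℝ 0 i m := by
  have e : (dil m r : Space d → ℂ) = m ∘ (r • ContinuousLinearMap.id ℝ (Space d)) := by
    funext y
    simp [dil_apply m hr.ne']
  rw [e, ContinuousLinearMap.iteratedFDeriv_comp_right _ (m.smooth i) x le_rfl]
  refine (ContinuousMultilinearMap.norm_compContinuousLinearMap_le _ _).trans ?_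
  rw [mul_comm]
  gcongr
  · rw [Finset.prod_const, Finset.card_univ, Fintype.card_fin]
    gcongr
    refine (norm_smul_le _ _).trans ?_
    rw [Real.norm_of_nonneg hr.le]
    exact mul_le_of_le_one_right hr.le ContinuousLinearMap.norm_id_le
  · exact m.norm_iteratedFDeriv_le_seminorm ℝ i _

lemma norm_dil_sub_one_le (m : Test d) (hm : m 0 = 1) {r : ℝ} (hr : 0 < r) (x : Space d) :
    ‖dil m r x - 1‖ ≤ r * ‖x‖ * SchwartzMap.seminorm ℝ 0 1 m := by
  rw [dil_apply m hr.ne', ← hm]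
  have := Convex.norm_image_sub_le_of_norm_fderiv_le (𝕜 := ℝ) (f := m) (s := univ)
    (C := SchwartzMap.seminorm ℝ 0 1 m) (fun y _ => m.differentiableAt)
    (fun y _ => by
      rw [← norm_iteratedFDeriv_one]; exact m.norm_iteratedFDeriv_le_seminorm ℝ 1 y)
    convex_univ (mem_univ 0) (mem_univ (r • x))
  rw [sub_zero, norm_smul, Real.norm_of_nonneg hr.le] at this
  linarith

/-- Order zero is the mean value theorem and costs a factor `‖x‖`; a derivative of order `i ≥ 1`
carries `r ^ i ≤ r`. -/
lemma norm_iteratedFDeriv_dil_sub_one_le (m : Test d) (hm : m 0 = 1) (l : ℕ) :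
    ∃ B, 0 ≤ B ∧ ∀ r, 0 < r → r ≤ 1 → ∀ i ≤ l, ∀ x,
      ‖iteratedFDeriv ℝ i (fun y => dil m r y - 1) x‖ ≤ r * B * (1 + ‖x‖) := by
  have hn : ∀ i, 0 ≤ SchwartzMap.seminorm ℝ 0 i m := fun i => apply_nonneg _ _
  obtain ⟨S, hS⟩ : ∃ S, ∀ i ≤ l, SchwartzMap.seminorm ℝ 0 i m ≤ S :=
    ⟨∑ i ∈ Finset.range (l + 1), SchwartzMap.seminorm ℝ 0 i m, fun i hi =>
      Finset.single_le_sum (f := fun i => SchwartzMap.seminorm ℝ 0 i m)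
        (fun i _ => hn i) (Finset.mem_range.2 (by omega))⟩
  have hS0 : 0 ≤ S := (hn 0).trans (hS 0 (Nat.zero_le _))
  refine ⟨SchwartzMap.seminorm ℝ 0 1 m + S, add_nonneg (hn 1) hS0, fun r hr hr1 i hi x => ?_⟩
  have h0 := hn 1
  have hx := norm_nonneg x
  rcases Nat.eq_zero_or_pos i with rfl | hi0
  · rw [norm_iteratedFDeriv_zero]
    refine (norm_dil_sub_one_le m hm hr x).trans ?_
    have : 0 ≤ SchwartzMap.seminorm ℝ 0 1 m + S + S * ‖x‖ := by positivity
    nlinarith [mul_nonneg hr.le this]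
  · have e : iteratedFDeriv ℝ i (fun y => dil m r y - 1) x = iteratedFDeriv ℝ i (dil m r) x := by
      have := iteratedFDeriv_sub_apply (𝕜 := ℝ) (f := (dil m r : Space d → ℂ)) (i := i) (x := x)
        (g := fun _ => (1 : ℂ)) ((dil m r).smooth i).contDiffAt contDiffAt_const
      have h2 := iteratedFDeriv_const_of_ne (𝕜 := ℝ) (E := Space d) hi0.ne' (1 : ℂ)
      rw [h2, Pi.zero_apply, sub_zero] at this
      exact this
    rw [e]
    refine (norm_iteratedFDeriv_dil_le m hr i x).trans ?_
    have h1 : r ^ i ≤ r := pow_le_of_le_one hr.le hr1 hi0.ne'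
    have h2 := hS i hi
    have h3 := hn i
    calc r ^ i * SchwartzMap.seminorm ℝ 0 i m ≤ r * (SchwartzMap.seminorm ℝ 0 1 m + S) := by
          gcongr; linarith
      _ ≤ _ := le_mul_of_one_le_right (by positivity) (by linarith)

/-- Leibniz rule with the previous bound; its weight `1 + ‖x‖` is paid for by the Schwartz seminorms
of `v` with one more power of `‖x‖`. -/
lemma seminorm_smulLeft_dil_sub_le (m : Test d) (hm : m 0 = 1) (v : Test d) (k l : ℕ) :
    ∃ C, ∀ r, 0 < r → r ≤ 1 →
      SchwartzMap.seminorm ℝ k l (SchwartzMap.smulLeftCLM ℂ (dil m r) v - v) ≤ r * C := by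
  obtain ⟨B, hB0, hB⟩ := norm_iteratedFDeriv_dil_sub_one_le m hm l
  refine ⟨∑ i ∈ Finset.range (l + 1), (l.choose i : ℝ) * (B *
    (SchwartzMap.seminorm ℝ k (l - i) v + SchwartzMap.seminorm ℝ (k + 1) (l - i) v)),
    fun r hr hr1 => ?_⟩
  have hC : 0 ≤ ∑ i ∈ Finset.range (l + 1), (l.choose i : ℝ) * (B *
      (SchwartzMap.seminorm ℝ k (l - i) v + SchwartzMap.seminorm ℝ (k + 1) (l - i) v)) :=
    Finset.sum_nonneg fun i _ => mul_nonneg (Nat.cast_nonneg _)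
      (mul_nonneg hB0 (add_nonneg (apply_nonneg _ _) (apply_nonneg _ _)))
  refine SchwartzMap.seminorm_le_bound ℝ k l _ (by positivity) fun x => ?_
  have e : (SchwartzMap.smulLeftCLM ℂ (dil m r) v - v : Test d) =
      fun y => (dil m r y - 1) * v y := by
    funext y
    rw [sub_apply, SchwartzMap.smulLeftCLM_apply_apply (dil m r).hasTemperateGrowth, smul_eq_mul]
    ring
  rw [e]
  have h1 := norm_iteratedFDeriv_mul_le (𝕜 := ℝ) (N := (l : WithTop ℕ∞)) (n := l)
    (f := fun y => dil m r y - 1) (g := v) (((dil m r).smooth l).sub contDiff_const) (v.smooth l)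
    x le_rfl
  calc _ ≤ ‖x‖ ^ k * ∑ i ∈ Finset.range (l + 1), (l.choose i : ℝ) *
        ‖iteratedFDeriv ℝ i (fun y => dil m r y - 1) x‖ * ‖iteratedFDeriv ℝ (l - i) v x‖ := by
        gcongr
    _ = ∑ i ∈ Finset.range (l + 1), (l.choose i : ℝ) *
        (‖iteratedFDeriv ℝ i (fun y => dil m r y - 1) x‖ *
          (‖x‖ ^ k * ‖iteratedFDeriv ℝ (l - i) v x‖)) := by
        rw [Finset.mul_sum]
        exact Finset.sum_congr rfl fun i _ => by ring
    _ ≤ ∑ i ∈ Finset.range (l + 1), (l.choose i : ℝ) * (r * (B *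
      (SchwartzMap.seminorm ℝ k (l - i) v + SchwartzMap.seminorm ℝ (k + 1) (l - i) v))) := by
        refine Finset.sum_le_sum fun i hi => mul_le_mul_of_nonneg_left ?_ (Nat.cast_nonneg _)
        have h2 := v.le_seminorm ℝ k (l - i) x
        have h3 := v.le_seminorm ℝ (k + 1) (l - i) x
        have h4 := hB r hr hr1 i (by simp at hi; omega) x
        calc _ ≤ r * B * (1 + ‖x‖) * (‖x‖ ^ k * ‖iteratedFDeriv ℝ (l - i) v x‖) := by gcongr
          _ = r * B * (‖x‖ ^ k * ‖iteratedFDeriv ℝ (l - i) v x‖ +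
              ‖x‖ ^ (k + 1) * ‖iteratedFDeriv ℝ (l - i) v x‖) := by ring
          _ ≤ r * B * (SchwartzMap.seminorm ℝ k (l - i) v +
              SchwartzMap.seminorm ℝ (k + 1) (l - i) v) := by gcongr
          _ = _ := by ring
    _ = _ := by
        rw [Finset.mul_sum]
        exact Finset.sum_congr rfl fun i _ => by ring

lemma tendsto_mult_dil (m : Test d) (hm : m 0 = 1) (u : Test d) :
    Tendsto (fun n : ℕ => mult (dil m (2⁻¹ ^ n)) u) atTop (𝓝 u) := by
  have h1 : Tendsto (fun n : ℕ => SchwartzMap.smulLeftCLM ℂ (dil m (2⁻¹ ^ n)) (𝓕⁻ u : Test d))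
      atTop (𝓝 (𝓕⁻ u)) := by
    rw [(schwartz_withSeminorms ℝ (Space d) ℂ).tendsto_nhds]
    rintro ⟨k, l⟩ ε hε
    obtain ⟨C, hC⟩ := seminorm_smulLeft_dil_sub_le m hm (𝓕⁻ u) k l
    have h2 : Tendsto (fun n : ℕ => (2⁻¹ : ℝ) ^ n * C) atTop (𝓝 (0 * C)) :=
      (tendsto_pow_atTop_nhds_zero_of_lt_one (by norm_num) (by norm_num)).mul_const C
    rw [zero_mul] at h2
    filter_upwards [h2.eventually_lt_const hε] with n hn
    exact (hC _ (by positivity) (pow_le_one₀ (by norm_num) (by norm_num))).trans_lt hn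
  have h2 := ((FourierTransform.fourierCLM ℂ (Test d)).continuous.tendsto _).comp h1
  simpa [Function.comp_def] using! h2

/-! ### Littlewood–Paley blocks -/

section LP

variable {φ₀ : Space d → ℝ} (hφ : IsDyadicGenerator φ₀)

/-- The generator of the dyadic partition of unity as a test function. -/
def gen {φ₀ : Space d → ℝ} (hφ : IsDyadicGenerator φ₀) : Test d :=
  HasCompactSupport.toSchwartzMap (f := fun x => (φ₀ x : ℂ))
    (HasCompactSupport.intro (isCompact_closedBall (0 : Space d) (3 / 2)) fun x hx => by
      rw [hφ.eq_zero x (by simpa using (not_le.1 (by simpa using hx)).le)]; simp)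
    (Complex.ofRealCLM.contDiff.comp hφ.smooth)

lemma gen_apply (x : Space d) : gen hφ x = φ₀ x := rfl

lemma gen_zero : gen hφ 0 = 1 := by
  rw [gen_apply, hφ.eq_one 0 (by simp)]; simp

/-- The symbol of the `j`-th block before scaling. -/
def sym {φ₀ : Space d → ℝ} (hφ : IsDyadicGenerator φ₀) (j : ℕ) : Test d :=
  if j = 0 then gen hφ else gen hφ - dil (gen hφ) 2

/-- A symbol that is equal to `1` on the support of `sym hφ j`. -/
def fat {φ₀ : Space d → ℝ} (hφ : IsDyadicGenerator φ₀) (j : ℕ) : Test d :=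
  if j = 0 then dil (gen hφ) 2⁻¹ else dil (gen hφ) 2⁻¹ - dil (gen hφ) 4

/-- For `j ≠ 0` the symbol lives on `1/2 ≤ ‖x‖ ≤ 3/2`, where `φ₀ (x/2) = 1` and `φ₀ (4x) = 0`. -/
lemma sym_mul_fat (j : ℕ) (x : Space d) : sym hφ j x * fat hφ j x = sym hφ j x := by
  rcases le_or_gt (3 / 2) ‖x‖ with h | h
  · have h0 : gen hφ x = 0 := by rw [gen_apply, hφ.eq_zero x h]; simp
    have h2 : dil (gen hφ) 2 x = 0 := by
      rw [dil_apply _ (by norm_num), gen_apply, hφ.eq_zero _ (by rw [norm_smul]; norm_num; linarith)]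
      simp
    have : sym hφ j x = 0 := by
      unfold sym; split_ifs <;> simp [h0, h2]
    simp [this]
  · have h1 : dil (gen hφ) 2⁻¹ x = 1 := by
      rw [dil_apply _ (by norm_num), gen_apply, hφ.eq_one _ (by rw [norm_smul]; norm_num; linarith)]
      simp
    unfold sym fat
    split_ifs with hj
    · rw [h1, mul_one]
    · rcases le_or_gt ‖x‖ (1 / 2) with h' | h'
      · have h0 : gen hφ x = 1 := by rw [gen_apply, hφ.eq_one x (by linarith)]; simp
        have h2 : dil (gen hφ) 2 x = 1 := by
          rw [dil_apply _ (by norm_num), gen_apply,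
            hφ.eq_one _ (by rw [norm_smul]; norm_num; linarith)]
          simp
        simp [h0, h2]
      · have h4 : dil (gen hφ) 4 x = 0 := by
          rw [dil_apply _ (by norm_num), gen_apply,
            hφ.eq_zero _ (by rw [norm_smul]; norm_num; linarith)]
          simp
        simp [h1, h4]

/-- The cancellation behind the factor `2 ^ (-a * j)` in `exists_lp_bounds`; it fails for the
low-frequency block `j = 0`. -/
lemma fat_zero {j : ℕ} (hj : j ≠ 0) : fat hφ j 0 = 0 := by
  simp [fat, hj, dil_apply, gen_zero]

/-- The Littlewood–Paley block, acting on test functions. -/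
def lp {φ₀ : Space d → ℝ} (hφ : IsDyadicGenerator φ₀) (j : ℕ) (u : Test d) : Test d :=
  mult (dil (sym hφ j) (2⁻¹ ^ j)) u

/-- The fattened block, acting on test functions. -/
def flp {φ₀ : Space d → ℝ} (hφ : IsDyadicGenerator φ₀) (j : ℕ) (u : Test d) : Test d :=
  mult (dil (fat hφ j) (2⁻¹ ^ j)) u

lemma dyadic_eq (j : ℕ) :
    (fun ξ => (dyadic φ₀ j ξ : ℂ)) = dil (sym hφ j) (2⁻¹ ^ j) := by
  funext ξ
  rw [dil_apply _ (by positivity)]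
  cases j with
  | zero => simp [dyadic, sym, gen_apply]
  | succ j =>
    have : (2 : ℝ) • ((2 : ℝ)⁻¹ ^ (j + 1)) • ξ = (2 : ℝ)⁻¹ ^ j • ξ := by
      rw [smul_smul, pow_succ]; congr 1; ring
    simp only [dyadic, sym, Nat.add_eq_zero_iff, one_ne_zero, and_false, if_false, sub_apply,
      gen_apply, dil_apply _ (two_ne_zero (α := ℝ)), Complex.ofReal_sub, this]

lemma block_apply (j : ℕ) (f : Distr d) (u : Test d) : block φ₀ j f u = f (lp hφ j u) := by
  rw [block, dyadic_eq hφ, TemperedDistribution.fourierMultiplierCLM_apply_apply]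
  rfl

lemma tg (m : Test d) : Function.HasTemperateGrowth (m : Space d → ℂ) := m.hasTemperateGrowth

lemma lp_flp (j : ℕ) (u : Test d) : lp hφ j (flp hφ j u) = lp hφ j u := by
  rw [lp, flp, mult_mult (tg _) (tg _)]
  congr 1
  funext x
  rw [dil_apply _ (by positivity), dil_apply _ (by positivity), sym_mul_fat]

lemma lp_sub (j : ℕ) (u v : Test d) : lp hφ j (u - v) = lp hφ j u - lp hφ j v :=
  mult_apply_sub _ _ _

lemma sum_lp (n : ℕ) (u : Test d) :
    ∑ j ∈ Finset.range (n + 1), lp hφ j u = mult (dil (gen hφ) (2⁻¹ ^ n)) u := by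
  induction n with
  | zero => simp [lp, sym]
  | succ n ih =>
    rw [Finset.sum_range_succ, ih, lp, mult, mult, mult, ← FourierTransform.fourier_add,
      ← add_apply, ← SchwartzMap.smulLeftCLM_add (tg _) (tg _)]
    congr 3
    funext x
    have : (2 : ℝ) • ((2 : ℝ)⁻¹ ^ (n + 1)) • x = (2 : ℝ)⁻¹ ^ n • x := by
      rw [smul_smul, pow_succ]; congr 1; ring
    rw [Pi.add_apply, dil_apply _ (by positivity), dil_apply _ (by positivity),
      dil_apply _ (by positivity)]
    simp only [sym, Nat.add_eq_zero_iff, one_ne_zero, and_false, if_false, sub_apply,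
      dil_apply _ (two_ne_zero (α := ℝ)), this]
    ring

lemma tendsto_sum_lp (f : Distr d) (u : Test d) :
    Tendsto (fun n => ∑ j ∈ Finset.range (n + 1), f (lp hφ j u)) atTop (𝓝 (f u)) := by
  have h := ((map_continuous f).tendsto u).comp (tendsto_mult_dil (gen hφ) (gen_zero hφ) u)
  refine h.congr fun n => ?_
  rw [Function.comp_apply, ← sum_lp, map_sum]

lemma hasSum_lp (f : Distr d) (u : Test d) {c : ℕ → ℝ} (hc : Summable c)
    (h : ∀ j, ‖f (lp hφ j u)‖ ≤ c j) : HasSum (fun j => f (lp hφ j u)) (f u) := by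
  have hs : Summable fun j => f (lp hφ j u) := Summable.of_norm_bounded hc h
  have := hs.hasSum.tendsto_sum_nat.comp (tendsto_add_atTop_nat 1)
  rw [← tendsto_nhds_unique this (tendsto_sum_lp hφ f u)]
  exact hs.hasSum

lemma norm_apply_le_tsum (f : Distr d) (u : Test d) {c : ℕ → ℝ} (hc : Summable c)
    (h : ∀ j, ‖f (lp hφ j u)‖ ≤ c j) : ‖f u‖ ≤ ∑' j, c j := by
  rw [← (hasSum_lp hφ f u hc h).tsum_eq]
  exact tsum_of_norm_bounded hc.hasSum h

lemma half_pow_rpow (j : ℕ) (a : ℝ) : ((2⁻¹ : ℝ) ^ j) ^ a = 2 ^ (-a * j) := by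
  rw [← Real.rpow_natCast, Real.inv_rpow (by norm_num), ← Real.rpow_neg (by norm_num),
    ← Real.rpow_mul (by norm_num)]
  congr 1
  ring

/-- Uniform estimates for the blocks. -/
lemma exists_lp_bounds {a : ℝ} (ha0 : 0 ≤ a) (ha1 : a ≤ 1) :
    ∃ C, 0 ≤ C ∧ ∀ j,
      (∀ u, l1 (lp hφ j u) ≤ C * l1 u) ∧ (∀ u, l1 (flp hφ j u) ≤ C * l1 u) ∧
      (∀ u z, l1 (tr z (lp hφ j u) - lp hφ j u) ≤ C * 2 ^ (a * j) * l1 u * ‖z‖ ^ a) ∧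
      (∀ u z, l1 (tr z (flp hφ j u) - flp hφ j u) ≤ C * 2 ^ (a * j) * l1 u * ‖z‖ ^ a) ∧
      (j ≠ 0 → ∀ u D, 0 ≤ D → (∀ z, l1 (tr z u - u) ≤ D * ‖z‖ ^ a) →
        l1 (flp hφ j u) ≤ C * 2 ^ (-a * j) * D) := by
  -- Up to dilation only four symbols occur, for `j = 0` and for `j ≠ 0`, so that four constants
  -- serve all `j`.
  obtain ⟨C1, hC1, h1⟩ := exists_dil_bounds (sym hφ 0) ha0 ha1
  obtain ⟨C2, hC2, h2⟩ := exists_dil_bounds (sym hφ 1) ha0 ha1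
  obtain ⟨C3, hC3, h3⟩ := exists_dil_bounds (fat hφ 0) ha0 ha1
  obtain ⟨C4, hC4, h4⟩ := exists_dil_bounds (fat hφ 1) ha0 ha1
  have hs : ∀ j : ℕ, ((((2⁻¹ : ℝ) ^ j) ^ a)⁻¹) = 2 ^ (a * j) := fun j => by
    rw [half_pow_rpow, ← Real.rpow_neg (by norm_num)]; congr 1; ring
  have hsym : ∀ j, ∃ C ≤ C1 + C2 + C3 + C4,
      (∀ u, l1 (lp hφ j u) ≤ C * l1 u) ∧
      (∀ u z, l1 (tr z (lp hφ j u) - lp hφ j u) ≤ C * 2 ^ (a * j) * l1 u * ‖z‖ ^ a) := by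
    intro j
    rcases eq_or_ne j 0 with rfl | hj
    · have := h1 (2⁻¹ ^ 0) (by positivity)
      exact ⟨C1, by linarith, this.1, by simpa only [hs, lp] using! this.2.2⟩
    · have e : sym hφ j = sym hφ 1 := by simp [sym, hj]
      have := h2 (2⁻¹ ^ j) (by positivity)
      refine ⟨C2, by linarith, ?_⟩
      simp only [lp, e]
      exact ⟨this.1, by simpa only [hs] using this.2.2⟩
  have hfat : ∀ j, ∃ C ≤ C1 + C2 + C3 + C4,
      (∀ u, l1 (flp hφ j u) ≤ C * l1 u) ∧
      (∀ u z, l1 (tr z (flp hφ j u) - flp hφ j u) ≤ C * 2 ^ (a * j) * l1 u * ‖z‖ ^ a) ∧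
      (j ≠ 0 → ∀ u D, 0 ≤ D → (∀ z, l1 (tr z u - u) ≤ D * ‖z‖ ^ a) →
        l1 (flp hφ j u) ≤ C * 2 ^ (-a * j) * D) := by
    intro j
    rcases eq_or_ne j 0 with rfl | hj
    · have := h3 (2⁻¹ ^ 0) (by positivity)
      exact ⟨C3, by linarith, this.1, by simpa only [hs, flp] using! this.2.2, fun h => (h rfl).elim⟩
    · have e : fat hφ j = fat hφ 1 := by simp [fat, hj]
      have := h4 (2⁻¹ ^ j) (by positivity)
      refine ⟨C4, by linarith, ?_⟩
      simp only [flp, e]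
      refine ⟨this.1, by simpa only [hs] using this.2.2, fun _ u D hD h => ?_⟩
      have h5 := this.2.1 u D hD h
      rwa [fat_zero hφ one_ne_zero, zero_smul, sub_zero, half_pow_rpow] at h5
  refine ⟨C1 + C2 + C3 + C4, by positivity, fun j => ?_⟩
  obtain ⟨C, hC, g1, g2⟩ := hsym j
  obtain ⟨C', hC', g3, g4, g5⟩ := hfat j
  have hl := l1_nonneg (d := d)
  refine ⟨fun u => (g1 u).trans ?_, fun u => (g3 u).trans ?_, fun u z => (g2 u z).trans ?_,
    fun u z => (g4 u z).trans ?_, fun hj u D hD h => (g5 hj u D hD h).trans ?_⟩ <;>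
  · have := hl
    gcongr
    all_goals exact hl _

/-! ### The Besov norm in terms of test functions -/

/-- `f` has norm at most `C` in `𝒞^γ`. -/
def BB {φ₀ : Space d → ℝ} (hφ : IsDyadicGenerator φ₀) (γ : ℝ) (f : Distr d) (C : ℝ) : Prop :=
  ∀ j u, ‖f (lp hφ j u)‖ ≤ C * 2 ^ (-γ * j) * l1 u

lemma linfty_apply_le (g : Lp ℂ ∞ (volume : Measure (Space d))) (ψ : Test d) :
    ‖Lp.toTemperedDistribution g ψ‖ ≤ ‖g‖ * l1 ψ := by
  rw [Lp.toTemperedDistribution_apply, l1, ← integral_const_mul]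
  refine norm_integral_le_of_norm_le (ψ.integrable.norm.const_mul _) ?_
  have h := ae_le_eLpNormEssSup (f := g) (μ := (volume : Measure (Space d)))
  filter_upwards [h] with x hx
  rw [smul_eq_mul, norm_mul, mul_comm]
  gcongr
  rw [← eLpNorm_exponent_top] at hx
  have := ENNReal.toReal_mono (Lp.eLpNorm_ne_top g) hx
  rwa [toReal_enorm] at this

lemma lb_of_linftyNorm_le {f : Distr d} {C : ℝ} (hC : 0 ≤ C)
    (h : linftyNorm f ≤ ENNReal.ofReal C) : LB f C := by
  intro ψ
  refine le_of_forall_pos_le_add fun ε hε => ?_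
  -- The infimum in `linftyNorm` is not known to be attained. The slack is chosen to cost at most
  -- `ε` after multiplication by `l1 ψ`.
  have hδ : 0 < ε / (l1 ψ + 1) := div_pos hε (by linarith [l1_nonneg ψ])
  have : linftyNorm f < ENNReal.ofReal (C + ε / (l1 ψ + 1)) :=
    h.trans_lt ((ENNReal.ofReal_lt_ofReal_iff (by linarith)).2 (by linarith))
  simp only [linftyNorm, iInf_lt_iff] at this
  obtain ⟨g, rfl, hg⟩ := this
  have hg' : ‖g‖ ≤ C + ε / (l1 ψ + 1) := by
    rw [← ofReal_norm] at hg
    exact (ENNReal.ofReal_le_ofReal_iff (by linarith)).1 hg.le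
  refine (linfty_apply_le g ψ).trans ?_
  have h1 : ε / (l1 ψ + 1) * l1 ψ ≤ ε := by
    rw [div_mul_eq_mul_div, div_le_iff₀ (by linarith [l1_nonneg ψ])]
    nlinarith [l1_nonneg ψ]
  nlinarith [l1_nonneg ψ, mul_le_mul_of_nonneg_right hg' (l1_nonneg ψ)]

lemma memLp_top_of_forall_le {w : Space d → ℂ} (hw : AEStronglyMeasurable w volume) {C : ℝ}
    (h : ∀ x, ‖w x‖ ≤ C) : MemLp w ∞ (volume : Measure (Space d)) :=
  memLp_top_of_bound hw C (Eventually.of_forall h)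

lemma toTemperedDistribution_toLp_apply {w : Space d → ℂ} (hw : MemLp w ∞ volume) (ψ : Test d) :
    Lp.toTemperedDistribution hw.toLp ψ = ∫ x, ψ x * w x := by
  rw [Lp.toTemperedDistribution_apply]
  refine integral_congr_ae ?_
  filter_upwards [hw.coeFn_toLp] with x hx
  rw [hx, smul_eq_mul]

lemma linftyNorm_le_of_lb {f : Distr d} {C H a : ℝ} (hf : LB f C) (ha : 0 < a)
    (hH : HB a f H) : linftyNorm f ≤ ENNReal.ofReal C := by
  have hw := memLp_top_of_forall_le (continuous_rep hf ha hH).aestronglyMeasurable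
    (norm_rep_le hf ha hH)
  refine iInf₂_le_of_le hw.toLp ?_ ?_
  · ext ψ
    rw [toTemperedDistribution_toLp_apply, apply_eq_integral_rep hf ha hH]
  · rw [Lp.enorm_toLp, eLpNorm_exponent_top]
    refine eLpNormEssSup_le_of_ae_enorm_bound (Eventually.of_forall fun x => ?_)
    rw [← ofReal_norm]
    exact ENNReal.ofReal_le_ofReal (norm_rep_le hf ha hH x)

/-- For the converse an `L^∞` representative is needed. A block equals itself composed with its
fattened block, hence is Lipschitz, and `rep` supplies the function. -/
lemma linftyNorm_block_le_iff {f : Distr d} {C : ℝ} (hC : 0 ≤ C) (j : ℕ) :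
    linftyNorm (block φ₀ j f) ≤ ENNReal.ofReal C ↔ ∀ u, ‖f (lp hφ j u)‖ ≤ C * l1 u := by
  constructor
  · intro h u
    rw [← block_apply hφ]
    exact lb_of_linftyNorm_le hC h u
  · intro h
    obtain ⟨K, hK, hb⟩ := exists_lp_bounds hφ (zero_le_one' ℝ) le_rfl
    refine linftyNorm_le_of_lb (a := 1) (H := C * (K * 2 ^ (1 * j : ℝ)))
      (fun u => by rw [block_apply hφ]; exact h u) one_pos fun z u => ?_
    rw [block_apply hφ, ← lp_flp]
    refine (h _).trans ?_
    rw [flp, mult_apply_sub, ← tr_mult]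
    have := (hb j).2.2.2.1 u z
    calc _ ≤ C * (K * 2 ^ (1 * j : ℝ) * l1 u * ‖z‖ ^ (1 : ℝ)) := by gcongr; exact this
      _ = _ := by ring

/-- The bridge to the statement: all estimates below are made for the real-valued bound `BB`. -/
lemma besovNorm_le_iff {γ : ℝ} {f : Distr d} {C : ℝ} (hC : 0 ≤ C) :
    besovNorm φ₀ γ f ≤ ENNReal.ofReal C ↔ BB hφ γ f C := by
  rw [besovNorm, iSup_le_iff, BB]
  refine forall_congr' fun j => ?_
  have h2 : (0 : ℝ) < 2 ^ (γ * j) := by positivity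
  have e : (2 : ℝ) ^ (-γ * j) = (2 ^ (γ * j))⁻¹ := by
    rw [← Real.rpow_neg (by norm_num)]; congr 1; ring
  rw [← linftyNorm_block_le_iff hφ (by positivity), e, ← div_eq_mul_inv,
    ENNReal.ofReal_div_of_pos h2, ENNReal.le_div_iff_mul_le (Or.inl (by simpa using h2))
      (Or.inl ENNReal.ofReal_ne_top), mul_comm]

end LP

/-! ### Derivatives -/

lemma summable_two_rpow {c : ℝ} (hc : 0 < c) : Summable fun j : ℕ => (2 : ℝ) ^ (-c * j) := by
  have : (fun j : ℕ => (2 : ℝ) ^ (-c * j)) = fun j : ℕ => ((2 : ℝ) ^ (-c)) ^ j := by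
    funext j
    rw [Real.rpow_mul (by norm_num), Real.rpow_natCast]
  rw [this]
  exact summable_geometric_of_lt_one (by positivity)
    (Real.rpow_lt_one_of_one_lt_of_neg (by norm_num) (by linarith))

lemma two_rpow_mul (x y z : ℝ) (h : x + y = z) (j : ℕ) :
    (2 : ℝ) ^ (x * j) * 2 ^ (y * j) = 2 ^ (z * j) := by
  rw [← Real.rpow_add (by norm_num), ← h]; ring_nf

lemma hasTemperateGrowth_inner (c : ℂ) (e : Space d) :
    Function.HasTemperateGrowth fun x : Space d => c * (inner ℝ x e : ℂ) :=
  (Function.HasTemperateGrowth.const c).mul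
    (Function.HasTemperateGrowth.comp Complex.ofRealCLM.hasTemperateGrowth
      (Function.hasTemperateGrowth_inner_left e))

/-- The symbol `2πi ⟨x, e⟩ m`. -/
def gradSym (m : Test d) (e : Space d) : Test d :=
  -- The minus sign comes from `mult`, which applies `𝓕` last: `∂_e (𝓕 v) = 𝓕 (-2πi ⟨·, e⟩ v)`.
  SchwartzMap.smulLeftCLM ℂ (fun x => -(2 * Real.pi * Complex.I) * (inner ℝ x e : ℂ)) m

lemma gradSym_apply (m : Test d) (e x : Space d) :
    gradSym m e x = -(2 * Real.pi * Complex.I) * (inner ℝ x e : ℂ) * m x := by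
  rw [gradSym, SchwartzMap.smulLeftCLM_apply_apply (hasTemperateGrowth_inner _ _), smul_eq_mul]

lemma mult_dil_lineDeriv (m : Test d) {r : ℝ} (hr : 0 < r) (e : Space d) (u : Test d) :
    mult (dil m r) (∂_{e} u) = (r⁻¹ : ℂ) • mult (dil (gradSym m e) r) u := by
  obtain ⟨v, rfl⟩ : ∃ v : Test d, u = 𝓕 v := ⟨𝓕⁻ u, by simp⟩
  rw [SchwartzMap.lineDerivOp_fourier_eq, mult, mult, ← FourierTransform.fourier_smul]
  simp only [FourierTransform.fourierInv_fourier_eq]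
  congr 1
  ext x
  have hi : Function.HasTemperateGrowth fun x : Space d => inner ℝ x e :=
    Function.hasTemperateGrowth_inner_left e
  rw [SchwartzMap.smulLeftCLM_apply_apply (tg _), smul_apply, smul_apply,
    SchwartzMap.smulLeftCLM_apply_apply (tg _), SchwartzMap.smulLeftCLM_apply_apply hi,
    dil_apply _ hr.ne', dil_apply _ hr.ne', gradSym_apply]
  simp only [smul_eq_mul, inner_smul_left, Complex.real_smul, Complex.ofReal_mul]
  have : (r : ℂ) ≠ 0 := by exact_mod_cast hr.ne'
  simp
  field_simp

variable {φ₀ : Space d → ℝ} (hφ : IsDyadicGenerator φ₀)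

/-- Distributions in `𝒞^γ`, `γ > 0`, are bounded. -/
lemma exists_lb_of_bb {γ : ℝ} (hγ : 0 < γ) :
    ∃ K, 0 ≤ K ∧ ∀ (f : Distr d) (C : ℝ), BB hφ γ f C → LB f (K * C) := by
  refine ⟨∑' j : ℕ, (2 : ℝ) ^ (-γ * j), tsum_nonneg fun _ => by positivity, fun f C h u => ?_⟩
  have := norm_apply_le_tsum hφ f u (((summable_two_rpow hγ).mul_left C).mul_right (l1 u))
    fun j => h j u
  rw [tsum_mul_right, tsum_mul_left] at this
  linarith

/-- Bernstein's inequality: at frequency `2 ^ j` a derivative costs `2 ^ j` and an increment of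
order `a` costs `2 ^ (a * j)`. -/
lemma exists_flp_lineDeriv (e : Space d) {a : ℝ} (ha0 : 0 ≤ a) (ha1 : a ≤ 1) :
    ∃ C, 0 ≤ C ∧ ∀ (j : ℕ) (u : Test d), l1 (flp hφ j (∂_{e} u)) ≤ C * 2 ^ (1 * j : ℝ) * l1 u ∧
      ∀ z, l1 (flp hφ j (∂_{e} (tr z u - u))) ≤ C * 2 ^ ((1 + a) * j) * l1 u * ‖z‖ ^ a := by
  obtain ⟨C3, hC3, h3⟩ := exists_dil_bounds (gradSym (fat hφ 0) e) ha0 ha1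
  obtain ⟨C4, hC4, h4⟩ := exists_dil_bounds (gradSym (fat hφ 1) e) ha0 ha1
  have hj : ∀ j, ∃ C ≤ C3 + C4, ∀ r, 0 < r →
      (∀ u, l1 (mult (dil (gradSym (fat hφ j) e) r) u) ≤ C * l1 u) ∧
      (∀ u z, l1 (tr z (mult (dil (gradSym (fat hφ j) e) r) u) -
        mult (dil (gradSym (fat hφ j) e) r) u) ≤ C * (r ^ a)⁻¹ * l1 u * ‖z‖ ^ a) := by
    intro j
    rcases eq_or_ne j 0 with rfl | hj
    · exact ⟨C3, by linarith, fun r hr => ⟨(h3 r hr).1, (h3 r hr).2.2⟩⟩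
    · have e : fat hφ j = fat hφ 1 := by simp [fat, hj]
      rw [e]
      exact ⟨C4, by linarith, fun r hr => ⟨(h4 r hr).1, (h4 r hr).2.2⟩⟩
  refine ⟨C3 + C4, by positivity, fun j u => ?_⟩
  obtain ⟨C, hC, h⟩ := hj j
  obtain ⟨g1, g2⟩ := h (2⁻¹ ^ j) (by positivity)
  have hl := l1_nonneg u
  have hr : ‖(((2⁻¹ ^ j : ℝ) : ℂ))⁻¹‖ = 2 ^ (1 * j : ℝ) := by
    rw [norm_inv, Complex.norm_real, Real.norm_of_nonneg (by positivity), one_mul,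
      Real.rpow_natCast, inv_pow, inv_inv]
  have hs : ((((2⁻¹ : ℝ) ^ j) ^ a)⁻¹) = 2 ^ (a * j) := by
    rw [half_pow_rpow, ← Real.rpow_neg (by norm_num)]; congr 1; ring
  have hd : ∀ v : Test d, flp hφ j (∂_{e} v) =
      (((2⁻¹ ^ j : ℝ) : ℂ))⁻¹ • mult (dil (gradSym (fat hφ j) e) (2⁻¹ ^ j)) v := fun v => by
    rw [flp, mult_dil_lineDeriv _ (by positivity)]
  constructor
  · rw [hd, l1_smul, hr]
    calc _ ≤ 2 ^ (1 * j : ℝ) * ((C3 + C4) * l1 u) := by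
          gcongr; exact (g1 u).trans (by gcongr)
      _ = _ := by ring
  · intro z
    rw [hd, l1_smul, hr, mult_apply_sub, ← tr_mult]
    have := g2 u z
    rw [hs] at this
    calc _ ≤ 2 ^ (1 * j : ℝ) * ((C3 + C4) * 2 ^ (a * j) * l1 u * ‖z‖ ^ a) := by
          gcongr; exact this.trans (by gcongr)
      _ = _ := by rw [← two_rpow_mul 1 a (1 + a) rfl]; ring

/-- The decay `2 ^ (-(α + 1) * j)` of the blocks against the Bernstein losses leaves geometric
series with exponents `α` and `α - a`; the second one requires `a < α`. -/
lemma exists_lineDeriv_bounds (e : Space d) {α a : ℝ} (ha0 : 0 ≤ a) (ha1 : a ≤ 1) (haα : a < α) :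
    ∃ K, 0 ≤ K ∧ ∀ (f : Distr d) (C : ℝ), 0 ≤ C → BB hφ (α + 1) f C →
      LB (∂_{e} f) (K * C) ∧ HB a (∂_{e} f) (K * C) := by
  obtain ⟨K, hK, h⟩ := exists_flp_lineDeriv hφ e ha0 ha1
  have hα : 0 < α := lt_of_le_of_lt ha0 haα
  set S1 := ∑' j : ℕ, (2 : ℝ) ^ (-α * j)
  set S2 := ∑' j : ℕ, (2 : ℝ) ^ (-(α - a) * j)
  have hS1 : 0 ≤ S1 := tsum_nonneg fun _ => by positivity
  have hS2 : 0 ≤ S2 := tsum_nonneg fun _ => by positivity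
  refine ⟨K * S1 + K * S2, by positivity, fun f C hC hf => ⟨fun u => ?_, fun z u => ?_⟩⟩
  · rw [TemperedDistribution.lineDerivOp_apply_apply, map_neg, norm_neg]
    have := norm_apply_le_tsum hφ f (∂_{e} u)
      (((summable_two_rpow hα).mul_left (C * K)).mul_right (l1 u)) fun j => by
        rw [← lp_flp]
        refine (hf j _).trans ?_
        calc _ ≤ C * 2 ^ (-(α + 1) * j) * (K * 2 ^ (1 * j : ℝ) * l1 u) := by
              gcongr; exact (h j u).1
          _ = _ := by rw [← two_rpow_mul (-(α + 1)) 1 (-α) (by ring)]; ring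
    rw [tsum_mul_right, tsum_mul_left] at this
    have h2 : 0 ≤ K * S2 * C * l1 u := by have := l1_nonneg u; positivity
    have e1 : C * K * S1 * l1 u = K * S1 * C * l1 u := by ring
    rw [e1] at this
    linarith
  · rw [TemperedDistribution.lineDerivOp_apply_apply, map_neg, norm_neg]
    have := norm_apply_le_tsum hφ f (∂_{e} (tr z u - u))
      (((summable_two_rpow (sub_pos.2 haα)).mul_left (C * K)).mul_right (l1 u * ‖z‖ ^ a))
        fun j => by
        rw [← lp_flp]
        refine (hf j _).trans ?_
        calc _ ≤ C * 2 ^ (-(α + 1) * j) * (K * 2 ^ ((1 + a) * j) * l1 u * ‖z‖ ^ a) := by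
              gcongr; exact (h j u).2 z
          _ = _ := by rw [← two_rpow_mul (-(α + 1)) (1 + a) (-(α - a)) (by ring)]; ring
    rw [tsum_mul_right, tsum_mul_left] at this
    have h2 : 0 ≤ K * S1 * C * (l1 u * ‖z‖ ^ a) := by have := l1_nonneg u; positivity
    have e1 : C * K * S2 * (l1 u * ‖z‖ ^ a) = K * S2 * C * (l1 u * ‖z‖ ^ a) := by ring
    rw [e1] at this
    linarith

/-! ### Convolution of a bounded function with a test function -/

section smooth

set_option linter.unusedSectionVars false

variable {V : Type} [NormedAddCommGroup V] [NormedSpace ℝ V] [NormedSpace ℂ V]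
  [SMulCommClass ℝ ℂ V]

lemma exists_norm_le_one_add_pow (K : 𝓢(Space d, V)) (N : ℕ) :
    ∃ C, 0 ≤ C ∧ ∀ x, ‖K x‖ ≤ C * ((1 + ‖x‖) ^ N)⁻¹ := by
  refine ⟨2 ^ N * ((Finset.Iic (N, 0)).sup fun m => SchwartzMap.seminorm ℝ m.1 m.2) K,
    by positivity, fun x => ?_⟩
  have := SchwartzMap.one_add_le_sup_seminorm_apply (𝕜 := ℝ) (m := (N, 0)) le_rfl le_rfl K x
  rw [norm_iteratedFDeriv_zero] at this
  rw [← div_eq_mul_inv, le_div_iff₀ (by positivity)]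
  linarith

/-- The function `y ↦ ∫ w(x) K(x - y) dx`. -/
def corr (w : Space d → ℂ) (K : 𝓢(Space d, V)) (y : Space d) : V := ∫ x, w x • K (x - y)

lemma integrable_corr {w : Space d → ℂ} (hw : Continuous w) {A : ℝ} (hA : ∀ x, ‖w x‖ ≤ A)
    (K : 𝓢(Space d, V)) (y : Space d) : Integrable fun x => w x • K (x - y) := by
  exact ((K.integrable (μ := volume)).comp_sub_right y).bdd_smul A
    hw.aestronglyMeasurable (Eventually.of_forall hA)

lemma norm_corr_le {w : Space d → ℂ} {A : ℝ} (hA : ∀ x, ‖w x‖ ≤ A)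
    (K : 𝓢(Space d, V)) (y : Space d) : ‖corr w K y‖ ≤ A * ∫ x, ‖K x‖ := by
  rw [corr, ← integral_sub_right_eq_self (fun x => ‖K x‖) y, ← integral_const_mul]
  refine norm_integral_le_of_norm_le
    (((K.integrable (μ := volume)).comp_sub_right y).norm.const_mul A)
    (Eventually.of_forall fun x => ?_)
  rw [norm_smul]
  gcongr
  exact hA x

lemma hasFDerivAt_corr [CompleteSpace V] {w : Space d → ℂ} (hw : Continuous w) {A : ℝ}
    (hA : ∀ x, ‖w x‖ ≤ A) (K : 𝓢(Space d, V)) (y₀ : Space d) :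
    HasFDerivAt (corr w K) (corr w (-(SchwartzMap.fderivCLM ℝ (Space d) V K)) y₀) y₀ := by
  have hA0 : 0 ≤ A := (norm_nonneg _).trans (hA 0)
  set K' := -(SchwartzMap.fderivCLM ℝ (Space d) V K) with hK'
  obtain ⟨C, hC0, hC⟩ := exists_norm_le_one_add_pow K' (d + 1)
  -- For `y` in the unit ball around `y₀` one has `1 + ‖x - y₀‖ ≤ 2 * (1 + ‖x - y‖)`, whence the
  -- factor `2 ^ (d + 1)`. The power `d + 1` is integrable in dimension `d`.
  have hbound : Integrable fun x : Space d =>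
      A * (C * 2 ^ (d + 1)) * (1 + ‖x - y₀‖) ^ (-((d + 1 : ℕ) : ℝ)) := by
    refine ((integrable_one_add_norm (μ := (volume : Measure (Space d))) ?_).comp_sub_right
      y₀).const_mul _
    simp
  refine hasFDerivAt_integral_of_dominated_of_fderiv_le (𝕜 := ℝ) (s := Metric.ball y₀ 1)
    (F := fun y x => w x • K (x - y)) (F' := fun y x => w x • K' (x - y))
    (Metric.ball_mem_nhds y₀ one_pos) ?_ (integrable_corr hw hA K y₀) ?_ ?_ hbound ?_
  · exact Eventually.of_forall fun y => (integrable_corr hw hA K y).aestronglyMeasurable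
  · exact (hw.smul (K'.continuous.comp (continuous_id.sub continuous_const))).aestronglyMeasurable
  · refine Eventually.of_forall fun x y hy => ?_
    rw [norm_smul, mul_assoc]
    gcongr
    · exact hA x
    refine (hC _).trans ?_
    rw [Real.rpow_neg (by positivity), Real.rpow_natCast, mul_assoc]
    gcongr
    rw [inv_eq_one_div, div_le_iff₀ (by positivity), ← div_eq_mul_inv, div_mul_eq_mul_div,
      le_div_iff₀ (by positivity), ← mul_pow, one_mul]
    gcongr
    have : ‖x - y₀‖ ≤ ‖x - y‖ + ‖y - y₀‖ := norm_sub_le_norm_sub_add_norm_sub _ _ _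
    have h2 : ‖y - y₀‖ < 1 := by simpa [dist_eq_norm] using hy
    linarith [norm_nonneg (x - y)]
  · refine Eventually.of_forall fun x y _ => ?_
    have h1 : HasFDerivAt (fun y => x - y) (-(ContinuousLinearMap.id ℝ (Space d))) y :=
      (hasFDerivAt_id y).const_sub x
    have h2 := ((K.hasFDerivAt (x - y)).comp y h1).const_smul (w x)
    convert! h2 using 1
    ext v
    simp [hK']

/-- The derivative is again a `corr`, but with a kernel valued in linear maps. The target space is
therefore quantified inside the induction. -/
lemma contDiff_corr {w : Space d → ℂ} (hw : Continuous w) {A : ℝ} (hA : ∀ x, ‖w x‖ ≤ A) (n : ℕ) :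
    ∀ (V : Type) [NormedAddCommGroup V] [NormedSpace ℝ V] [NormedSpace ℂ V]
      [SMulCommClass ℝ ℂ V] [CompleteSpace V] (K : 𝓢(Space d, V)),
      ContDiff ℝ n (corr w K) ∧ ∃ C, ∀ y, ‖iteratedFDeriv ℝ n (corr w K) y‖ ≤ C := by
  induction n with
  | zero =>
    intro V _ _ _ _ _ K
    refine ⟨?_, A * ∫ x, ‖K x‖, fun y => ?_⟩
    · rw [Nat.cast_zero, contDiff_zero]
      exact continuous_iff_continuousAt.2 fun y => (hasFDerivAt_corr hw hA K y).continuousAt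
    · rw [norm_iteratedFDeriv_zero]
      exact norm_corr_le hA K y
  | succ n ih =>
    intro V _ _ _ _ _ K
    have hd : fderiv ℝ (corr w K) = corr w (-(SchwartzMap.fderivCLM ℝ (Space d) V K)) :=
      funext fun y => (hasFDerivAt_corr hw hA K y).fderiv
    obtain ⟨h1, C, hC⟩ := ih _ (-(SchwartzMap.fderivCLM ℝ (Space d) V K))
    refine ⟨?_, C, fun y => ?_⟩
    · rw [Nat.cast_add, Nat.cast_one, contDiff_succ_iff_fderiv, hd]
      exact ⟨fun y => (hasFDerivAt_corr hw hA K y).differentiableAt, by simp, h1⟩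
    · rw [← norm_iteratedFDeriv_fderiv, hd]
      exact hC y

lemma hasTemperateGrowth_corr {w : Space d → ℂ} (hw : Continuous w) {A : ℝ}
    (hA : ∀ x, ‖w x‖ ≤ A) (K : Test d) : (corr w K).HasTemperateGrowth := by
  refine ⟨contDiff_infty.2 fun n => (contDiff_corr hw hA n ℂ K).1, fun n => ?_⟩
  obtain ⟨C, hC⟩ := (contDiff_corr hw hA n ℂ K).2
  exact ⟨0, C, fun x => by simpa using hC x⟩

end smooth

/-! ### Mollification of Hölder continuous functions -/

/-- `w` is bounded and Hölder continuous with exponent `a`, with constant `A`. -/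
structure Hol (a : ℝ) (w : Space d → ℂ) (A : ℝ) : Prop where
  bound : ∀ x, ‖w x‖ ≤ A
  holder : ∀ x y, ‖w x - w y‖ ≤ A * ‖x - y‖ ^ a

lemma Hol.nonneg {a A : ℝ} {w : Space d → ℂ} (h : Hol a w A) : 0 ≤ A :=
  (norm_nonneg _).trans (h.bound 0)

lemma Hol.continuous {a A : ℝ} {w : Space d → ℂ} (h : Hol a w A) (ha : 0 < a) : Continuous w :=
  continuous_of_holder ha h.holder

lemma Hol.sub {a A B : ℝ} {v w : Space d → ℂ} (hv : Hol a v A) (hw : Hol a w B) :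
    Hol a (v - w) (A + B) := by
  refine ⟨fun x => (norm_sub_le _ _).trans (add_le_add (hv.bound x) (hw.bound x)), fun x y => ?_⟩
  have e : (v - w) x - (v - w) y = (v x - v y) - (w x - w y) := by simp only [Pi.sub_apply]; ring
  rw [e, add_mul]
  exact (norm_sub_le _ _).trans (add_le_add (hv.holder x y) (hw.holder x y))

/-- The mollification of `w` with symbol `m (r ·)`. -/
def moll (m : Test d) (r : ℝ) (w : Space d → ℂ) : Space d → ℂ := corr w (𝓕 (dil m r) : Test d)

lemma moll_apply (m : Test d) (r : ℝ) (w : Space d → ℂ) (y : Space d) :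
    moll m r w y = ∫ z, w (y + z) * 𝓕 (dil m r) z := by
  rw [moll, corr, ← integral_add_left_eq_self _ y]
  refine integral_congr_ae (Eventually.of_forall fun z => ?_)
  simp

section moll

variable {a A : ℝ} {w : Space d → ℂ}

lemma Hol.hasTemperateGrowth_moll (ha : 0 < a) (hw : Hol a w A) (m : Test d) (r : ℝ) :
    (moll m r w).HasTemperateGrowth :=
  hasTemperateGrowth_corr (hw.continuous ha) hw.bound _

lemma Hol.integrable_moll (ha : 0 < a) (hw : Hol a w A) (m : Test d) (r : ℝ) (y : Space d) :
    Integrable fun z => w (y + z) * 𝓕 (dil m r) z :=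
  (𝓕 (dil m r)).integrable.bdd_mul
    ((hw.continuous ha).comp (continuous_const.add continuous_id)).aestronglyMeasurable
    (Eventually.of_forall fun z => hw.bound (y + z))

lemma Hol.moll (ha : 0 < a) (hw : Hol a w A) (m : Test d) {r : ℝ} (hr : 0 < r) :
    Hol a (moll m r w) (l1 (𝓕 m) * A) := by
  have hA := hw.nonneg
  constructor
  · intro y
    rw [moll_apply, ← l1_fourier_dil m hr, l1, ← integral_mul_const]
    refine norm_integral_le_of_norm_le ((𝓕 (dil m r)).integrable.norm.mul_const _)
      (Eventually.of_forall fun z => ?_)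
    rw [norm_mul, mul_comm]
    gcongr
    exact hw.bound _
  · intro x y
    rw [moll_apply, moll_apply, ← integral_sub (hw.integrable_moll ha m r x)
      (hw.integrable_moll ha m r y), ← l1_fourier_dil m hr, l1, mul_assoc, ← integral_mul_const]
    refine norm_integral_le_of_norm_le ((𝓕 (dil m r)).integrable.norm.mul_const _)
      (Eventually.of_forall fun z => ?_)
    rw [← sub_mul, norm_mul, mul_comm]
    gcongr
    simpa using hw.holder (x + z) (y + z)

lemma Hol.norm_moll_sub_le (ha : 0 < a) (hw : Hol a w A) (m : Test d) (hm : m 0 = 1) {r : ℝ} (hr : 0 < r)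
    (y : Space d) :
    ‖RoughHeat.moll m r w y - w y‖ ≤ r ^ a * (∫ z, ‖𝓕 m z‖ * ‖z‖ ^ a) * A := by
  have e : w y = ∫ z, w y * 𝓕 (dil m r) z := by
    rw [integral_const_mul, integral_fourier, dil_zero _ hr.ne', hm, mul_one]
  rw [moll_apply, e, ← integral_sub (hw.integrable_moll ha m r y)
    ((𝓕 (dil m r)).integrable.const_mul _), ← moment_fourier_dil m hr, ← integral_mul_const]
  refine norm_integral_le_of_norm_le ((integrable_pow_norm_mul_kernel _ ha.le).mul_const _)
    (Eventually.of_forall fun z => ?_)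
  rw [← sub_mul, norm_mul, mul_comm, mul_assoc]
  gcongr
  have := hw.holder (y + z) y
  rw [add_sub_cancel_left] at this
  linarith

end moll

/-! ### Products of functions and test functions in `L¹` -/

open Classical in
/-- The product `w ψ` in `L¹`. -/
def prodL1 (w : Space d → ℂ) (ψ : Test d) : L1 d :=
  if h : Integrable (fun x => w x * ψ x) then h.toL1 else 0

lemma integrable_mul_test {w : Space d → ℂ} (hc : Continuous w) {A : ℝ} (hA : ∀ x, ‖w x‖ ≤ A)
    (ψ : Test d) : Integrable fun x => w x * ψ x :=
  ψ.integrable.bdd_mul hc.aestronglyMeasurable (Eventually.of_forall hA)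

lemma prodL1_eq {w : Space d → ℂ} {ψ : Test d} (h : Integrable fun x => w x * ψ x) :
    prodL1 w ψ = h.toL1 := by rw [prodL1, dif_pos h]

lemma norm_prodL1_sub_le {v w : Space d → ℂ} (hv : Continuous v) (hw : Continuous w) {A B D : ℝ}
    (hA : ∀ x, ‖v x‖ ≤ A) (hB : ∀ x, ‖w x‖ ≤ B) (hD : ∀ x, ‖v x - w x‖ ≤ D) (φ ψ : Test d) :
    ‖prodL1 v φ - prodL1 w ψ‖ ≤ D * l1 φ + B * l1 (φ - ψ) := by
  rw [prodL1_eq (integrable_mul_test hv hA φ), prodL1_eq (integrable_mul_test hw hB ψ),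
    ← Integrable.toL1_sub, L1.norm_eq_integral_norm, l1, l1, ← integral_const_mul,
    ← integral_const_mul, ← integral_add (φ.integrable.norm.const_mul _)
      ((φ - ψ).integrable.norm.const_mul _)]
  refine integral_mono_ae (L1.integrable_coeFn _).norm ((φ.integrable.norm.const_mul _).add
      ((φ - ψ).integrable.norm.const_mul _)) ?_
  filter_upwards [Integrable.coeFn_toL1 ((integrable_mul_test hv hA φ).sub
    (integrable_mul_test hw hB ψ))] with x hx
  rw [hx]
  simp only [Pi.sub_apply, sub_apply]
  have e : v x * φ x - w x * ψ x = (v x - w x) * φ x + w x * (φ x - ψ x) := by ring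
  rw [e]
  refine (norm_add_le _ _).trans ?_
  rw [norm_mul, norm_mul]
  gcongr
  · exact hD x
  · exact hB x

lemma norm_prodL1_le {w : Space d → ℂ} (hw : Continuous w) {A : ℝ} (hA : ∀ x, ‖w x‖ ≤ A)
    (ψ : Test d) : ‖prodL1 w ψ‖ ≤ A * l1 ψ := by
  have h := integrable_mul_test hw hA ψ
  rw [prodL1_eq h, L1.norm_eq_integral_norm, l1, ← integral_const_mul]
  refine integral_mono_ae (L1.integrable_coeFn _).norm (ψ.integrable.norm.const_mul _) ?_
  filter_upwards [h.coeFn_toL1] with x hx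
  rw [hx, norm_mul]
  gcongr
  exact hA x

lemma prodL1_add {w : Space d → ℂ} (hw : Continuous w) {A : ℝ} (hA : ∀ x, ‖w x‖ ≤ A)
    (φ ψ : Test d) : prodL1 w (φ + ψ) = prodL1 w φ + prodL1 w ψ := by
  rw [prodL1_eq (integrable_mul_test hw hA φ), prodL1_eq (integrable_mul_test hw hA ψ),
    prodL1_eq (integrable_mul_test hw hA _), ← Integrable.toL1_add]
  congr 1
  funext x
  simp [mul_add]

lemma prodL1_smul {w : Space d → ℂ} (hw : Continuous w) {A : ℝ} (hA : ∀ x, ‖w x‖ ≤ A)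
    (c : ℂ) (ψ : Test d) : prodL1 w (c • ψ) = c • prodL1 w ψ := by
  rw [prodL1_eq (integrable_mul_test hw hA ψ), prodL1_eq (integrable_mul_test hw hA _),
    ← Integrable.toL1_smul]
  congr 1
  funext x
  simp
  ring

lemma prodL1_sub_left {v w : Space d → ℂ} (hv : Continuous v) (hw : Continuous w) {A B : ℝ}
    (hA : ∀ x, ‖v x‖ ≤ A) (hB : ∀ x, ‖w x‖ ≤ B) (ψ : Test d) :
    prodL1 (v - w) ψ = prodL1 v ψ - prodL1 w ψ := by
  have h : Integrable fun x => (v - w) x * ψ x := by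
    refine ((integrable_mul_test hv hA ψ).sub (integrable_mul_test hw hB ψ)).congr
      (Eventually.of_forall fun x => ?_)
    simp [sub_mul]
  rw [prodL1_eq (integrable_mul_test hv hA ψ), prodL1_eq (integrable_mul_test hw hB ψ),
    prodL1_eq h, ← Integrable.toL1_sub]
  congr 1
  funext x
  simp [sub_mul]

lemma prodL1_eq_toL1 {w : Space d → ℂ} (hw : w.HasTemperateGrowth) (ψ : Test d) :
    prodL1 w ψ = toL1 (SchwartzMap.smulLeftCLM ℂ w ψ) := by
  have e : (fun x => w x * ψ x) = SchwartzMap.smulLeftCLM ℂ w ψ := by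
    funext x
    rw [SchwartzMap.smulLeftCLM_apply_apply hw, smul_eq_mul]
  have h : Integrable fun x => w x * ψ x := by
    rw [e]; exact SchwartzMap.integrable _
  rw [prodL1_eq h]
  refine Lp.ext ?_
  filter_upwards [h.coeFn_toL1, (SchwartzMap.smulLeftCLM ℂ w ψ).coeFn_toLp 1 volume] with x h1 h2
  have h3 : w x * ψ x = SchwartzMap.smulLeftCLM ℂ w ψ x := congrFun e x
  rw [h1, h3]
  exact h2.symm

/-! ### Construction of distributions -/

/-- A linear map is continuous once it is so at `0`; any continuous `q` that vanishes at `0`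
controls it there, seminorm or not. -/
lemma exists_distr (P : Test d →ₗ[ℂ] ℂ) {q : Test d → ℝ} (hq : Continuous q) (hq0 : q 0 = 0)
    (hP : ∀ ψ, ‖P ψ‖ ≤ q ψ) : ∃ N : Distr d, ∀ ψ, N ψ = P ψ := by
  have hc : Continuous P := by
    refine continuous_of_continuousAt_zero P ?_
    rw [ContinuousAt, map_zero, tendsto_zero_iff_norm_tendsto_zero]
    refine squeeze_zero (fun _ => norm_nonneg _) hP ?_
    have := hq.tendsto 0
    rwa [hq0] at this
  exact ⟨ContinuousLinearMap.toPointwiseConvergenceCLM ℂ (RingHom.id ℂ) (Test d) ℂ ⟨P, hc⟩,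
    fun ψ => rfl⟩

lemma continuous_l1grad : Continuous (l1grad : Test d → ℝ) := by
  have : (l1grad : Test d → ℝ) = fun ψ =>
      ‖(SchwartzMap.fderivCLM ℂ (Space d) ℂ ψ).toLp 1 (volume : Measure (Space d))‖ :=
    funext fun ψ => SchwartzMap.norm_toLp_one.symm
  rw [this]
  exact ((SchwartzMap.toLpCLM ℂ _ 1 (volume : Measure (Space d))).continuous.comp
    (SchwartzMap.fderivCLM ℂ (Space d) ℂ).continuous).norm

lemma l1_zero : l1 (0 : Test d) = 0 := by simp [l1]

lemma l1grad_zero : l1grad (0 : Test d) = 0 := by simp [l1grad]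

/-! ### The terms of the product series -/

section product

variable {φ₀ : Space d → ℝ} (hφ : IsDyadicGenerator φ₀)

lemma BB.block {β C : ℝ} {g : Distr d} (hg : BB hφ β g C) (k : ℕ) :
    LB (block φ₀ k g) (C * 2 ^ (-β * k)) := fun ψ => by
  rw [block_apply hφ]; exact hg k ψ

variable (φ₀) in
/-- The pairing of `w` times the `k`-th block of `g` with `ψ`. -/
def pt (g : Distr d) (w : Space d → ℂ) (ψ : Test d) (k : ℕ) : ℂ :=
  ext (block φ₀ k g) (prodL1 w ψ)

lemma norm_pt_le {β C A : ℝ} {g : Distr d} (hg : BB hφ β g C) (hC : 0 ≤ C) {w : Space d → ℂ}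
    (hw : Continuous w) (hA : ∀ x, ‖w x‖ ≤ A) (ψ : Test d) (k : ℕ) :
    ‖pt φ₀ g w ψ k‖ ≤ C * 2 ^ (-β * k) * (A * l1 ψ) :=
  (norm_ext_le (hg.block hφ k) _).trans (by gcongr; exact norm_prodL1_le hw hA ψ)

lemma pt_of_smooth {β C : ℝ} {g : Distr d} (hg : BB hφ β g C) {w : Space d → ℂ}
    (hw : w.HasTemperateGrowth) (ψ : Test d) (k : ℕ) :
    pt φ₀ g w ψ k = g (lp hφ k (SchwartzMap.smulLeftCLM ℂ w ψ)) := by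
  rw [pt, prodL1_eq_toL1 hw, ext_toL1 (hg.block hφ k), block_apply hφ]

/-- Product rule for increments: one falls on `w`, pointwise, and the other on `ψ`, in `L¹`. -/
lemma l1_tr_smulLeft_sub_le {a A H : ℝ} {w : Space d → ℂ} (hw : w.HasTemperateGrowth)
    (hA : Hol a w A) (ψ : Test d) (hH : ∀ z, l1 (tr z ψ - ψ) ≤ H * ‖z‖ ^ a) (z : Space d) :
    l1 (tr z (SchwartzMap.smulLeftCLM ℂ w ψ) - SchwartzMap.smulLeftCLM ℂ w ψ) ≤
      (A * (l1 ψ + H)) * ‖z‖ ^ a := by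
  have h1 : l1 (tr z (SchwartzMap.smulLeftCLM ℂ w ψ) - SchwartzMap.smulLeftCLM ℂ w ψ) ≤
      A * ‖z‖ ^ a * l1 (tr z ψ) + A * l1 (tr z ψ - ψ) := by
    rw [l1, l1, l1, ← integral_const_mul, ← integral_const_mul,
      ← integral_add ((tr z ψ).integrable.norm.const_mul _)
        ((tr z ψ - ψ).integrable.norm.const_mul _)]
    refine integral_mono (SchwartzMap.integrable _).norm
      (((tr z ψ).integrable.norm.const_mul _).add ((tr z ψ - ψ).integrable.norm.const_mul _))
      fun x => ?_
    simp only [sub_apply, SchwartzMap.compSubConstCLM_apply,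
      SchwartzMap.smulLeftCLM_apply_apply hw, smul_eq_mul]
    have e : w (x - z) * ψ (x - z) - w x * ψ x =
        (w (x - z) - w x) * ψ (x - z) + w x * (ψ (x - z) - ψ x) := by ring
    rw [e]
    refine (norm_add_le _ _).trans ?_
    rw [norm_mul, norm_mul]
    have h2 := hA.holder (x - z) x
    have e2 : x - z - x = -z := by abel
    rw [e2, norm_neg] at h2
    gcongr
    exact hA.bound x
  rw [l1_tr] at h1
  have h3 := mul_le_mul_of_nonneg_left (hH z) hA.nonneg
  calc _ ≤ _ := h1
    _ ≤ A * ‖z‖ ^ a * l1 ψ + A * (H * ‖z‖ ^ a) := by linarith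
    _ = _ := by ring

lemma tendsto_prodL1 {w : Space d → ℂ} {v : ℕ → Space d → ℂ} (hw : Continuous w)
    (hv : ∀ n, Continuous (v n)) {A B : ℝ} (hA : ∀ x, ‖w x‖ ≤ A) (hB : ∀ n x, ‖v n x‖ ≤ B)
    {δ : ℕ → ℝ} (hδ : Tendsto δ atTop (𝓝 0)) (h : ∀ n x, ‖v n x - w x‖ ≤ δ n) (ψ : Test d) :
    Tendsto (fun n => prodL1 (v n) ψ) atTop (𝓝 (prodL1 w ψ)) := by
  rw [tendsto_iff_norm_sub_tendsto_zero]
  refine squeeze_zero (fun _ => norm_nonneg _)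
    (fun n => norm_prodL1_sub_le (hv n) hw (hB n) hA (h n) ψ ψ) ?_
  simpa [l1_zero] using hδ.mul_const (l1 ψ)

lemma tendsto_moll_error {a : ℝ} (ha : 0 < a) (c A : ℝ) :
    Tendsto (fun n : ℕ => ((2⁻¹ : ℝ) ^ n) ^ a * c * A) atTop (𝓝 0) := by
  have h := (tendsto_half_pow_rpow ha).mul_const (c * A)
  rw [zero_mul] at h
  simpa only [one_div, mul_assoc] using h

/-- The decay of the terms of the product series. -/
lemma exists_norm_pt_le {a : ℝ} (ha0 : 0 < a) (ha1 : a ≤ 1) :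
    ∃ K, 0 ≤ K ∧ ∀ {β C A H : ℝ} {g : Distr d} {w : Space d → ℂ} {ψ : Test d}, BB hφ β g C →
      0 ≤ C → Hol a w A → 0 ≤ H → (∀ z, l1 (tr z ψ - ψ) ≤ H * ‖z‖ ^ a) → ∀ k, k ≠ 0 →
      ‖pt φ₀ g w ψ k‖ ≤ K * (C * A * (l1 ψ + H)) * 2 ^ (-(β + a) * k) := by
  obtain ⟨K, hK, hb⟩ := exists_lp_bounds hφ ha0.le ha1
  refine ⟨K * l1 (𝓕 gauss : Test d), mul_nonneg hK (l1_nonneg _), ?_⟩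
  intro β C A H g w ψ hg hC hw hH hψ k hk
  have hl := l1_nonneg ψ
  have hA := hw.nonneg
  -- For smooth `v` the product `v ψ` is a test function, and the fattened block gains `2 ^ (-a *
  -- k)` from its `L¹` Hölder modulus. A general `w` is the limit of its Gaussian mollifications,
  -- whose Hölder constants are larger by `l1 (𝓕 gauss)` at most.
  have hsmooth : ∀ {B : ℝ} {v : Space d → ℂ}, v.HasTemperateGrowth → Hol a v B →
      ‖pt φ₀ g v ψ k‖ ≤ K * (C * B * (l1 ψ + H)) * 2 ^ (-(β + a) * k) := by
    intro B v hv hB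
    rw [pt_of_smooth hφ hg hv, ← lp_flp]
    have hB0 := hB.nonneg
    refine (hg k _).trans ?_
    have := (hb k).2.2.2.2 hk _ (B * (l1 ψ + H)) (by positivity)
      (l1_tr_smulLeft_sub_le hv hB ψ hψ)
    calc _ ≤ C * 2 ^ (-β * k) * (K * 2 ^ (-a * k) * (B * (l1 ψ + H))) := by gcongr
      _ = _ := by rw [← two_rpow_mul (-β) (-a) (-(β + a)) (by ring)]; ring
  have hv : ∀ n : ℕ, Hol a (moll gauss (2⁻¹ ^ n) w) (l1 (𝓕 gauss : Test d) * A) := fun n =>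
    hw.moll ha0 gauss (by positivity)
  have hlim := tendsto_prodL1 (hw.continuous ha0) (fun n => (hv n).continuous ha0) hw.bound
    (fun n => (hv n).bound) (tendsto_moll_error ha0 _ A)
    (fun n => hw.norm_moll_sub_le ha0 gauss gauss_zero (by positivity)) ψ
  refine le_of_tendsto (((ext (block φ₀ k g)).continuous.tendsto _).comp hlim).norm
    (Eventually.of_forall fun n => ?_)
  refine (hsmooth (hw.hasTemperateGrowth_moll ha0 gauss (2⁻¹ ^ n)) (hv n)).trans_eq ?_
  ring

lemma exists_norm_pt_le_all {a : ℝ} (ha0 : 0 < a) (ha1 : a ≤ 1) :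
    ∃ K, 0 ≤ K ∧ ∀ {β C A H : ℝ} {g : Distr d} {w : Space d → ℂ} {ψ : Test d}, BB hφ β g C →
      0 ≤ C → Hol a w A → 0 ≤ H → (∀ z, l1 (tr z ψ - ψ) ≤ H * ‖z‖ ^ a) → ∀ k,
      ‖pt φ₀ g w ψ k‖ ≤ K * (C * A * (l1 ψ + H)) * 2 ^ (-(β + a) * k) := by
  obtain ⟨K, hK, h⟩ := exists_norm_pt_le hφ ha0 ha1
  refine ⟨K + 1, by positivity, ?_⟩
  intro β C A H g w ψ hg hC hw hH hψ k
  have hl := l1_nonneg ψ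
  have hA := hw.nonneg
  have h0 : 0 ≤ C * A * (l1 ψ + H) := by positivity
  rcases eq_or_ne k 0 with rfl | hk
  · refine (norm_pt_le hφ hg hC (hw.continuous ha0) hw.bound ψ 0).trans ?_
    have h1 : 0 ≤ C * A * H := by positivity
    simp only [Nat.cast_zero, mul_zero, Real.rpow_zero, mul_one]
    nlinarith [mul_nonneg hK h0]
  · refine (h hg hC hw hH hψ k hk).trans ?_
    gcongr
    linarith

lemma summable_pt {a β C A : ℝ} (ha0 : 0 < a) (ha1 : a ≤ 1) (hβ : 0 < β + a) {g : Distr d}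
    (hg : BB hφ β g C) (hC : 0 ≤ C) {w : Space d → ℂ} (hw : Hol a w A) (ψ : Test d) :
    Summable (pt φ₀ g w ψ) := by
  obtain ⟨K, hK, h⟩ := exists_norm_pt_le_all hφ ha0 ha1
  exact Summable.of_norm_bounded ((summable_two_rpow hβ).mul_left _)
    (h hg hC hw (by linarith [l1_nonneg ψ, l1grad_nonneg ψ]) (fun z => l1_tr_sub_le ψ z ha0.le ha1))

open Classical in
/-- Dominated convergence for the product series. -/
lemma tendsto_tsum_pt {a β C A B : ℝ} (ha0 : 0 < a) (ha1 : a ≤ 1) (hβ : 0 < β + a) {g : Distr d}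
    (hg : BB hφ β g C) (hC : 0 ≤ C) {w : Space d → ℂ} (hw : Hol a w A) {v : ℕ → Space d → ℂ}
    (hv : ∀ n, Hol a (v n) B) {δ : ℕ → ℝ} (hδ : Tendsto δ atTop (𝓝 0))
    (hvw : ∀ n x, ‖v n x - w x‖ ≤ δ n) (p : ℕ → ℕ → Prop) (hp : ∀ k, ∀ᶠ n in atTop, p n k)
    (ψ : Test d) :
    Tendsto (fun n => ∑' k, if p n k then pt φ₀ g (v n) ψ k else 0) atTop
      (𝓝 (∑' k, pt φ₀ g w ψ k)) := by
  -- The predicate `p` serves two purposes: it is constantly true when only `w` is approximated, and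
  -- is `k < n + 1` when `g` is also cut off to `S_n g`.
  obtain ⟨K, hK, h⟩ := exists_norm_pt_le_all hφ ha0 ha1
  have hH : 0 ≤ 2 * l1 ψ + l1grad ψ := by linarith [l1_nonneg ψ, l1grad_nonneg ψ]
  have hl := l1_nonneg ψ
  have hB := (hv 0).nonneg
  refine tendsto_tsum_of_dominated_convergence
    (bound := fun k => K * (C * B * (l1 ψ + (2 * l1 ψ + l1grad ψ))) * 2 ^ (-(β + a) * k))
    ((summable_two_rpow hβ).mul_left _) (fun k => ?_) (Eventually.of_forall fun n k => ?_)
  · have := ((ext (block φ₀ k g)).continuous.tendsto _).comp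
      (tendsto_prodL1 (hw.continuous ha0) (fun n => (hv n).continuous ha0) hw.bound
        (fun n => (hv n).bound) hδ hvw ψ)
    refine this.congr' ?_
    filter_upwards [hp k] with n hn
    rw [if_pos hn]
    rfl
  · split_ifs
    · exact h hg hC (hv n) hH (fun z => l1_tr_sub_le ψ z ha0.le ha1) k
    · rw [norm_zero]; positivity

/-! ### The product -/

open Classical in
variable (φ₀) in
/-- The product of the function `w` and the distribution `g`. -/
def prd (g : Distr d) (w : Space d → ℂ) : Distr d :=
  if h : ∃ N : Distr d, ∀ ψ, N ψ = ∑' k, pt φ₀ g w ψ k then h.choose else 0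

lemma prd_apply {a β C A : ℝ} (ha0 : 0 < a) (ha1 : a ≤ 1) (hβ : 0 < β + a) {g : Distr d}
    (hg : BB hφ β g C) (hC : 0 ≤ C) {w : Space d → ℂ} (hw : Hol a w A) (ψ : Test d) :
    prd φ₀ g w ψ = ∑' k, pt φ₀ g w ψ k := by
  have hex : ∃ N : Distr d, ∀ ψ, N ψ = ∑' k, pt φ₀ g w ψ k := by
    obtain ⟨K, hK, h⟩ := exists_norm_pt_le_all hφ ha0 ha1
    have hwc := hw.continuous ha0
    let P : Test d →ₗ[ℂ] ℂ :=
      { toFun := fun ψ => ∑' k, pt φ₀ g w ψ k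
        map_add' := fun φ ψ => by
          rw [← (summable_pt hφ ha0 ha1 hβ hg hC hw φ).tsum_add
            (summable_pt hφ ha0 ha1 hβ hg hC hw ψ)]
          simp only [pt, prodL1_add hwc hw.bound, map_add]
        map_smul' := fun c ψ => by
          simp only [pt, prodL1_smul hwc hw.bound, map_smul, smul_eq_mul, RingHom.id_apply,
            tsum_mul_left] }
    set S := ∑' k : ℕ, (2 : ℝ) ^ (-(β + a) * k)
    refine exists_distr P (q := fun ψ => K * (C * A * (l1 ψ + (2 * l1 ψ + l1grad ψ))) * S) ?_ ?_ ?_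
    · have := continuous_l1 (d := d)
      have := continuous_l1grad (d := d)
      fun_prop
    · simp [l1_zero, l1grad_zero]
    · intro ψ
      have := tsum_of_norm_bounded ((summable_two_rpow hβ).mul_left
        (K * (C * A * (l1 ψ + (2 * l1 ψ + l1grad ψ))))).hasSum
        (h hg hC hw (by linarith [l1_nonneg ψ, l1grad_nonneg ψ])
          (fun z => l1_tr_sub_le ψ z ha0.le ha1))
      rwa [tsum_mul_left] at this
  rw [prd, dif_pos hex]
  exact hex.choose_spec ψ

lemma prd_sub {a β C A B : ℝ} (ha0 : 0 < a) (ha1 : a ≤ 1) (hβ : 0 < β + a) {g : Distr d}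
    (hg : BB hφ β g C) (hC : 0 ≤ C) {v w : Space d → ℂ} (hv : Hol a v A) (hw : Hol a w B) :
    prd φ₀ g v - prd φ₀ g w = prd φ₀ g (v - w) := by
  ext ψ
  rw [prd_apply hφ ha0 ha1 hβ hg hC (hv.sub hw)]
  have : ∀ k, pt φ₀ g (v - w) ψ k = pt φ₀ g v ψ k - pt φ₀ g w ψ k := fun k => by
    rw [pt, prodL1_sub_left (hv.continuous ha0) (hw.continuous ha0) hv.bound hw.bound, map_sub]
    rfl
  simp only [this]
  rw [(summable_pt hφ ha0 ha1 hβ hg hC hv ψ).tsum_sub (summable_pt hφ ha0 ha1 hβ hg hC hw ψ),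
    ← prd_apply hφ ha0 ha1 hβ hg hC hv, ← prd_apply hφ ha0 ha1 hβ hg hC hw]
  rfl

lemma summable_int_geometric {ρ : ℝ} (h0 : 0 ≤ ρ) (h1 : ρ < 1) :
    Summable fun n : ℤ => ρ ^ n.natAbs :=
  Summable.of_nat_of_neg (by simpa using summable_geometric_of_lt_one h0 h1)
    (by simpa using summable_geometric_of_lt_one h0 h1)

/-- Turns decay in `k - j` on either side of the diagonal into a two-sided geometric series,
summable over `k` uniformly in `j`. -/
lemma min_two_rpow_le (x y : ℝ) (j k : ℕ) :
    min ((2 : ℝ) ^ (x * (k - j : ℝ))) (2 ^ (-y * (k - j : ℝ))) ≤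
      ((2 : ℝ) ^ (-min x y)) ^ ((k : ℤ) - j).natAbs := by
  have hnn : ((((k : ℤ) - j).natAbs : ℕ) : ℝ) = |(k : ℝ) - j| := by
    rw [Nat.cast_natAbs]; push_cast; rfl
  rw [← Real.rpow_natCast, ← Real.rpow_mul (by norm_num), hnn]
  rcases le_total (k : ℝ) j with h | h
  · refine (min_le_left _ _).trans (Real.rpow_le_rpow_of_exponent_le (by norm_num) ?_)
    rw [abs_of_nonpos (by linarith)]
    nlinarith [min_le_left x y]
  · refine (min_le_right _ _).trans (Real.rpow_le_rpow_of_exponent_le (by norm_num) ?_)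
    rw [abs_of_nonneg (by linarith)]
    nlinarith [min_le_right x y]

/-- The product of a Hölder continuous function and a distribution in `𝒞^β` is in `𝒞^β`. -/
lemma exists_bb_prd {a β : ℝ} (ha0 : 0 < a) (ha1 : a ≤ 1) (hβ0 : β < 0) (hβ : 0 < β + a) :
    ∃ K, 0 ≤ K ∧ ∀ {C A : ℝ} {g : Distr d} {w : Space d → ℂ}, BB hφ β g C → 0 ≤ C →
      Hol a w A → BB hφ β (prd φ₀ g w) (K * A * C) := by
  obtain ⟨K₁, hK₁, h₁⟩ := exists_norm_pt_le_all hφ ha0 ha1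
  obtain ⟨K₂, hK₂, h₂⟩ := exists_lp_bounds hφ ha0.le ha1
  set ρ : ℝ := 2 ^ (-min (-β) (β + a)) with hρ
  have hρ1 : ρ < 1 := Real.rpow_lt_one_of_one_lt_of_neg (by norm_num)
    (neg_neg_of_pos (lt_min (by linarith) hβ))
  have hsum := summable_int_geometric (ρ := ρ) (by positivity) hρ1
  set S := ∑' n : ℤ, ρ ^ n.natAbs with hS
  refine ⟨(K₂ + 2 * (K₁ * K₂)) * S, mul_nonneg (by positivity) (tsum_nonneg fun _ => by positivity), ?_⟩
  intro C A g w hg hC hw j u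
  have hA := hw.nonneg
  have hl := l1_nonneg u
  obtain ⟨b1, -, b3, -⟩ := h₂ j
  have hinj : Function.Injective fun k : ℕ => (k : ℤ) - j := fun k l h => by
    simpa using h
  set E := (K₂ + 2 * (K₁ * K₂)) * A * C * l1 u * 2 ^ (-β * j) with hE
  have hE0 : 0 ≤ E := by positivity
  have hterm : ∀ k : ℕ, ‖pt φ₀ g w (lp hφ j u) k‖ ≤ E * ρ ^ ((k : ℤ) - j).natAbs := by
    intro k
    -- Useful for `k ≤ j`: only the sup norm of `w` enters, and there is decay as `k` falls below
    -- `j` because `β < 0`.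
    have t1 : ‖pt φ₀ g w (lp hφ j u) k‖ ≤ E * 2 ^ (-β * (k - j : ℝ)) := by
      refine (norm_pt_le hφ hg hC (hw.continuous ha0) hw.bound _ k).trans ?_
      have e : (2 : ℝ) ^ (-β * j) * 2 ^ (-β * (k - j : ℝ)) = 2 ^ (-β * k) := by
        rw [← Real.rpow_add (by norm_num)]; congr 1; ring
      calc _ ≤ C * 2 ^ (-β * k) * (A * (K₂ * l1 u)) := by gcongr; exact b1 u
        _ = K₂ * A * C * l1 u * (2 ^ (-β * j) * 2 ^ (-β * (k - j : ℝ))) := by rw [e]; ring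
        _ ≤ (K₂ + 2 * (K₁ * K₂)) * A * C * l1 u * (2 ^ (-β * j) * 2 ^ (-β * (k - j : ℝ))) := by
          gcongr; linarith [mul_nonneg hK₁ hK₂]
        _ = _ := by rw [hE]; ring
    -- Useful for `k ≥ j`: the Hölder modulus of `lp hφ j u` costs `2 ^ (a * j)`, but the gain `2 ^
    -- (-(β + a) * k)` wins because `β + a > 0`.
    have t2 : ‖pt φ₀ g w (lp hφ j u) k‖ ≤ E * 2 ^ (-(β + a) * (k - j : ℝ)) := by
      refine (h₁ hg hC hw (H := K₂ * 2 ^ (a * j) * l1 u) (by positivity) (b3 u) k).trans ?_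
      have e : (2 : ℝ) ^ (-β * j) * 2 ^ (-(β + a) * (k - j : ℝ)) =
          2 ^ (a * j) * 2 ^ (-(β + a) * k) := by
        rw [← Real.rpow_add (by norm_num), ← Real.rpow_add (by norm_num)]; congr 1; ring
      have e1 : (1 : ℝ) ≤ 2 ^ (a * j) := Real.one_le_rpow (by norm_num) (by positivity)
      calc _ ≤ K₁ * (C * A * (K₂ * 2 ^ (a * j) * l1 u + K₂ * 2 ^ (a * j) * l1 u)) *
            2 ^ (-(β + a) * k) := by
            gcongr
            refine (b1 u).trans ?_
            gcongr
            exact le_mul_of_one_le_right hK₂ e1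
        _ = 2 * (K₁ * K₂) * A * C * l1 u * (2 ^ (-β * j) * 2 ^ (-(β + a) * (k - j : ℝ))) := by
            rw [e]; ring
        _ ≤ (K₂ + 2 * (K₁ * K₂)) * A * C * l1 u *
            (2 ^ (-β * j) * 2 ^ (-(β + a) * (k - j : ℝ))) := by
            gcongr; linarith
        _ = _ := by rw [hE]; ring
    refine (le_min t1 t2).trans ?_
    rw [← mul_min_of_nonneg _ _ hE0]
    gcongr
    exact min_two_rpow_le _ _ j k
  rw [prd_apply hφ ha0 ha1 hβ hg hC hw]
  have hs' : Summable fun k : ℕ => ρ ^ ((k : ℤ) - j).natAbs := hsum.comp_injective hinj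
  refine (tsum_of_norm_bounded (hs'.mul_left E).hasSum hterm).trans ?_
  rw [tsum_mul_left]
  have hle : ∑' k : ℕ, ρ ^ ((k : ℤ) - j).natAbs ≤ S :=
    tsum_comp_le_tsum_of_inj hsum (fun _ => by positivity) hinj
  calc _ ≤ E * S := by gcongr
    _ = _ := by rw [hE]; ring

lemma tendsto_apply_smulLeft {a β C A B : ℝ} (ha0 : 0 < a) (ha1 : a ≤ 1) (hβ : 0 < β + a)
    {g : Distr d} (hg : BB hφ β g C) (hC : 0 ≤ C) {w : Space d → ℂ} (hw : Hol a w A)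
    {v : ℕ → Space d → ℂ} (hv : ∀ n, Hol a (v n) B) (hvg : ∀ n, (v n).HasTemperateGrowth)
    {δ : ℕ → ℝ} (hδ : Tendsto δ atTop (𝓝 0)) (hvw : ∀ n x, ‖v n x - w x‖ ≤ δ n) (ψ : Test d) :
    Tendsto (fun n => g (SchwartzMap.smulLeftCLM ℂ (v n) ψ)) atTop (𝓝 (prd φ₀ g w ψ)) := by
  classical
  rw [prd_apply hφ ha0 ha1 hβ hg hC hw]
  refine (tendsto_tsum_pt hφ ha0 ha1 hβ hg hC hw hv hδ hvw (fun _ _ => True) (by simp) ψ).congr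
    fun n => ?_
  simp only [if_true]
  have hs := summable_pt hφ ha0 ha1 hβ hg hC (hv n) ψ
  have e : pt φ₀ g (v n) ψ = fun k => g (lp hφ k (SchwartzMap.smulLeftCLM ℂ (v n) ψ)) :=
    funext fun k => pt_of_smooth hφ hg (hvg n) ψ k
  rw [e] at hs ⊢
  exact tendsto_nhds_unique (hs.hasSum.tendsto_sum_nat.comp (tendsto_add_atTop_nat 1))
    (tendsto_sum_lp hφ g _)

lemma tendsto_lowFreq_smulLeft {a β C A B : ℝ} (ha0 : 0 < a) (ha1 : a ≤ 1) (hβ : 0 < β + a)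
    {g : Distr d} (hg : BB hφ β g C) (hC : 0 ≤ C) {w : Space d → ℂ} (hw : Hol a w A)
    {v : ℕ → Space d → ℂ} (hv : ∀ n, Hol a (v n) B) (hvg : ∀ n, (v n).HasTemperateGrowth)
    {δ : ℕ → ℝ} (hδ : Tendsto δ atTop (𝓝 0)) (hvw : ∀ n x, ‖v n x - w x‖ ≤ δ n) (ψ : Test d) :
    Tendsto (fun n => TemperedDistribution.smulLeftCLM ℂ (v n) (lowFreq φ₀ n g) ψ) atTop
      (𝓝 (prd φ₀ g w ψ)) := by
  classical
  rw [prd_apply hφ ha0 ha1 hβ hg hC hw]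
  refine (tendsto_tsum_pt hφ ha0 ha1 hβ hg hC hw hv hδ hvw (fun n k => k < n + 1)
    (fun k => (eventually_ge_atTop k).mono fun n hn => by omega) ψ).congr fun n => ?_
  rw [TemperedDistribution.smulLeftCLM_apply_apply, lowFreq, sum_apply]
  refine (tsum_eq_sum (s := Finset.range (n + 1))
    fun k hk => if_neg (by simpa using hk)).trans ?_
  refine Finset.sum_congr rfl fun k hk => ?_
  rw [if_pos (by simpa using hk), pt_of_smooth hφ hg (hvg n), block_apply hφ]

end product

/-! ### Uniqueness and existence of products -/

lemma eq_of_forall_integral_test_eq {f g : Space d → ℂ} (hf : Continuous f) (hg : Continuous g)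
    (h : ∀ ψ : Test d, ∫ x, ψ x * f x = ∫ x, ψ x * g x) : f = g := by
  refine (hf.ae_eq_iff_eq volume hg).1 ?_
  refine ae_eq_of_integral_contDiff_smul_eq hf.locallyIntegrable hg.locallyIntegrable
    fun φ hφ hφc => ?_
  set ψ : Test d := HasCompactSupport.toSchwartzMap (f := fun x => (φ x : ℂ))
    (hφc.comp_left (g := fun r : ℝ => (r : ℂ)) Complex.ofReal_zero)
    (Complex.ofRealCLM.contDiff.comp hφ) with hψ
  simpa [Complex.real_smul] using! h ψ

/-- By Fubini, a multiplier on the test function is a mollification of `w`. This identifies `S_n` of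
a Hölder function with `moll`. -/
lemma integral_mul_mult {w : Space d → ℂ} (hw : Continuous w) {A : ℝ} (hA : ∀ x, ‖w x‖ ≤ A)
    (m ψ : Test d) :
    ∫ x, mult m ψ x * w x = ∫ y, ψ y * ∫ z, w (y + z) * 𝓕 m z := by
  have hA0 : 0 ≤ A := (norm_nonneg _).trans (hA 0)
  have h1 : Integrable (Function.uncurry fun x z => 𝓕 m z * ψ (x - z) * w x)
      ((volume : Measure (Space d)).prod volume) := by
    have h0 := ((ψ.integrable (μ := (volume : Measure (Space d)))).mul_prod
      ((𝓕 m).integrable (μ := (volume : Measure (Space d)))))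
    have h2 := (measurePreserving_sub_prod (G := Space d) volume volume).integrable_comp_of_integrable h0
    refine (h2.bdd_mul (f := fun p : Space d × Space d => w p.1)
      (hw.comp continuous_fst).aestronglyMeasurable
      (Eventually.of_forall fun p => hA p.1)).congr (Eventually.of_forall fun p => ?_)
    simp only [Function.uncurry, Function.comp_apply]
    ring
  calc ∫ x, mult m ψ x * w x = ∫ x, ∫ z, 𝓕 m z * ψ (x - z) * w x := by
        refine integral_congr_ae (Eventually.of_forall fun x => ?_)
        simp only [mult_eq_integral, integral_mul_const]
    _ = ∫ z, ∫ x, 𝓕 m z * ψ (x - z) * w x := integral_integral_swap h1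
    _ = ∫ z, ∫ y, ψ y * (w (y + z) * 𝓕 m z) := by
        refine integral_congr_ae (Eventually.of_forall fun z => ?_)
        simp only
        rw [← integral_add_right_eq_self _ z]
        refine integral_congr_ae (Eventually.of_forall fun x => ?_)
        simp only [add_sub_cancel_right]
        ring
    _ = ∫ y, ∫ z, ψ y * (w (y + z) * 𝓕 m z) := by
        refine integral_integral_swap ?_
        have h0 := (((𝓕 m).integrable (μ := (volume : Measure (Space d)))).mul_prod
          (ψ.integrable (μ := (volume : Measure (Space d)))))
        refine (h0.bdd_mul (f := fun p : Space d × Space d => w (p.2 + p.1))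
          (hw.comp (continuous_snd.add continuous_fst)).aestronglyMeasurable
          (Eventually.of_forall fun p => hA _)).congr (Eventually.of_forall fun p => ?_)
        simp only [Function.uncurry]
        ring
    _ = _ := by simp only [integral_const_mul]

section product

variable {φ₀ : Space d → ℝ} (hφ : IsDyadicGenerator φ₀)

lemma lowFreq_apply (n : ℕ) (f : Distr d) (u : Test d) :
    lowFreq φ₀ n f u = f (mult (dil (gen hφ) (2⁻¹ ^ n)) u) := by
  rw [lowFreq, sum_apply, ← sum_lp, map_sum]
  exact Finset.sum_congr rfl fun j _ => block_apply hφ _ _ _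

lemma toTemperedDistribution_moll {a A : ℝ} (ha : 0 < a) {w : Space d → ℂ} (hw : Hol a w A)
    {W : Distr d} (hW : ∀ ψ : Test d, W ψ = ∫ x, ψ x * w x) (n : ℕ) :
    Function.HasTemperateGrowth.toTemperedDistribution volume
      (hw.hasTemperateGrowth_moll ha (gen hφ) (2⁻¹ ^ n)) = lowFreq φ₀ n W := by
  ext ψ
  rw [lowFreq_apply hφ, hW, integral_mul_mult (hw.continuous ha) hw.bound,
    Function.HasTemperateGrowth.toTemperedDistribution_apply (μ := (volume : Measure (Space d)))]
  simp only [← moll_apply, smul_eq_mul]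

/-- The product in the sense of Littlewood–Paley theory is given by the product series. -/
lemma isProduct_iff {a β C A : ℝ} (ha0 : 0 < a) (ha1 : a ≤ 1) (hβ : 0 < β + a) {g : Distr d}
    (hg : BB hφ β g C) (hC : 0 ≤ C) {w : Space d → ℂ} (hw : Hol a w A)
    {W : Distr d} (hW : ∀ ψ : Test d, W ψ = ∫ x, ψ x * w x) (h : Distr d) :
    IsProduct φ₀ W g h ↔ h = prd φ₀ g w := by
  have hlim := tendsto_lowFreq_smulLeft hφ ha0 ha1 hβ hg hC hw
    (fun n => hw.moll ha0 (gen hφ) (r := 2⁻¹ ^ n) (by positivity))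
    (fun n => hw.hasTemperateGrowth_moll ha0 (gen hφ) (2⁻¹ ^ n)) (tendsto_moll_error ha0 _ A)
    (fun n => hw.norm_moll_sub_le ha0 (gen hφ) (gen_zero hφ) (by positivity))
  constructor
  · rintro ⟨f', hf', hlim'⟩
    ext ψ
    refine tendsto_nhds_unique (hlim' ψ) ((hlim ψ).congr fun n => ?_)
    congr 3
    obtain ⟨h1, h2⟩ := hf' n
    have h3 := hw.hasTemperateGrowth_moll ha0 (gen hφ) (2⁻¹ ^ n)
    -- The function `f' n` in `IsProduct` is forced: it and the mollification are continuous and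
    -- represent the same distribution `S_n W`.
    refine eq_of_forall_integral_test_eq h3.1.continuous h1.1.continuous fun ψ => ?_
    have h4 := (toTemperedDistribution_moll hφ ha0 hw hW n).trans h2.symm
    have h5 := DFunLike.congr_fun h4 ψ
    simpa only [Function.HasTemperateGrowth.toTemperedDistribution_apply, smul_eq_mul] using h5
  · rintro rfl
    exact ⟨_, fun n => ⟨_, toTemperedDistribution_moll hφ ha0 hw hW n⟩, hlim⟩

lemma im_moll {w : Space d → ℂ} (hw : ∀ x, (w x).im = 0) {r : ℝ} (hr : 0 < r) (y : Space d) :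
    (moll gauss r w y).im = 0 := by
  rw [moll_apply]
  have e : (fun z => w (y + z) * 𝓕 (dil gauss r) z) =
      fun z => (((w (y + z)).re * (heatKernel r z).re : ℝ) : ℂ) := by
    funext z
    apply Complex.ext
    · simp [hw, heatKernel]
    · have := heatKernel_im hr z
      rw [heatKernel] at this
      simp [hw, this]
  rw [e, integral_complex_ofReal, Complex.ofReal_im]

/-- The approximation is by Gaussian mollification because the Gaussian has a real kernel. The
kernel of `φ₀` need not be real, as `φ₀` is not assumed to be even. -/
lemma isReal_prd {a β C A : ℝ} (ha0 : 0 < a) (ha1 : a ≤ 1) (hβ : 0 < β + a) {g : Distr d}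
    (hg : BB hφ β g C) (hC : 0 ≤ C) {w : Space d → ℂ} (hw : Hol a w A) (hgr : IsReal g)
    (hwr : ∀ x, (w x).im = 0) : IsReal (prd φ₀ g w) := by
  intro ψ hψ
  have hv : ∀ n : ℕ, (moll gauss (2⁻¹ ^ n) w).HasTemperateGrowth :=
    fun n => hw.hasTemperateGrowth_moll ha0 gauss (2⁻¹ ^ n)
  have hlim := tendsto_apply_smulLeft hφ ha0 ha1 hβ hg hC hw
    (fun n => hw.moll ha0 gauss (r := 2⁻¹ ^ n) (by positivity)) hv (tendsto_moll_error ha0 _ A)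
    (fun n => hw.norm_moll_sub_le ha0 gauss gauss_zero (by positivity)) ψ
  refine tendsto_nhds_unique ((Complex.continuous_im.tendsto _).comp hlim)
    (tendsto_const_nhds.congr fun n => ?_)
  rw [Function.comp_apply, hgr]
  intro x
  rw [SchwartzMap.smulLeftCLM_apply_apply (hv n), smul_eq_mul, Complex.mul_im, hψ,
    im_moll hwr (by positivity)]
  simp

end product

/-! ### The nonlinearity -/

lemma IsC1LipschitzPartials.exists_fderiv_lipschitz {F : Space d → ℝ}
    (hF : IsC1LipschitzPartials F) :
    ∃ L : ℝ, 0 ≤ L ∧ ∀ x y, ‖fderiv ℝ F x - fderiv ℝ F y‖ ≤ L * ‖x - y‖ := by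
  obtain ⟨-, L, hL⟩ := hF
  refine ⟨d * L, by positivity, fun x y => ContinuousLinearMap.opNorm_le_bound _ (by positivity)
    fun v => ?_⟩
  have e : v = ∑ i, v i • EuclideanSpace.single i (1 : ℝ) := by
    simpa using ((EuclideanSpace.basisFun (Fin d) ℝ).sum_repr v).symm
  have h1 : (fderiv ℝ F x - fderiv ℝ F y) v = ∑ i, v i *
      (fderiv ℝ F x (EuclideanSpace.single i 1) - fderiv ℝ F y (EuclideanSpace.single i 1)) := by
    conv_lhs => rw [e]
    simp [map_sum, mul_sub]
  rw [h1]
  refine (norm_sum_le _ _).trans ?_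
  have h2 : ∀ i ∈ Finset.univ, ‖v i * (fderiv ℝ F x (EuclideanSpace.single i 1) -
      fderiv ℝ F y (EuclideanSpace.single i 1))‖ ≤ ‖v‖ * (L * ‖x - y‖) := fun i _ => by
    rw [norm_mul]
    gcongr
    · exact PiLp.norm_apply_le v i
    · exact (hL i).norm_sub_le x y
  refine (Finset.sum_le_sum h2).trans_eq ?_
  simp
  ring

lemma IsC1LipschitzPartials.exists_fderiv_bound {F : Space d → ℝ}
    (hF : IsC1LipschitzPartials F) (R : ℝ) :
    ∃ M : ℝ, 0 ≤ M ∧ ∀ x, ‖x‖ ≤ R → ‖fderiv ℝ F x‖ ≤ M := by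
  obtain ⟨L, hL, h⟩ := hF.exists_fderiv_lipschitz
  refine ⟨‖fderiv ℝ F 0‖ + L * |R|, by positivity, fun x hx => ?_⟩
  have h1 := h x 0
  rw [sub_zero] at h1
  have h2 := norm_sub_norm_le (fderiv ℝ F x) (fderiv ℝ F 0)
  have h3 := mul_le_mul_of_nonneg_left (hx.trans (le_abs_self R)) hL
  linarith

lemma IsC1LipschitzPartials.differentiable {F : Space d → ℝ} (hF : IsC1LipschitzPartials F) :
    Differentiable ℝ F := hF.1.differentiable one_ne_zero

/-- The first order estimate for a function with Lipschitz derivative. -/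
lemma norm_sub_le_of_fderiv_bound {F : Space d → ℝ} (hF : Differentiable ℝ F) {R M : ℝ}
    (hM : ∀ x, ‖x‖ ≤ R → ‖fderiv ℝ F x‖ ≤ M) {p q : Space d} (hp : ‖p‖ ≤ R) (hq : ‖q‖ ≤ R) :
    ‖F p - F q‖ ≤ M * ‖p - q‖ :=
  Convex.norm_image_sub_le_of_norm_fderiv_le (𝕜 := ℝ) (s := Metric.closedBall 0 R)
    (fun x _ => hF x) (fun x hx => hM x (by simpa using hx)) (convex_closedBall _ _)
    (by simpa using hq) (by simpa using hp)

/-- The second order estimate for a function with Lipschitz derivative. -/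
lemma norm_sub_sub_sub_le {F : Space d → ℝ} (hF : Differentiable ℝ F) {R M L : ℝ}
    (hM : ∀ x, ‖x‖ ≤ R → ‖fderiv ℝ F x‖ ≤ M) (hM0 : 0 ≤ M) (hL0 : 0 ≤ L)
    (hL : ∀ x y, ‖fderiv ℝ F x - fderiv ℝ F y‖ ≤ L * ‖x - y‖) {p q p' q' : Space d} {B : ℝ}
    (hp : ‖p‖ ≤ R) (hq : ‖q‖ ≤ R) (hpp : ‖p - p'‖ ≤ B) (hqq : ‖q - q'‖ ≤ B) :
    ‖(F p - F q) - (F p' - F q')‖ ≤ M * ‖(p - q) - (p' - q')‖ + L * B * ‖p' - q'‖ := by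
  have hB : 0 ≤ B := (norm_nonneg _).trans hpp
  have hseg : ∀ (x y : Space d) (C : ℝ) (s : ℝ), s ∈ Icc (0 : ℝ) 1 → ‖x‖ ≤ C → ‖y‖ ≤ C →
      ‖x + s • (y - x)‖ ≤ C := fun x y C s hs hx hy => by
    have e : x + s • (y - x) = (1 - s) • x + s • y := by module
    rw [e]
    refine (norm_add_le _ _).trans ?_
    rw [norm_smul, norm_smul, Real.norm_of_nonneg hs.1, Real.norm_of_nonneg (by linarith [hs.2])]
    nlinarith [hs.1, hs.2]
  have hline : ∀ (x v : Space d) (s : ℝ), HasDerivAt (fun s : ℝ => F (x + s • v))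
      (fderiv ℝ F (x + s • v) v) s := fun x v s => by
    have h1 : HasDerivAt (fun s : ℝ => x + s • v) v s := by
      simpa using ((hasDerivAt_id s).smul_const v).const_add x
    exact (hF _).hasFDerivAt.comp_hasDerivAt s h1
  -- Both segments, from `q` to `p` and from `q'` to `p'`, are run through with the same parameter
  -- `s`. The points at parameter `s` differ by a convex combination of `q - q'` and `p - p'`, hence
  -- by at most `B`.
  have h := norm_image_sub_le_of_norm_deriv_le_segment_01'
    (f := fun s : ℝ => F (q + s • (p - q)) - F (q' + s • (p' - q')))
    (f' := fun s => fderiv ℝ F (q + s • (p - q)) (p - q) -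
      fderiv ℝ F (q' + s • (p' - q')) (p' - q'))
    (C := M * ‖(p - q) - (p' - q')‖ + L * B * ‖p' - q'‖)
    (fun s _ => ((hline q (p - q) s).sub (hline q' (p' - q') s)).hasDerivWithinAt) ?_
  · simpa [sub_sub_sub_comm] using h
  · intro s hs
    have hs' : s ∈ Icc (0 : ℝ) 1 := ⟨hs.1, hs.2.le⟩
    set x := q + s • (p - q) with hx
    set y := q' + s • (p' - q') with hy
    have e : fderiv ℝ F x (p - q) - fderiv ℝ F y (p' - q') =
        fderiv ℝ F x ((p - q) - (p' - q')) + (fderiv ℝ F x - fderiv ℝ F y) (p' - q') := by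
      simp only [map_sub, sub_apply]; ring
    have hxy : ‖x - y‖ ≤ B := by
      have e2 : x - y = (q - q') + s • ((p - p') - (q - q')) := by rw [hx, hy]; module
      rw [e2]
      exact hseg _ _ B s hs' hqq hpp
    rw [e]
    refine (norm_add_le _ _).trans (add_le_add ?_ ?_)
    · refine ((fderiv ℝ F x).le_opNorm _).trans ?_
      gcongr
      exact hM x (hseg q p R s hs' hq hp)
    · refine ((fderiv ℝ F x - fderiv ℝ F y).le_opNorm _).trans ?_
      gcongr
      exact (hL x y).trans (by gcongr)

/-! ### The gradient of an element of `𝒞^{α+1}`, and the function `F(∇u)`. -/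

/-- The gradient of `u` as a continuous function. -/
def gradFun (u : Distr d) (x : Space d) : Space d :=
  WithLp.toLp 2 fun i => (rep (∂_{EuclideanSpace.single i (1 : ℝ)} u) x).re

/-- The function `F (∇u)`. -/
def fgrad (F : Space d → ℝ) (u : Distr d) (x : Space d) : ℂ := F (gradFun u x)

lemma norm_le_of_forall_le {v : Space d} {C : ℝ} (h : ∀ i, |v i| ≤ C) : ‖v‖ ≤ d * C := by
  have e : v = ∑ i, v i • EuclideanSpace.single i (1 : ℝ) := by
    simpa using ((EuclideanSpace.basisFun (Fin d) ℝ).sum_repr v).symm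
  rw [e]
  refine (norm_sum_le _ _).trans ((Finset.sum_le_sum (g := fun _ => C) fun i _ => ?_).trans_eq ?_)
  · rw [norm_smul]
    simpa using h i
  · simp

section gradient

variable {φ₀ : Space d → ℝ} (hφ : IsDyadicGenerator φ₀)

lemma exists_partial_bounds {α a : ℝ} (ha0 : 0 ≤ a) (ha1 : a ≤ 1) (haα : a < α) :
    ∃ K, 0 ≤ K ∧ ∀ (i : Fin d) (f : Distr d) (C : ℝ), 0 ≤ C → BB hφ (α + 1) f C →
      LB (∂_{EuclideanSpace.single i (1 : ℝ)} f) (K * C) ∧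
      HB a (∂_{EuclideanSpace.single i (1 : ℝ)} f) (K * C) := by
  choose K hK h using fun i : Fin d =>
    exists_lineDeriv_bounds hφ (EuclideanSpace.single i (1 : ℝ)) ha0 ha1 haα
  refine ⟨∑ i, K i, Finset.sum_nonneg fun i _ => hK i, fun i f C hC hf => ?_⟩
  have hle : K i * C ≤ (∑ i, K i) * C := by
    gcongr; exact Finset.single_le_sum (fun i _ => hK i) (Finset.mem_univ i)
  obtain ⟨h1, h2⟩ := h i f C hC hf
  refine ⟨fun ψ => (h1 ψ).trans ?_, fun z ψ => (h2 z ψ).trans ?_⟩ <;>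
  · have := l1_nonneg ψ
    gcongr

lemma exists_gradFun_bounds {α a : ℝ} (ha0 : 0 < a) (ha1 : a ≤ 1) (haα : a < α) :
    ∃ K, 0 ≤ K ∧ ∀ (u : Distr d) (C : ℝ), 0 ≤ C → BB hφ (α + 1) u C →
      (∀ x, ‖gradFun u x‖ ≤ K * C) ∧ ∀ x y, ‖gradFun u x - gradFun u y‖ ≤ K * C * ‖x - y‖ ^ a := by
  obtain ⟨K, hK, h⟩ := exists_partial_bounds hφ ha0.le ha1 haα
  refine ⟨d * K, by positivity, fun u C hC hu => ⟨fun x => ?_, fun x y => ?_⟩⟩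
  · rw [mul_assoc]
    refine norm_le_of_forall_le fun i => ?_
    obtain ⟨h1, h2⟩ := h i u C hC hu
    exact (Complex.abs_re_le_norm _).trans (norm_rep_le h1 ha0 h2 x)
  · rw [mul_assoc, mul_assoc, ← mul_assoc K]
    refine norm_le_of_forall_le fun i => ?_
    obtain ⟨h1, h2⟩ := h i u C hC hu
    refine le_trans ?_ (norm_rep_sub_le h1 ha0 h2 x y)
    rw [PiLp.sub_apply]
    simp only [gradFun, ← Complex.sub_re]
    exact Complex.abs_re_le_norm _

lemma gradFun_sub {α C D : ℝ} (hα : 0 < α) {u v : Distr d} (hC : 0 ≤ C) (hD : 0 ≤ D)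
    (hu : BB hφ (α + 1) u C) (hv : BB hφ (α + 1) v D) (x : Space d) :
    gradFun (u - v) x = gradFun u x - gradFun v x := by
  -- Any Hölder exponent in `(0, α)` that is at most `1` serves; it is needed only for the
  -- representing functions to exist.
  have ha : 0 < min (α / 2) 1 := lt_min (by linarith) one_pos
  obtain ⟨K, hK, h⟩ := exists_partial_bounds hφ (a := min (α / 2) 1) ha.le (min_le_right _ _)
    ((min_le_left _ _).trans_lt (by linarith : α / 2 < α))
  ext i
  obtain ⟨h1, h2⟩ := h i u C hC hu
  obtain ⟨h3, h4⟩ := h i v D hD hv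
  simp only [gradFun, PiLp.sub_apply, ← Complex.sub_re]
  have e : ∂_{EuclideanSpace.single i (1 : ℝ)} (u - v) =
      ∂_{EuclideanSpace.single i (1 : ℝ)} u - ∂_{EuclideanSpace.single i (1 : ℝ)} v := by
    ext ψ
    simp only [TemperedDistribution.lineDerivOp_apply_apply, sub_apply]
  rw [← rep_sub h1 ha h2 h3 h4, e]

/-- The place where the Lipschitz derivative of `F` is essential. The Hölder increment of `F(∇u) -
F(∇v)` is a second difference of `F` at the four points `∇u(x)`, `∇v(x)`, `∇u(y)`, `∇v(y)`, which
`norm_sub_sub_sub_le` bounds linearly in `u - v`. -/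
lemma exists_hol_fgrad {F : Space d → ℝ} (hF : IsC1LipschitzPartials F) {α a : ℝ} (ha0 : 0 < a)
    (ha1 : a ≤ 1) (haα : a < α) (R : ℝ) (hR : 0 ≤ R) :
    ∃ A, 0 ≤ A ∧ (∀ u : Distr d, BB hφ (α + 1) u R → Hol a (fgrad F u) A) ∧
      ∀ (u v : Distr d) (D : ℝ), 0 ≤ D → BB hφ (α + 1) u R → BB hφ (α + 1) v R →
        BB hφ (α + 1) (u - v) D → Hol a (fgrad F u - fgrad F v) (A * D) := by
  obtain ⟨K, hK, hg⟩ := exists_gradFun_bounds hφ ha0 ha1 haα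
  obtain ⟨L, hL0, hL⟩ := hF.exists_fderiv_lipschitz
  obtain ⟨M, hM0, hM⟩ := hF.exists_fderiv_bound (K * R)
  have hFd := hF.differentiable
  have hKR : 0 ≤ K * R := by positivity
  refine ⟨‖F 0‖ + M * (K * R) + (M + L * (K * R)) * K, by positivity, fun u hu => ?_, ?_⟩
  · obtain ⟨g1, g2⟩ := hg u R hR hu
    have hnn : 0 ≤ (M + L * (K * R)) * K := by positivity
    refine ⟨fun x => ?_, fun x y => ?_⟩
    · rw [fgrad, Complex.norm_real]
      have := norm_sub_le_of_fderiv_bound hFd hM (g1 x) (q := 0) (by simpa using hKR)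
      rw [sub_zero] at this
      have h2 := norm_sub_norm_le (F (gradFun u x)) (F 0)
      have h3 := mul_le_mul_of_nonneg_left (g1 x) hM0
      linarith
    · rw [fgrad, fgrad, ← Complex.ofReal_sub, Complex.norm_real]
      refine (norm_sub_le_of_fderiv_bound hFd hM (g1 x) (g1 y)).trans ?_
      calc _ ≤ M * (K * R * ‖x - y‖ ^ a) := by gcongr; exact g2 x y
        _ = M * (K * R) * ‖x - y‖ ^ a := by ring
        _ ≤ _ := by
          gcongr
          linarith [norm_nonneg (F 0)]
  · intro u v D hD hu hv huv
    obtain ⟨u1, u2⟩ := hg u R hR hu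
    obtain ⟨v1, v2⟩ := hg v R hR hv
    obtain ⟨w1, w2⟩ := hg (u - v) D hD huv
    have hα : 0 < α := ha0.trans haα
    have hsub := gradFun_sub hφ hα hR hR hu hv
    have hnn : 0 ≤ ‖F 0‖ + M * (K * R) := by positivity
    have hle : (M + L * (K * R)) * K * D ≤
        (‖F 0‖ + M * (K * R) + (M + L * (K * R)) * K) * D := by gcongr; linarith
    refine ⟨fun x => le_trans ?_ hle, fun x y => ?_⟩
    · rw [Pi.sub_apply, fgrad, fgrad, ← Complex.ofReal_sub, Complex.norm_real]
      refine (norm_sub_le_of_fderiv_bound hFd hM (u1 x) (v1 x)).trans ?_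
      rw [← hsub]
      have h1 : 0 ≤ L * (K * R) * (K * D) := by positivity
      calc _ ≤ M * (K * D) := by gcongr; exact w1 x
        _ ≤ _ := by linarith
    · rw [Pi.sub_apply, Pi.sub_apply]
      simp only [fgrad, ← Complex.ofReal_sub, Complex.norm_real]
      refine (norm_sub_sub_sub_le hFd hM hM0 hL0 hL (u1 x) (v1 x) (u2 x y) (v2 x y)).trans ?_
      rw [← hsub, ← hsub]
      calc _ ≤ M * (K * D * ‖x - y‖ ^ a) + L * (K * R * ‖x - y‖ ^ a) * (K * D) := by
            gcongr
            · exact w2 x y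
            · exact w1 y
        _ = (M + L * (K * R)) * K * D * ‖x - y‖ ^ a := by ring
        _ ≤ _ := by gcongr

lemma im_fgrad (F : Space d → ℝ) (u : Distr d) (x : Space d) : (fgrad F u x).im = 0 :=
  Complex.ofReal_im _

lemma toTemperedDistribution_injective :
    Function.Injective (Lp.toTemperedDistribution :
      Lp ℂ ∞ (volume : Measure (Space d)) → Distr d) := fun g h hgh => by
  have h0 : g - h ∈ (Lp.toTemperedDistributionCLM ℂ (volume : Measure (Space d)) ∞).ker := by
    rw [LinearMap.mem_ker, ContinuousLinearMap.coe_coe, map_sub, sub_eq_zero]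
    exact hgh
  rw [Lp.ker_toTemperedDistributionCLM_eq_bot] at h0
  exact sub_eq_zero.1 (by simpa using h0)

section isFGrad

variable {F : Space d → ℝ} {α C : ℝ} {u : Distr d}

/-- An `L^∞` function is determined by its distribution, so the `L^∞` derivatives in `IsFGrad` agree
almost everywhere with the continuous representatives in `gradFun`. -/
lemma IsFGrad.apply_eq (hα : 0 < α) (hC : 0 ≤ C) (hu : BB hφ (α + 1) u C) {w : Distr d} (h : IsFGrad F u w) (ψ : Test d) :
    w ψ = ∫ x, ψ x * fgrad F u x := by
  have ha : 0 < min (α / 2) 1 := lt_min (by linarith) one_pos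
  obtain ⟨K, hK, hb⟩ := exists_partial_bounds hφ (a := min (α / 2) 1) ha.le (min_le_right _ _)
    ((min_le_left _ _).trans_lt (by linarith : α / 2 < α))
  obtain ⟨v, f, hv, hf, rfl⟩ := h
  have hvi : ∀ i, ∀ᵐ x, v i x = rep (∂_{EuclideanSpace.single i (1 : ℝ)} u) x := by
    intro i
    obtain ⟨h1, h2⟩ := hb i u C hC hu
    have hm := memLp_top_of_forall_le (continuous_rep h1 ha h2).aestronglyMeasurable
      (norm_rep_le h1 ha h2)
    have : v i = hm.toLp := toTemperedDistribution_injective (by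
      rw [hv]
      ext ψ
      rw [toTemperedDistribution_toLp_apply, apply_eq_integral_rep h1 ha h2])
    rw [this]
    exact hm.coeFn_toLp
  rw [Lp.toTemperedDistribution_apply]
  refine integral_congr_ae ?_
  filter_upwards [hf, ae_all_iff.2 hvi] with x hx hx2
  simp only [hx, hx2, smul_eq_mul, fgrad, gradFun]

lemma exists_isFGrad (hF : IsC1LipschitzPartials F) (hα : 0 < α) (hC : 0 ≤ C)
    (hu : BB hφ (α + 1) u C) : ∃ w : Distr d, IsFGrad F u w := by
  have ha : 0 < min (α / 2) 1 := lt_min (by linarith) one_pos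
  have haα : min (α / 2) 1 < α := (min_le_left _ _).trans_lt (by linarith : α / 2 < α)
  obtain ⟨K, hK, hb⟩ := exists_partial_bounds hφ (a := min (α / 2) 1) ha.le (min_le_right _ _) haα
  obtain ⟨A, hA, hhol, -⟩ := exists_hol_fgrad hφ hF ha (min_le_right _ _) haα C hC
  have hf := memLp_top_of_forall_le ((hhol u hu).continuous ha).aestronglyMeasurable
    (hhol u hu).bound
  have hm : ∀ i, MemLp (rep (∂_{EuclideanSpace.single i (1 : ℝ)} u)) ∞ volume := fun i =>
    memLp_top_of_forall_le
      (continuous_rep (hb i u C hC hu).1 ha (hb i u C hC hu).2).aestronglyMeasurable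
      (norm_rep_le (hb i u C hC hu).1 ha (hb i u C hC hu).2)
  refine ⟨_, fun i => (hm i).toLp, hf.toLp, fun i => ?_, ?_, rfl⟩
  · ext ψ
    rw [toTemperedDistribution_toLp_apply,
      apply_eq_integral_rep (hb i u C hC hu).1 ha (hb i u C hC hu).2]
  · filter_upwards [hf.coeFn_toLp, ae_all_iff.2 fun i => (hm i).coeFn_toLp] with x hx hx2
    simp only [hx, hx2, fgrad, gradFun]

end isFGrad

end gradient

/-! ### The heat semigroup -/

/-- The heat semigroup on test functions (the identity for negative times). -/
def hts (t : ℝ) (u : Test d) : Test d := if 0 < t then mult (dil gauss √t) u else u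

lemma hts_of_pos {t : ℝ} (ht : 0 < t) (u : Test d) : hts t u = mult (dil gauss √t) u := if_pos ht

lemma hts_of_nonpos {t : ℝ} (ht : t ≤ 0) (u : Test d) : hts t u = u := if_neg ht.not_gt

lemma dil_gauss_sqrt {t : ℝ} (ht : 0 < t) (x : Space d) :
    dil gauss √t x = (Real.exp (-t * (2 * Real.pi) ^ 2 * ‖x‖ ^ 2) : ℂ) := by
  rw [dil_apply _ (Real.sqrt_pos.2 ht).ne', gauss_apply, norm_smul,
    Real.norm_of_nonneg (Real.sqrt_nonneg t), mul_pow √t, Real.sq_sqrt ht.le]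
  congr 2
  ring

lemma heat_apply {t : ℝ} (ht : 0 ≤ t) (f : Distr d) (u : Test d) : heat t f u = f (hts t u) := by
  have h : heat t f u =
      f (mult (fun ξ => (Real.exp (-t * (2 * Real.pi) ^ 2 * ‖ξ‖ ^ 2) : ℂ)) u) := by
    rw [heat, TemperedDistribution.fourierMultiplierCLM_apply_apply]
    rfl
  rw [h]
  rcases ht.eq_or_lt with rfl | ht
  · rw [hts_of_nonpos le_rfl]
    simp [mult]
  · rw [hts_of_pos ht]
    congr 2
    funext x
    exact (dil_gauss_sqrt ht x).symm

lemma hts_hts {s t : ℝ} (hs : 0 ≤ s) (ht : 0 ≤ t) (u : Test d) :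
    hts s (hts t u) = hts (s + t) u := by
  rcases hs.eq_or_lt with rfl | hs
  · rw [hts_of_nonpos le_rfl, zero_add]
  rcases ht.eq_or_lt with rfl | ht
  · rw [hts_of_nonpos (t := 0) le_rfl, add_zero]
  rw [hts_of_pos hs, hts_of_pos ht, hts_of_pos (add_pos hs ht), mult_mult (tg _) (tg _)]
  congr 1
  funext x
  rw [dil_gauss_sqrt hs, dil_gauss_sqrt ht, dil_gauss_sqrt (add_pos hs ht), ← Complex.ofReal_mul,
    ← Real.exp_add]
  congr 2
  ring

lemma hts_mult {m : Space d → ℂ} (hm : m.HasTemperateGrowth) (t : ℝ) (u : Test d) :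
    hts t (mult m u) = mult m (hts t u) := by
  unfold hts
  split_ifs
  · exact mult_comm (tg _) hm u
  · rfl

lemma hts_sub (t : ℝ) (u v : Test d) : hts t (u - v) = hts t u - hts t v := by
  unfold hts
  split_ifs
  · exact mult_apply_sub _ _ _
  · rfl

lemma l1_hts_le (t : ℝ) (u : Test d) : l1 (hts t u) ≤ l1 u := by
  unfold hts
  split_ifs with h
  · have := l1_mult_le (dil gauss √t) u
    rwa [← heatKernel, l1_heatKernel (Real.sqrt_pos.2 h), one_mul] at this
  · exact le_rfl

lemma im_hts (t : ℝ) {u : Test d} (hu : ∀ x, (u x).im = 0) (x : Space d) : (hts t u x).im = 0 := by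
  unfold hts
  split_ifs with h
  · rw [mult_eq_integral]
    have e : (fun z => 𝓕 (dil gauss √t) z * u (x - z)) =
        fun z => (((heatKernel √t z).re * (u (x - z)).re : ℝ) : ℂ) := by
      funext z
      have h1 := heatKernel_im (Real.sqrt_pos.2 h) z
      rw [heatKernel] at h1
      apply Complex.ext
      · simp [hu, heatKernel]
      · simp [hu, h1]
    rw [e, integral_complex_ofReal, Complex.ofReal_im]
  · exact hu x

lemma IsReal.heat {f : Distr d} (hf : IsReal f) {t : ℝ} (ht : 0 ≤ t) : IsReal (heat t f) :=
  fun ψ hψ => by rw [heat_apply ht]; exact hf _ (im_hts t hψ)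

lemma heat_heat {s t : ℝ} (hs : 0 ≤ s) (ht : 0 ≤ t) (f : Distr d) :
    heat s (heat t f) = heat (s + t) f := by
  ext u
  rw [heat_apply hs, heat_apply ht, heat_apply (add_nonneg hs ht), hts_hts ht hs, add_comm]

lemma heat_zero (f : Distr d) : heat 0 f = f := by
  ext u
  rw [heat_apply le_rfl, hts_of_nonpos le_rfl]

lemma exists_l1_hts_sub_le {a : ℝ} (ha0 : 0 ≤ a) (ha1 : a ≤ 1) :
    ∃ C, 0 ≤ C ∧ ∀ (t : ℝ) (u : Test d) (D : ℝ), 0 ≤ D → (∀ z, l1 (tr z u - u) ≤ D * ‖z‖ ^ a) →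
      l1 (hts t u - u) ≤ C * √t ^ a * D := by
  obtain ⟨C, hC, h⟩ := exists_dil_bounds (gauss : Test d) ha0 ha1
  refine ⟨C, hC, fun t u D hD hu => ?_⟩
  unfold hts
  split_ifs with ht
  · simpa [gauss_zero] using (h √t (Real.sqrt_pos.2 ht)).2.1 u D hD hu
  · rw [sub_self, l1_zero]; positivity

section

variable {φ₀ : Space d → ℝ} (hφ : IsDyadicGenerator φ₀)

lemma hts_lp (t : ℝ) (j : ℕ) (u : Test d) : hts t (lp hφ j u) = lp hφ j (hts t u) :=
  hts_mult (tg _) t u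

lemma hts_flp (t : ℝ) (j : ℕ) (u : Test d) : hts t (flp hφ j u) = flp hφ j (hts t u) :=
  hts_mult (tg _) t u

/-! ### Elementary properties of the Besov bounds -/

variable {hφ} {γ C D : ℝ} {f g : Distr d}

lemma BB.mono (h : BB hφ γ f C) (hCD : C ≤ D) : BB hφ γ f D := fun j u =>
  (h j u).trans (by have := l1_nonneg u; gcongr)

lemma BB.add (hf : BB hφ γ f C) (hg : BB hφ γ g D) : BB hφ γ (f + g) (C + D) := fun j u => by
  have e : (f + g) (lp hφ j u) = f (lp hφ j u) + g (lp hφ j u) := rfl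
  rw [e]
  refine (norm_add_le _ _).trans ((add_le_add (hf j u) (hg j u)).trans_eq ?_)
  ring

lemma BB.sub (hf : BB hφ γ f C) (hg : BB hφ γ g D) : BB hφ γ (f - g) (C + D) := fun j u => by
  have e : (f - g) (lp hφ j u) = f (lp hφ j u) - g (lp hφ j u) := rfl
  rw [e]
  refine (norm_sub_le _ _).trans ((add_le_add (hf j u) (hg j u)).trans_eq ?_)
  ring

lemma BB.neg_sub (h : BB hφ γ (f - g) C) : BB hφ γ (g - f) C := fun j u => by
  have e : (g - f) (lp hφ j u) = -((f - g) (lp hφ j u)) := by simp [sub_apply]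
  rw [e, norm_neg]
  exact h j u

lemma bb_zero (hC : 0 ≤ C) : BB hφ γ (0 : Distr d) C := fun j u => by
  have := l1_nonneg u
  have e : (0 : Distr d) (lp hφ j u) = 0 := rfl
  rw [e, norm_zero]
  positivity

lemma BB.eq_zero (h : BB hφ γ f 0) : f = 0 := by
  ext u
  have h1 := tendsto_sum_lp hφ f u
  have h2 : ∀ j, f (lp hφ j u) = 0 := fun j => by simpa using h j u
  simp only [h2, Finset.sum_const_zero] at h1
  exact (tendsto_nhds_unique h1 tendsto_const_nhds)

lemma BB.of_tendsto {c : ℕ → ℝ} (hc : Tendsto c atTop (𝓝 C)) (h : ∀ n, BB hφ γ f (c n)) :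
    BB hφ γ f C := fun j u =>
  ge_of_tendsto' ((hc.mul_const _).mul_const _) fun n => h n j u

lemma BB.heat (hf : BB hφ γ f C) (hC : 0 ≤ C) {t : ℝ} (ht : 0 ≤ t) : BB hφ γ (heat t f) C :=
  fun j u => by
    rw [heat_apply ht, hts_lp]
    refine (hf j _).trans ?_
    gcongr
    exact l1_hts_le t u

variable (hφ)

/-! ### Smoothing and time continuity of the heat semigroup on the Besov scale. -/

/-- The smoothing of the heat semigroup on frequencies of order `2^j`. -/
lemma exists_l1_flp_hts_le (T : ℝ) (hT : 0 < T) {σ : ℝ} (hσ0 : 0 ≤ σ) (hσ1 : σ ≤ 1) :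
    ∃ K, 0 ≤ K ∧ ∀ t, 0 < t → t ≤ T → ∀ j u,
      l1 (flp hφ j (hts t u)) ≤ K * (√t ^ σ)⁻¹ * 2 ^ (-σ * j) * l1 u := by
  obtain ⟨C₁, hC₁, h₁⟩ := exists_lp_bounds hφ hσ0 hσ1
  obtain ⟨C₂, hC₂, h₂⟩ := exists_dil_bounds (gauss : Test d) hσ0 hσ1
  refine ⟨C₁ * √T ^ σ + C₁ * C₂, by positivity, fun t ht htT j u => ?_⟩
  have hl := l1_nonneg u
  have hst := Real.sqrt_pos.2 ht
  rcases eq_or_ne j 0 with rfl | hj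
  -- The lowest block gains nothing from its frequency, but for `t ≤ T` the factor `(√t ^ σ)⁻¹` is
  -- bounded below. This makes the constant depend on `T`.
  · have h3 : 1 ≤ √T ^ σ * (√t ^ σ)⁻¹ := by
      rw [← div_eq_mul_inv, one_le_div (by positivity)]
      exact Real.rpow_le_rpow hst.le (Real.sqrt_le_sqrt htT) hσ0
    calc l1 (flp hφ 0 (hts t u)) ≤ C₁ * l1 u :=
          ((h₁ 0).2.1 _).trans (by gcongr; exact l1_hts_le t u)
      _ ≤ C₁ * (√T ^ σ * (√t ^ σ)⁻¹) * l1 u := by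
          gcongr; exact le_mul_of_one_le_right hC₁ h3
      _ ≤ (C₁ * √T ^ σ + C₁ * C₂) * (√t ^ σ)⁻¹ * 2 ^ (-σ * (0 : ℕ)) * l1 u := by
          simp only [Nat.cast_zero, mul_zero, Real.rpow_zero, mul_one]
          rw [← mul_assoc]
          gcongr
          linarith [mul_nonneg hC₁ hC₂]
  · rw [hts_of_pos ht]
    have h3 := (h₁ j).2.2.2.2 hj (mult (dil gauss √t) u) (C₂ * (√t ^ σ)⁻¹ * l1 u)
      (by positivity) ((h₂ √t hst).2.2 u)
    calc _ ≤ _ := h3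
      _ = C₁ * C₂ * ((√t ^ σ)⁻¹ * 2 ^ (-σ * j) * l1 u) := by ring
      _ ≤ (C₁ * √T ^ σ + C₁ * C₂) * ((√t ^ σ)⁻¹ * 2 ^ (-σ * j) * l1 u) := by
          gcongr; linarith [show 0 ≤ C₁ * √T ^ σ by positivity]
      _ = _ := by ring

/-- The smoothing of the heat semigroup. -/
lemma exists_bb_heat (T : ℝ) (hT : 0 < T) {σ : ℝ} (hσ0 : 0 ≤ σ) (hσ1 : σ ≤ 1) :
    ∃ K, 0 ≤ K ∧ ∀ {γ M : ℝ} {f : Distr d}, 0 ≤ M → BB hφ γ f M → ∀ t, 0 < t → t ≤ T →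
      BB hφ (γ + 2 * σ) (RoughHeat.heat t f) (K * t ^ (-σ) * M) := by
  obtain ⟨K, hK, h⟩ := exists_l1_flp_hts_le hφ T hT hσ0 hσ1
  refine ⟨K * K * 2 ^ σ, by positivity, fun {γ M f} hM hf t ht htT j u => ?_⟩
  -- Each half of the time gains `σ ≤ 1` derivatives, which is as much as first differences can
  -- detect; together they gain `2 * σ`.
  have ht2 : 0 < t / 2 := by linarith
  have e : RoughHeat.heat t f (lp hφ j u) =
      f (lp hφ j (flp hφ j (hts (t / 2) (flp hφ j (hts (t / 2) u))))) := by
    rw [heat_apply ht.le, hts_lp, hts_flp, lp_flp, lp_flp, hts_hts ht2.le ht2.le, add_halves]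
  rw [e]
  have e2 : (√(t / 2) ^ σ)⁻¹ * (√(t / 2) ^ σ)⁻¹ = 2 ^ σ * t ^ (-σ) := by
    rw [← mul_inv, ← Real.mul_rpow (Real.sqrt_nonneg _) (Real.sqrt_nonneg _),
      Real.mul_self_sqrt ht2.le, Real.div_rpow ht.le (by norm_num), Real.rpow_neg ht.le, inv_div,
      div_eq_mul_inv]
  have hl := l1_nonneg u
  calc _ ≤ M * 2 ^ (-γ * j) * (K * (√(t / 2) ^ σ)⁻¹ * 2 ^ (-σ * j) *
        (K * (√(t / 2) ^ σ)⁻¹ * 2 ^ (-σ * j) * l1 u)) := by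
        refine (hf j _).trans ?_
        gcongr
        refine (h _ ht2 (by linarith) j _).trans ?_
        gcongr
        exact h _ ht2 (by linarith) j u
    _ = K * K * ((√(t / 2) ^ σ)⁻¹ * (√(t / 2) ^ σ)⁻¹) * M *
        (2 ^ (-γ * j) * 2 ^ (-σ * j) * 2 ^ (-σ * j)) * l1 u := by ring
    _ = _ := by
        rw [e2, two_rpow_mul _ _ _ rfl, two_rpow_mul _ _ (-(γ + 2 * σ)) (by ring)]
        ring

/-- The continuity of the heat semigroup. -/
lemma exists_bb_heat_sub {a : ℝ} (ha0 : 0 ≤ a) (ha1 : a ≤ 1) :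
    ∃ K, 0 ≤ K ∧ ∀ {γ M : ℝ} {f : Distr d}, 0 ≤ M → BB hφ γ f M → ∀ t, 0 ≤ t →
      BB hφ (γ - a) (RoughHeat.heat t f - f) (K * √t ^ a * M) := by
  obtain ⟨C₁, hC₁, h₁⟩ := exists_lp_bounds hφ ha0 ha1
  obtain ⟨C₂, hC₂, h₂⟩ := exists_l1_hts_sub_le (d := d) ha0 ha1
  refine ⟨C₂ * C₁, by positivity, fun {γ M f} hM hf t ht j u => ?_⟩
  have e : (RoughHeat.heat t f - f) (lp hφ j u) =
      f (lp hφ j (hts t (flp hφ j u) - flp hφ j u)) := by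
    rw [sub_apply, heat_apply ht, lp_sub, map_sub, lp_flp, hts_flp, lp_flp, hts_lp]
  rw [e]
  have hl := l1_nonneg u
  have h3 := h₂ t (flp hφ j u) (C₁ * 2 ^ (a * j) * l1 u) (by positivity) ((h₁ j).2.2.2.1 u)
  calc _ ≤ M * 2 ^ (-γ * j) * (C₂ * √t ^ a * (C₁ * 2 ^ (a * j) * l1 u)) := by
        refine (hf j _).trans ?_
        gcongr
    _ = C₂ * C₁ * √t ^ a * M * (2 ^ (-γ * j) * 2 ^ (a * j)) * l1 u := by ring
    _ = _ := by rw [two_rpow_mul _ _ (-(γ - a)) (by ring)]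

end

/-! ### The Duhamel integral -/

section duhamel

variable {φ₀ : Space d → ℝ} (hφ : IsDyadicGenerator φ₀)

/-- `N` is an admissible right-hand side on `[x, y]`, bounded by `M` in `𝒞^β`. -/
structure Adm {φ₀ : Space d → ℝ} (hφ : IsDyadicGenerator φ₀) (β : ℝ) (N : ℝ → Distr d)
    (x y M : ℝ) : Prop where
  bb : ∀ s ∈ Icc x y, BB hφ β (N s) M
  -- Measurability is asked of the whole integrand, in which the test function moves with `s`.
  meas : ∀ (t : ℝ) (ψ : Test d),
    AEStronglyMeasurable (fun s => N s (hts (t - s) ψ)) (volume.restrict (Icc x y))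

open Classical in
/-- The Duhamel integral `∫_x^y P_{t-s} N(s) ds`. -/
def duh (N : ℝ → Distr d) (x y t : ℝ) : Distr d :=
  if h : ∃ D : Distr d, ∀ ψ, D ψ = ∫ s in x..y, N s (hts (t - s) ψ) then h.choose else 0

lemma intervalIntegrable_sub_rpow {σ : ℝ} (hσ : σ < 1) (x y : ℝ) :
    IntervalIntegrable (fun s => (y - s) ^ (-σ)) volume x y := by
  have h := (intervalIntegral.intervalIntegrable_rpow' (a := y - x) (b := y - y) (r := -σ)
    (by linarith)).comp_sub_left y
  simpa using h

lemma integral_sub_rpow {σ : ℝ} (hσ : σ < 1) (x y : ℝ) :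
    ∫ s in x..y, (y - s) ^ (-σ) = (y - x) ^ (1 - σ) / (1 - σ) := by
  rw [intervalIntegral.integral_comp_sub_left (fun r => r ^ (-σ)), sub_self,
    integral_rpow (Or.inl (by linarith)), show -σ + 1 = 1 - σ by ring,
    Real.zero_rpow (by linarith), sub_zero]

variable {hφ} {β M x y : ℝ} {N : ℝ → Distr d}

lemma Adm.mono (h : Adm hφ β N x y M) {x' y' : ℝ} (hx : x ≤ x') (hy : y' ≤ y) :
    Adm hφ β N x' y' M :=
  ⟨fun s hs => h.bb s ⟨hx.trans hs.1, hs.2.trans hy⟩, fun t ψ =>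
    (h.meas t ψ).mono_set (Icc_subset_Icc hx hy)⟩

lemma Adm.congr (h : Adm hφ β N x y M) {N' : ℝ → Distr d} (e : EqOn N N' (Icc x y)) :
    Adm hφ β N' x y M :=
  ⟨fun s hs => e hs ▸ h.bb s hs, fun t ψ => (h.meas t ψ).congr
    ((ae_restrict_mem measurableSet_Icc).mono fun s hs => by simp only [e hs])⟩

lemma Adm.sub (h : Adm hφ β N x y M) {N' : ℝ → Distr d} {M' D : ℝ} (h' : Adm hφ β N' x y M')
    (hD : ∀ s ∈ Icc x y, BB hφ β (N s - N' s) D) : Adm hφ β (fun s => N s - N' s) x y D :=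
  ⟨hD, fun t ψ => ((h.meas t ψ).sub (h'.meas t ψ)).congr (Eventually.of_forall fun _ => rfl)⟩

lemma Adm.append (h : Adm hφ β N x y M) {z : ℝ} (h' : Adm hφ β N y z M) : Adm hφ β N x z M := by
  refine ⟨fun s hs => ?_, fun t ψ => ?_⟩
  · rcases le_total s y with hy | hy
    · exact h.bb s ⟨hs.1, hy⟩
    · exact h'.bb s ⟨hy, hs.2⟩
  · refine (aestronglyMeasurable_union_iff.2 ⟨h.meas t ψ, h'.meas t ψ⟩).mono_measure
      (Measure.restrict_mono (fun s hs => ?_) le_rfl)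
    rcases le_total s y with hy | hy
    · exact Or.inl ⟨hs.1, hy⟩
    · exact Or.inr ⟨hy, hs.2⟩

lemma Adm.shift {c : ℝ} (h : Adm hφ β N (x + c) (y + c) M) :
    Adm hφ β (fun s => N (s + c)) x y M := by
  refine ⟨fun s hs => h.bb _ ⟨by linarith [hs.1], by linarith [hs.2]⟩, fun t ψ => ?_⟩
  have hmp : MeasurePreserving (fun s : ℝ => s + c) (volume.restrict (Icc x y))
      (volume.restrict (Icc (x + c) (y + c))) := by
    have := (measurePreserving_add_right (volume : Measure ℝ) c).restrict_preimage
      (measurableSet_Icc (a := x + c) (b := y + c))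
    simpa using this
  refine ((h.meas (t + c) ψ).comp_measurePreserving hmp).congr (Eventually.of_forall fun s => ?_)
  simp

lemma Adm.unshift {c : ℝ} (h : Adm hφ β (fun s => N (s + c)) x y M) :
    Adm hφ β N (x + c) (y + c) M := by
  have : Adm hφ β (fun s => N (s + c)) (x + c + -c) (y + c + -c) M := by simpa using h
  simpa using this.shift

variable (hφ)

/-- The basic estimate of the integrand in the Duhamel integral. -/
lemma exists_norm_apply_hts_le (T : ℝ) (hT : 0 < T) {σ : ℝ} (hσ0 : 0 ≤ σ) (hσ1 : σ < 1) :
    ∃ K, 0 ≤ K ∧ ∀ {β M : ℝ} {f : Distr d}, 0 ≤ M → BB hφ β f M → ∀ {s y t : ℝ}, s < y → y ≤ t →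
      t - s ≤ T → BB hφ (β + 2 * σ) (heat (t - s) f) (K * M * (y - s) ^ (-σ)) := by
  obtain ⟨K, hK, h⟩ := exists_bb_heat hφ T hT hσ0 hσ1.le
  refine ⟨K, hK, fun {β M f} hM hf {s y t} hs hy ht => ?_⟩
  refine (h hM hf (t - s) (by linarith) ht).mono ?_
  have : (t - s) ^ (-σ) ≤ (y - s) ^ (-σ) :=
    Real.rpow_le_rpow_of_nonpos (by linarith) (by linarith) (by linarith)
  calc _ ≤ K * (y - s) ^ (-σ) * M := by gcongr
    _ = _ := by ring

variable {hφ}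

/-- A gain of one derivative puts `P_{t-s} N(s)` in `𝒞^{β+1}` with `β + 1 > 0`, hence makes it
bounded on `L¹`, at the price of the integrable singularity `(y - s) ^ (-1/2)`. So the Duhamel
integral exists as a distribution. -/
lemma Adm.exists_bound (hβ : -1 < β) (hM : 0 ≤ M) (h : Adm hφ β N x y M) {t : ℝ} (hyt : y ≤ t) :
    ∃ C, 0 ≤ C ∧ ∀ s ∈ Ico x y, ∀ ψ : Test d,
      ‖N s (hts (t - s) ψ)‖ ≤ C * (y - s) ^ (-(1 / 2 : ℝ)) * l1 ψ := by
  have hT : 0 < |t - x| + 1 := by positivity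
  obtain ⟨K, hK, hb⟩ := exists_norm_apply_hts_le hφ _ hT (σ := 1 / 2) (by norm_num) (by norm_num)
  obtain ⟨K', hK', hl⟩ := exists_lb_of_bb hφ (γ := β + 2 * (1 / 2)) (by linarith)
  refine ⟨K' * (K * M), by positivity, fun s hs ψ => ?_⟩
  have h1 := hb hM (h.bb s ⟨hs.1, hs.2.le⟩) hs.2 hyt
    (by linarith [hs.1, le_abs_self (t - x)])
  have h2 := hl _ _ h1 ψ
  rw [heat_apply (by linarith [hs.2])] at h2
  calc _ ≤ _ := h2
    _ = _ := by ring

lemma Adm.intervalIntegrable (hβ : -1 < β) (hM : 0 ≤ M) (h : Adm hφ β N x y M) {t : ℝ}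
    (hxy : x ≤ y) (hyt : y ≤ t) (ψ : Test d) :
    IntervalIntegrable (fun s => N s (hts (t - s) ψ)) volume x y := by
  obtain ⟨C, hC, hb⟩ := h.exists_bound hβ hM hyt
  have h1 := ((intervalIntegrable_sub_rpow (σ := 1 / 2) (by norm_num) x y).const_mul C).mul_const
    (l1 ψ)
  refine h1.mono_fun ?_ ?_
  · rw [uIoc_of_le hxy]
    exact (h.meas t ψ).mono_set Ioc_subset_Icc_self
  · rw [uIoc_of_le hxy, ← restrict_Ioo_eq_restrict_Ioc]
    filter_upwards [ae_restrict_mem measurableSet_Ioo] with s hs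
    exact (hb s ⟨hs.1.le, hs.2⟩ ψ).trans (le_abs_self _)

lemma hts_add (t : ℝ) (u v : Test d) : hts t (u + v) = hts t u + hts t v := by
  have h := hts_sub t (u + v) v
  rw [add_sub_cancel_right] at h
  rw [h, sub_add_cancel]

lemma hts_smul (t : ℝ) (c : ℂ) (u : Test d) : hts t (c • u) = c • hts t u := by
  unfold hts
  split_ifs
  · have h : ∀ w, mult (dil gauss √t) w = (FourierTransform.fourierCLM ℂ (Test d) ∘L
      SchwartzMap.smulLeftCLM ℂ (dil gauss √t) ∘L FourierTransform.fourierInvCLM ℂ (Test d)) w :=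
        fun _ => rfl
    rw [h, h, map_smul]
  · rfl

lemma Adm.duh_apply (hβ : -1 < β) (hM : 0 ≤ M) (h : Adm hφ β N x y M) {t : ℝ}
    (hxy : x ≤ y) (hyt : y ≤ t) (ψ : Test d) :
    duh N x y t ψ = ∫ s in x..y, N s (hts (t - s) ψ) := by
  have hex : ∃ D : Distr d, ∀ ψ, D ψ = ∫ s in x..y, N s (hts (t - s) ψ) := by
    obtain ⟨C, hC, hb⟩ := h.exists_bound hβ hM hyt
    have hi := fun ψ => h.intervalIntegrable hβ hM hxy hyt ψ
    let P : Test d →ₗ[ℂ] ℂ :=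
      { toFun := fun ψ => ∫ s in x..y, N s (hts (t - s) ψ)
        map_add' := fun φ ψ => by
          rw [← intervalIntegral.integral_add (hi φ) (hi ψ)]
          simp only [hts_add, map_add]
        map_smul' := fun c ψ => by
          simp only [hts_smul, map_smul, smul_eq_mul, RingHom.id_apply,
            intervalIntegral.integral_const_mul] }
    refine exists_distr P (q := fun ψ => (∫ s in x..y, C * (y - s) ^ (-(1 / 2 : ℝ))) * l1 ψ)
      (continuous_const.mul continuous_l1) (by simp [l1_zero]) fun ψ => ?_
    have hii := intervalIntegrable_sub_rpow (σ := 1 / 2) (by norm_num) x y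
    rw [← intervalIntegral.integral_mul_const]
    refine intervalIntegral.norm_integral_le_of_norm_le hxy ?_ ((hii.const_mul C).mul_const _)
    filter_upwards [compl_mem_ae_iff.2 (measure_singleton y)] with s hsy hs
    exact hb s ⟨hs.1.le, lt_of_le_of_ne hs.2 hsy⟩ ψ
  rw [duh, dif_pos hex]
  exact hex.choose_spec ψ

variable (hφ)

/-- The regularity of the Duhamel integral. -/
lemma exists_bb_duh (T : ℝ) (hT : 0 < T) {σ : ℝ} (hσ0 : 0 ≤ σ) (hσ1 : σ < 1) :
    ∃ K, 0 ≤ K ∧ ∀ {β M x y t : ℝ} {N : ℝ → Distr d}, -1 < β → 0 ≤ M → Adm hφ β N x y M →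
      x ≤ y → y ≤ t → t - x ≤ T →
      BB hφ (β + 2 * σ) (duh N x y t) (K * M * (y - x) ^ (1 - σ)) := by
  obtain ⟨K, hK, hb⟩ := exists_norm_apply_hts_le hφ T hT hσ0 hσ1
  refine ⟨K / (1 - σ), div_nonneg hK (by linarith), ?_⟩
  intro β M x y t N hβ hM h hxy hyt htx j u
  rw [h.duh_apply hβ hM hxy hyt]
  have hii := ((intervalIntegrable_sub_rpow hσ1 x y).const_mul (K * M)).mul_const
    (2 ^ (-(β + 2 * σ) * j) * l1 u)
  have h1 : ‖∫ s in x..y, N s (hts (t - s) (lp hφ j u))‖ ≤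
      ∫ s in x..y, K * M * (y - s) ^ (-σ) * (2 ^ (-(β + 2 * σ) * j) * l1 u) := by
    refine intervalIntegral.norm_integral_le_of_norm_le hxy ?_ hii
    filter_upwards [compl_mem_ae_iff.2 (measure_singleton y)] with s hsy hs
    have hsy : s < y := lt_of_le_of_ne hs.2 hsy
    have := hb hM (h.bb s ⟨hs.1.le, hs.2⟩) hsy hyt (by linarith [hs.1]) j u
    rw [heat_apply (by linarith)] at this
    calc _ ≤ _ := this
      _ = _ := by ring
  refine h1.trans_eq ?_
  rw [intervalIntegral.integral_mul_const, intervalIntegral.integral_const_mul,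
    integral_sub_rpow hσ1]
  ring

variable {hφ}

lemma Adm.isReal_duh (hβ : -1 < β) (hM : 0 ≤ M) (h : Adm hφ β N x y M) {t : ℝ}
    (hxy : x ≤ y) (hyt : y ≤ t) (hN : ∀ s ∈ Icc x y, IsReal (N s)) : IsReal (duh N x y t) := by
  intro ψ hψ
  rw [h.duh_apply hβ hM hxy hyt]
  have h1 := Complex.imCLM.intervalIntegral_comp_comm
    (h.intervalIntegrable hβ hM hxy hyt ψ)
  rw [← Complex.imCLM_apply, ← h1]
  refine intervalIntegral.integral_zero_ae (Eventually.of_forall fun s hs => ?_)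
  rw [uIoc_of_le hxy] at hs
  exact hN s ⟨hs.1.le, hs.2⟩ _ (im_hts _ hψ)

lemma Adm.duh_sub (hβ : -1 < β) (hM : 0 ≤ M) (h : Adm hφ β N x y M) {N' : ℝ → Distr d} {M' D : ℝ}
    (hM' : 0 ≤ M') (h' : Adm hφ β N' x y M') (hD0 : 0 ≤ D)
    (hD : ∀ s ∈ Icc x y, BB hφ β (N s - N' s) D) {t : ℝ} (hxy : x ≤ y) (hyt : y ≤ t) :
    duh N x y t - duh N' x y t = duh (fun s => N s - N' s) x y t := by
  ext ψ
  rw [(h.sub h' hD).duh_apply hβ hD0 hxy hyt, sub_apply, h.duh_apply hβ hM hxy hyt,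
    h'.duh_apply hβ hM' hxy hyt, ← intervalIntegral.integral_sub
      (h.intervalIntegrable hβ hM hxy hyt ψ) (h'.intervalIntegrable hβ hM' hxy hyt ψ)]
  rfl

lemma Adm.duh_congr (hβ : -1 < β) (hM : 0 ≤ M) (h : Adm hφ β N x y M) {N' : ℝ → Distr d}
    (e : EqOn N N' (Icc x y)) {t : ℝ} (hxy : x ≤ y) (hyt : y ≤ t) :
    duh N x y t = duh N' x y t := by
  ext ψ
  rw [h.duh_apply hβ hM hxy hyt, (h.congr e).duh_apply hβ hM hxy hyt]
  refine intervalIntegral.integral_congr fun s hs => ?_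
  rw [uIcc_of_le hxy] at hs
  simp only [e hs]

lemma Adm.duh_split (hβ : -1 < β) (hM : 0 ≤ M) {z : ℝ} (h : Adm hφ β N x z M)
    (hxy : x ≤ y) (hyz : y ≤ z) :
    duh N x z z = heat (z - y) (duh N x y y) + duh N y z z := by
  ext ψ
  have h1 := h.mono le_rfl hyz
  have h2 := h.mono hxy le_rfl
  rw [add_apply, heat_apply (by linarith), h.duh_apply hβ hM (hxy.trans hyz) le_rfl,
    h1.duh_apply hβ hM hxy le_rfl, h2.duh_apply hβ hM hyz le_rfl,
    ← intervalIntegral.integral_add_adjacent_intervals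
      (h1.intervalIntegrable hβ hM hxy hyz ψ) (h2.intervalIntegrable hβ hM hyz le_rfl ψ)]
  congr 1
  refine intervalIntegral.integral_congr fun s hs => ?_
  rw [uIcc_of_le hxy] at hs
  rw [hts_hts (by linarith [hs.2]) (by linarith)]
  congr 2
  ring

lemma Adm.duh_shift (hβ : -1 < β) (hM : 0 ≤ M) {c : ℝ} (h : Adm hφ β N (x + c) (y + c) M)
    {t : ℝ} (hxy : x ≤ y) (hyt : y ≤ t) :
    duh (fun s => N (s + c)) x y t = duh N (x + c) (y + c) (t + c) := by
  ext ψ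
  rw [h.shift.duh_apply hβ hM hxy hyt, h.duh_apply hβ hM (by linarith) (by linarith),
    ← intervalIntegral.integral_comp_add_right (fun s => N s (hts (t + c - s) ψ))]
  simp

variable (hφ)

/-- The Duhamel integral is Hölder continuous in time. -/
lemma exists_bb_duh_sub (T : ℝ) (hT : 0 < T) {θ : ℝ} (hθ0 : 0 ≤ θ) (hθ1 : θ < 1) :
    ∃ K, 0 ≤ K ∧ ∀ {β M x y z : ℝ} {N : ℝ → Distr d}, -1 < β → 0 ≤ M → Adm hφ β N x z M →
      x ≤ y → y ≤ z → z - x ≤ T →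
      BB hφ (β + 2 * θ) (duh N x z z - duh N x y y)
        (K * M * (√(z - y) ^ (1 - θ) + (z - y) ^ (1 - θ))) := by
  obtain ⟨K₁, hK₁, h₁⟩ := exists_bb_duh hφ T hT hθ0 hθ1
  -- The exponent `(1 + θ) / 2` lies midway between `θ` and `1`. The surplus of `1 - θ` derivatives
  -- is traded for the factor `√(z - y) ^ (1 - θ)`.
  obtain ⟨K₂, hK₂, h₂⟩ := exists_bb_duh hφ T hT (σ := (1 + θ) / 2) (by linarith) (by linarith)
  obtain ⟨K₃, hK₃, h₃⟩ := exists_bb_heat_sub hφ (a := 1 - θ) (by linarith) (by linarith)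
  refine ⟨K₁ + K₃ * K₂ * T ^ (1 - (1 + θ) / 2), by positivity, ?_⟩
  intro β M x y z N hβ hM h hxy hyz hzx
  have hyx : (0 : ℝ) ≤ y - x := by linarith
  have hzy : (0 : ℝ) ≤ z - y := by linarith
  have g2 := h₂ hβ hM (h.mono le_rfl hyz) hxy le_rfl (by linarith)
  have g3 := h₃ (by positivity) g2 (z - y) (by linarith)
  have g1 := h₁ hβ hM (h.mono hxy le_rfl) hyz le_rfl (by linarith)
  rw [show β + 2 * ((1 + θ) / 2) - (1 - θ) = β + 2 * θ by ring] at g3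
  have e : duh N x z z - duh N x y y =
      (heat (z - y) (duh N x y y) - duh N x y y) + duh N y z z := by
    rw [h.duh_split hβ hM hxy hyz]; abel
  rw [e]
  refine (g3.add g1).mono ?_
  have h4 : (y - x) ^ (1 - (1 + θ) / 2) ≤ T ^ (1 - (1 + θ) / 2) :=
    Real.rpow_le_rpow hyx (by linarith) (by linarith)
  have h5 : 0 ≤ √(z - y) ^ (1 - θ) := by positivity
  have h6 : 0 ≤ (z - y) ^ (1 - θ) := by positivity
  calc _ ≤ K₃ * √(z - y) ^ (1 - θ) * (K₂ * M * T ^ (1 - (1 + θ) / 2)) +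
        K₁ * M * (z - y) ^ (1 - θ) := by gcongr
    _ = K₃ * K₂ * T ^ (1 - (1 + θ) / 2) * M * √(z - y) ^ (1 - θ) +
        K₁ * M * (z - y) ^ (1 - θ) := by ring
    _ ≤ (K₁ + K₃ * K₂ * T ^ (1 - (1 + θ) / 2)) * M * √(z - y) ^ (1 - θ) +
        (K₁ + K₃ * K₂ * T ^ (1 - (1 + θ) / 2)) * M * (z - y) ^ (1 - θ) := by
        gcongr
        · linarith
        · have : 0 ≤ K₃ * K₂ * T ^ (1 - (1 + θ) / 2) := by positivity
          linarith
    _ = _ := by ring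

end duhamel

/-! ### Measurability of the nonlinear term -/

/-- The functionals are measurable only after pairing with test functions. Density extends this to
fixed elements of `L¹`, and simple functions then handle an argument that depends on `s`. -/
lemma aestronglyMeasurable_ext {μ : Measure ℝ} {f : ℝ → Distr d} {C : ℝ} (hf : ∀ s, LB (f s) C)
    (hm : ∀ ψ : Test d, AEStronglyMeasurable (fun s => f s ψ) μ) {h : ℝ → L1 d}
    (hh : AEStronglyMeasurable h μ) : AEStronglyMeasurable (fun s => ext (f s) (h s)) μ := by
  have h1 : ∀ c : L1 d, AEStronglyMeasurable (fun s => ext (f s) c) μ := by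
    intro c
    obtain ⟨v, hv, hlim⟩ := mem_closure_iff_seq_limit.1 (denseRange_toL1 c)
    choose ψ hψ using hv
    refine aestronglyMeasurable_of_tendsto_ae atTop (f := fun n s => f s (ψ n))
      (fun n => hm (ψ n)) (Eventually.of_forall fun s => ?_)
    refine (((ext (f s)).continuous.tendsto c).comp hlim).congr fun n => ?_
    rw [Function.comp_apply, ← hψ n, ext_toL1 (hf s)]
  obtain ⟨g, hg, hhg⟩ := hh
  have h2 : AEStronglyMeasurable (fun s => ext (f s) (g s)) μ := by
    refine aestronglyMeasurable_of_tendsto_ae atTop (f := fun n s => ext (f s) (hg.approx n s))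
      (fun n => ?_)
      (Eventually.of_forall fun s => ((ext (f s)).continuous.tendsto _).comp (hg.tendsto_approx s))
    have e : (fun s => ext (f s) (hg.approx n s)) = fun s =>
        ∑ c ∈ (hg.approx n).range, (hg.approx n ⁻¹' {c}).indicator (fun s => ext (f s) c) s := by
      funext s
      rw [Finset.sum_eq_single (hg.approx n s)]
      · rw [indicator_of_mem (by simp)]
      · intro c _ hc
        rw [indicator_of_notMem]
        exact fun h => hc (by simpa using h.symm)
      · intro h
        exact (h (SimpleFunc.mem_range_self _ _)).elim
    rw [e]
    exact Finset.aestronglyMeasurable_fun_sum _ fun c _ =>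
      (h1 c).indicator ((hg.approx n).measurableSet_fiber c)
  exact h2.congr (hhg.mono fun s hs => by simp only [hs])

lemma exists_l1_hts_sub_hts_le (ψ : Test d) :
    ∃ C, 0 ≤ C ∧ ∀ p q : ℝ, l1 (hts p ψ - hts q ψ) ≤ C * √|p - q| := by
  obtain ⟨C, hC, h⟩ := exists_l1_hts_sub_le (d := d) (zero_le_one' ℝ) le_rfl
  have hD : 0 ≤ 2 * l1 ψ + l1grad ψ := by linarith [l1_nonneg ψ, l1grad_nonneg ψ]
  refine ⟨C * (2 * l1 ψ + l1grad ψ), by positivity, ?_⟩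
  have key : ∀ p q : ℝ, 0 ≤ q → q ≤ p →
      l1 (hts p ψ - hts q ψ) ≤ C * (2 * l1 ψ + l1grad ψ) * √|p - q| := by
    intro p q hq hpq
    have e : hts p ψ - hts q ψ = hts q (hts (p - q) ψ - ψ) := by
      rw [hts_sub, hts_hts hq (by linarith), add_sub_cancel]
    rw [e]
    refine (l1_hts_le _ _).trans ((h (p - q) ψ _ hD
      fun z => l1_tr_sub_le ψ z zero_le_one le_rfl).trans_eq ?_)
    rw [Real.rpow_one, abs_of_nonneg (by linarith)]
    ring
  have key2 : ∀ p q : ℝ, q ≤ p →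
      l1 (hts p ψ - hts q ψ) ≤ C * (2 * l1 ψ + l1grad ψ) * √|p - q| := by
    intro p q hpq
    rcases le_total 0 q with hq | hq
    · exact key p q hq hpq
    rw [hts_of_nonpos hq]
    rcases le_total p 0 with hp | hp
    · rw [hts_of_nonpos hp, sub_self, l1_zero]; positivity
    · have := key p 0 le_rfl hp
      rw [hts_of_nonpos le_rfl] at this
      refine this.trans ?_
      gcongr
  intro p q
  rcases le_total q p with hpq | hpq
  · exact key2 p q hpq
  · rw [← l1_neg, neg_sub, abs_sub_comm]
    exact key2 q p hpq

/-! ### Drifts, curves in `𝒞^γ`, and the nonlinear term along a curve. -/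

section curves

variable {φ₀ : Space d → ℝ} (hφ : IsDyadicGenerator φ₀)

/-- A drift that is bounded by `M` in `𝒞^β` at all times. -/
structure Drift {φ₀ : Space d → ℝ} (hφ : IsDyadicGenerator φ₀) (β : ℝ) (b : ℝ → Distr d)
    (M : ℝ) : Prop where
  bb : ∀ s, BB hφ β (b s) M
  real : ∀ s, IsReal (b s)
  meas : ∀ ψ : Test d, AEStronglyMeasurable (fun s => b s ψ) volume

/-- A bounded curve in `𝒞^γ` on `[0, h]` that is continuous at positive times. -/
structure Curve {φ₀ : Space d → ℝ} (hφ : IsDyadicGenerator φ₀) (γ : ℝ) (u : ℝ → Distr d)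
    (h R : ℝ) : Prop where
  bb : ∀ s ∈ Icc 0 h, BB hφ γ (u s) R
  real : ∀ s ∈ Icc 0 h, IsReal (u s)
  cont : ∀ s ∈ Ioc 0 h, ∀ ε > 0, ∃ δ > 0, ∀ s' ∈ Icc 0 h, |s' - s| < δ → BB hφ γ (u s' - u s) ε

variable (φ₀) in
/-- The nonlinear term `F(∇u) b`. -/
def nl (F : Space d → ℝ) (b u : ℝ → Distr d) (s : ℝ) : Distr d := prd φ₀ (b s) (fgrad F (u s))

variable {hφ}

lemma Drift.shift {β M : ℝ} {b : ℝ → Distr d} (hb : Drift hφ β b M) (c : ℝ) :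
    Drift hφ β (fun s => b (s + c)) M :=
  ⟨fun _ => hb.bb _, fun _ => hb.real _, fun ψ =>
    (hb.meas ψ).comp_measurePreserving (measurePreserving_add_right volume c)⟩

lemma Curve.mono {γ h h' R R' : ℝ} {u : ℝ → Distr d} (hu : Curve hφ γ u h R) (hh : h' ≤ h)
    (hR : R ≤ R') : Curve hφ γ u h' R' := by
  refine ⟨fun s hs => (hu.bb s ⟨hs.1, hs.2.trans hh⟩).mono hR,
    fun s hs => hu.real s ⟨hs.1, hs.2.trans hh⟩, fun s hs ε hε => ?_⟩
  obtain ⟨δ, hδ, h⟩ := hu.cont s ⟨hs.1, hs.2.trans hh⟩ ε hε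
  exact ⟨δ, hδ, fun s' hs' => h s' ⟨hs'.1, hs'.2.trans hh⟩⟩

lemma Curve.congr {γ h R : ℝ} {u v : ℝ → Distr d} (hu : Curve hφ γ u h R)
    (e : EqOn u v (Icc 0 h)) : Curve hφ γ v h R := by
  refine ⟨fun s hs => e hs ▸ hu.bb s hs, fun s hs => e hs ▸ hu.real s hs, fun s hs ε hε => ?_⟩
  obtain ⟨δ, hδ, h⟩ := hu.cont s hs ε hε
  exact ⟨δ, hδ, fun s' hs' h' => by
    rw [← e hs', ← e ⟨hs.1.le, hs.2⟩]; exact h s' hs' h'⟩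

variable (hφ)

lemma Curve.continuousOn_prodL1 {α a A h R t : ℝ} (ha0 : 0 < a) {F : Space d → ℝ} {u : ℝ → Distr d}
    (hu : Curve hφ (α + 1) u h R) (hA : 0 ≤ A)
    (h1 : ∀ u : Distr d, BB hφ (α + 1) u R → Hol a (fgrad F u) A)
    (h2 : ∀ (u v : Distr d) (D : ℝ), 0 ≤ D → BB hφ (α + 1) u R → BB hφ (α + 1) v R →
        BB hφ (α + 1) (u - v) D → Hol a (fgrad F u - fgrad F v) (A * D)) (ψ : Test d) :
    ContinuousOn (fun s => prodL1 (fgrad F (u s)) (hts (t - s) ψ)) (Ioc 0 h) := by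
  intro s₀ hs₀
  obtain ⟨C, hC, hψ⟩ := exists_l1_hts_sub_hts_le ψ
  have hl := l1_nonneg ψ
  have hI : ∀ {s}, s ∈ Ioc 0 h → s ∈ Icc 0 h := fun hs => ⟨hs.1.le, hs.2⟩
  rw [ContinuousWithinAt, Metric.tendsto_nhds]
  intro ε hε
  have hε1 : 0 < ε / (2 * (A * l1 ψ + 1)) := by positivity
  obtain ⟨δ, hδ, hc⟩ := hu.cont s₀ hs₀ _ hε1
  have hlim : Tendsto (fun s => A * (C * √|t - s - (t - s₀)|)) (𝓝 s₀) (𝓝 0) := by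
    have : Continuous fun s => A * (C * √|t - s - (t - s₀)|) := by fun_prop
    simpa using this.tendsto s₀
  filter_upwards [self_mem_nhdsWithin,
    nhdsWithin_le_nhds (hlim.eventually_lt_const (half_pos hε)),
    nhdsWithin_le_nhds (Metric.ball_mem_nhds s₀ hδ)] with s hs hs2 hs3
  have hd := h2 _ _ _ hε1.le (hu.bb s (hI hs)) (hu.bb s₀ (hI hs₀))
    (hc s (hI hs) (by simpa [Real.dist_eq] using hs3))
  have hw := h1 _ (hu.bb s (hI hs))
  have hw0 := h1 _ (hu.bb s₀ (hI hs₀))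
  rw [dist_eq_norm]
  refine (norm_prodL1_sub_le (hw.continuous ha0) (hw0.continuous ha0) hw.bound hw0.bound
    hd.bound _ _).trans_lt ?_
  have e1 : A * (ε / (2 * (A * l1 ψ + 1))) * l1 (hts (t - s) ψ) ≤ ε / 2 := by
    calc _ ≤ A * (ε / (2 * (A * l1 ψ + 1))) * l1 ψ := by gcongr; exact l1_hts_le _ _
      _ = (A * l1 ψ) / (A * l1 ψ + 1) * (ε / 2) := by field_simp
      _ ≤ 1 * (ε / 2) := by
          gcongr
          rw [div_le_one (by positivity)]
          linarith
      _ = _ := one_mul _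
  have e2 : A * l1 (hts (t - s) ψ - hts (t - s₀) ψ) ≤ A * (C * √|t - s - (t - s₀)|) := by
    gcongr; exact hψ _ _
  linarith

/-- The nonlinear term is admissible, bounded and locally Lipschitz continuous. -/
lemma exists_adm_nl {F : Space d → ℝ} (hF : IsC1LipschitzPartials F) {α β : ℝ} (hα1 : α < 1)
    (hβ0 : β < 0) (hβ : -α < β) (R : ℝ) (hR : 0 ≤ R) :
    ∃ P, 0 ≤ P ∧ ∀ {b : ℝ → Distr d} {M : ℝ}, 0 ≤ M → Drift hφ β b M →
      (∀ {u : ℝ → Distr d} {h : ℝ}, Curve hφ (α + 1) u h R →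
        Adm hφ β (nl φ₀ F b u) 0 h (P * M)) ∧
      (∀ {u v : ℝ → Distr d} {s D : ℝ}, 0 ≤ D → BB hφ (α + 1) (u s) R → BB hφ (α + 1) (v s) R →
        BB hφ (α + 1) (u s - v s) D → BB hφ β (nl φ₀ F b u s - nl φ₀ F b v s) (P * M * D)) := by
  -- The midpoint of `-β` and `α`: below the regularity of `∇u`, yet with `β + a > 0`, as the
  -- product requires.
  set a := (α - β) / 2 with ha
  have ha0 : 0 < a := by rw [ha]; linarith
  have ha1 : a ≤ 1 := by rw [ha]; linarith
  have haα : a < α := by rw [ha]; linarith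
  have hβa : 0 < β + a := by rw [ha]; linarith
  obtain ⟨A, hA, h1, h2⟩ := exists_hol_fgrad hφ hF ha0 ha1 haα R hR
  obtain ⟨K, hK, h3⟩ := exists_bb_prd hφ ha0 ha1 hβ0 hβa
  refine ⟨K * A, by positivity, fun {b M} hM hb => ⟨fun {u h} hu => ⟨fun s hs => ?_, fun t ψ => ?_⟩,
    fun {u v s D} hD hu hv huv => ?_⟩⟩
  · exact h3 (hb.bb s) hM (h1 _ (hu.bb s hs))
  -- The null set `{0}` is dropped, because a curve need not be continuous there.
  · rw [← restrict_Ioc_eq_restrict_Icc]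
    have hc : AEStronglyMeasurable (fun s => prodL1 (fgrad F (u s)) (hts (t - s) ψ))
        (volume.restrict (Ioc 0 h)) :=
      (hu.continuousOn_prodL1 hφ ha0 hA h1 h2 ψ).aestronglyMeasurable measurableSet_Ioc
    have hpt : ∀ k, AEStronglyMeasurable (fun s => pt φ₀ (b s) (fgrad F (u s)) (hts (t - s) ψ) k)
        (volume.restrict (Ioc 0 h)) := fun k => by
      refine aestronglyMeasurable_ext (fun s => (hb.bb s).block hφ k) (fun ψ => ?_) hc
      simp only [block_apply hφ]
      exact (hb.meas _).restrict
    refine aestronglyMeasurable_of_tendsto_ae atTop (fun n =>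
      Finset.aestronglyMeasurable_fun_sum (Finset.range n) fun k _ => hpt k) ?_
    filter_upwards [ae_restrict_mem measurableSet_Ioc] with s hs
    have hw := h1 _ (hu.bb s ⟨hs.1.le, hs.2⟩)
    rw [nl, prd_apply hφ ha0 ha1 hβa (hb.bb s) hM hw]
    exact (summable_pt hφ ha0 ha1 hβa (hb.bb s) hM hw _).hasSum.tendsto_sum_nat
  · rw [nl, nl, prd_sub hφ ha0 ha1 hβa (hb.bb s) hM (h1 _ hu) (h1 _ hv)]
    refine (h3 (hb.bb s) hM (h2 _ _ D hD hu hv huv)).mono (le_of_eq ?_)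
    ring

lemma isReal_nl {F : Space d → ℝ} (hF : IsC1LipschitzPartials F) {α β : ℝ} (hα1 : α < 1)
    (hβ0 : β < 0) (hβ : -α < β) {R : ℝ} (hR : 0 ≤ R) {b u : ℝ → Distr d} {M : ℝ} (hM : 0 ≤ M)
    (hb : Drift hφ β b M) {s : ℝ} (hu : BB hφ (α + 1) (u s) R) : IsReal (nl φ₀ F b u s) := by
  have ha0 : 0 < (α - β) / 2 := by linarith
  have haα : (α - β) / 2 < α := by linarith
  obtain ⟨A, hA, h1, h2⟩ := exists_hol_fgrad hφ hF ha0 (by linarith) haα R hR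
  exact isReal_prd hφ ha0 (by linarith) (by linarith) (hb.bb s) hM (h1 _ hu) (hb.real s)
    (im_fgrad F _)

end curves

/-! ### Mild solutions on compact intervals -/

/-- The assumptions on the nonlinearity and the exponents. -/
structure Admissible (F : Space d → ℝ) (α β : ℝ) : Prop where
  hF : IsC1LipschitzPartials F
  lt_one : α < 1
  neg : β < 0
  neg_lt : -α < β
  sub_lt : α - 1 < β

section mild

variable {φ₀ : Space d → ℝ} (hφ : IsDyadicGenerator φ₀)

/-- `u` is a mild solution on `[0, h]`. -/
structure Mild {φ₀ : Space d → ℝ} (hφ : IsDyadicGenerator φ₀) (α : ℝ) (F : Space d → ℝ)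
    (b : ℝ → Distr d) (u₀ : Distr d) (h : ℝ) (u : ℝ → Distr d) : Prop where
  curve : ∃ R, 0 ≤ R ∧ Curve hφ (α + 1) u h R
  eq : ∀ t ∈ Icc 0 h, u t = heat t u₀ + duh (nl φ₀ F b u) 0 t t

lemma heat_add (t : ℝ) (f g : Distr d) : heat t (f + g) = heat t f + heat t g := map_add _ f g

lemma exists_small (C : ℝ) {c : ℝ} (hc : 0 < c) {T : ℝ} (hT : 0 < T) :
    ∃ η, 0 < η ∧ η ≤ T ∧ ∀ r, 0 ≤ r → r ≤ η → C * r ^ c ≤ 1 / 2 := by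
  have h1 : Tendsto (fun r : ℝ => C * r ^ c) (𝓝 0) (𝓝 (C * 0 ^ c)) :=
    ((Real.continuous_rpow_const hc.le).const_mul C).tendsto 0
  rw [Real.zero_rpow hc.ne', mul_zero] at h1
  obtain ⟨δ, hδ, h2⟩ := Metric.eventually_nhds_iff.1
    (h1.eventually_le_const (show (0 : ℝ) < 1 / 2 by norm_num))
  refine ⟨min (δ / 2) T, by positivity, min_le_right _ _, fun r hr hr' => h2 ?_⟩
  rw [Real.dist_eq, sub_zero, abs_of_nonneg hr]
  linarith [min_le_left (δ / 2) T]

/-- Sums of a heat evolution and a Duhamel integral are curves in `𝒞^{β + 2θ}`. -/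
lemma exists_curve_duh (T : ℝ) (hT : 0 < T) {θ : ℝ} (hθ0 : 0 ≤ θ) (hθ1 : θ < 1) :
    ∃ K, 0 ≤ K ∧ ∀ {β M h R : ℝ} {N : ℝ → Distr d} {u₀ : Distr d}, -1 < β → 0 ≤ M → 0 ≤ R →
      Adm hφ β N 0 h M → (∀ s ∈ Icc 0 h, IsReal (N s)) → h ≤ T → BB hφ (β + 2 * θ) u₀ R →
      IsReal u₀ → Curve hφ (β + 2 * θ) (fun t => heat t u₀ + duh N 0 t t) h
        (R + K * M * h ^ (1 - θ)) := by
  obtain ⟨K, hK, h1⟩ := exists_bb_duh hφ T hT hθ0 hθ1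
  obtain ⟨K₁, hK₁, h2⟩ := exists_bb_duh_sub hφ T hT hθ0 hθ1
  obtain ⟨K₂, hK₂, h3⟩ := exists_bb_heat hφ T hT (σ := 1 / 2) (by norm_num) (by norm_num)
  obtain ⟨K₃, hK₃, h4⟩ := exists_bb_heat_sub hφ (zero_le_one' ℝ) le_rfl
  refine ⟨K, hK, fun {β M h R N u₀} hβ hM hR hN hNr hh hu₀ hu₀r => ?_⟩
  have hAdm : ∀ t ∈ Icc 0 h, Adm hφ β N 0 t M := fun t ht => hN.mono le_rfl ht.2
  refine ⟨fun t ht => ?_, fun t ht => ?_, fun s hs ε hε => ?_⟩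
  · refine (hu₀.heat hR ht.1).add ((h1 hβ hM (hAdm t ht) ht.1 le_rfl (by linarith [ht.2])).mono ?_)
    rw [sub_zero]
    have := Real.rpow_le_rpow ht.1 ht.2 (by linarith : (0 : ℝ) ≤ 1 - θ)
    gcongr
  · have r1 := hu₀r.heat ht.1
    have r2 := (hAdm t ht).isReal_duh hβ hM ht.1 le_rfl fun s hs => hNr s ⟨hs.1, hs.2.trans ht.2⟩
    intro ψ hψ
    rw [add_apply, Complex.add_im, r1 ψ hψ, r2 ψ hψ, add_zero]
  -- A modulus of continuity on `[s/2, h]`. After time `p ≥ s/2` the heat evolution of `u₀` has one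
  -- derivative to spare, with constant `(s/2) ^ (-1/2)`, which is traded for `√η`; the second
  -- summand is that of the Duhamel integral.
  · set ω : ℝ → ℝ := fun η => K₃ * √η ^ (1 : ℝ) * (K₂ * (s / 2) ^ (-(1 / 2 : ℝ)) * R) +
      K₁ * M * (√η ^ (1 - θ) + η ^ (1 - θ)) with hω
    have hω0 : Tendsto ω (𝓝 0) (𝓝 0) := by
      have hc : Continuous ω := by
        have c1 : Continuous fun η : ℝ => √η ^ (1 - θ) :=
          Real.continuous_sqrt.rpow_const fun _ => Or.inr (by linarith)
        have c2 : Continuous fun η : ℝ => η ^ (1 - θ) :=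
          Real.continuous_rpow_const (by linarith)
        have c3 : Continuous fun η : ℝ => √η ^ (1 : ℝ) :=
          Real.continuous_sqrt.rpow_const fun _ => Or.inr zero_le_one
        fun_prop
      have := hc.tendsto 0
      rwa [show ω 0 = 0 by
        simp [hω, Real.zero_rpow (show (1 : ℝ) - θ ≠ 0 by linarith)]] at this
    have key : ∀ p q : ℝ, s / 2 ≤ p → p ≤ q → q ≤ h →
        BB hφ (β + 2 * θ) ((heat q u₀ + duh N 0 q q) - (heat p u₀ + duh N 0 p p)) (ω (q - p)) := by
      intro p q hp hpq hq
      have hs0 := hs.1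
      have hp0 : 0 < p := by linarith
      have g1 := h3 hR hu₀ p (by linarith) (by linarith)
      have g2 := h4 (by positivity) g1 (q - p) (by linarith)
      rw [show β + 2 * θ + 2 * (1 / 2) - 1 = β + 2 * θ by ring,
        heat_heat (by linarith) (by linarith), sub_add_cancel] at g2
      have g3 := h2 hβ hM (hN.mono le_rfl hq) (y := p) (by linarith) hpq (by linarith)
      rw [add_sub_add_comm]
      refine BB.add (g2.mono ?_) g3
      have : p ^ (-(1 / 2 : ℝ)) ≤ (s / 2) ^ (-(1 / 2 : ℝ)) :=
        Real.rpow_le_rpow_of_nonpos (by linarith) hp (by norm_num)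
      gcongr
    obtain ⟨δ, hδ, hδ2⟩ := Metric.eventually_nhds_iff.1 (hω0.eventually_le_const hε)
    refine ⟨min δ (s / 2), lt_min hδ (by linarith [hs.1]), fun s' hs' hd => ?_⟩
    have hd1 := hd.trans_le (min_le_left _ _)
    have hd2 := hd.trans_le (min_le_right _ _)
    rw [abs_lt] at hd2
    rcases le_total s s' with hss | hss
    · refine (key s s' (by linarith [hs.1]) hss hs'.2).mono (hδ2 ?_)
      simpa [Real.dist_eq] using hd1
    · refine (key s' s (by linarith [hs.1]) hss hs.2).neg_sub.mono (hδ2 ?_)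
      rw [abs_sub_comm] at hd1
      simpa [Real.dist_eq] using hd1

variable {hφ}

lemma Mild.mono {α h h' : ℝ} {F : Space d → ℝ} {b u : ℝ → Distr d} {u₀ : Distr d}
    (hu : Mild hφ α F b u₀ h u) (hh : h' ≤ h) : Mild hφ α F b u₀ h' u := by
  obtain ⟨⟨R, hR, hc⟩, he⟩ := hu
  exact ⟨⟨R, hR, hc.mono hh le_rfl⟩, fun t ht => he t ⟨ht.1, ht.2.trans hh⟩⟩

variable {F : Space d → ℝ} {α β : ℝ}

lemma Admissible.neg_one_lt (H : Admissible F α β) : -1 < β := by linarith [H.neg_lt, H.lt_one]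

lemma Admissible.theta_nonneg (H : Admissible F α β) : 0 ≤ (α + 1 - β) / 2 := by
  linarith [H.neg_lt, H.neg]

/-- The role of `α - 1 < β`: passing from `𝒞^β` to `𝒞^{α+1}` costs `(t - s) ^ (-θ)` with `θ = (α + 1
- β) / 2`, which must be integrable. -/
lemma Admissible.theta_lt (H : Admissible F α β) : (α + 1 - β) / 2 < 1 := by linarith [H.sub_lt]

lemma theta_eq (α β : ℝ) : β + 2 * ((α + 1 - β) / 2) = α + 1 := by ring

lemma Mild.adm (H : Admissible F α β) {M h : ℝ} (hM : 0 ≤ M) {b u : ℝ → Distr d} {u₀ : Distr d}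
    (hb : Drift hφ β b M) (hu : Mild hφ α F b u₀ h u) :
    ∃ M', 0 ≤ M' ∧ Adm hφ β (nl φ₀ F b u) 0 h M' := by
  obtain ⟨⟨R, hR, hc⟩, -⟩ := hu
  obtain ⟨P, hP, h1⟩ := exists_adm_nl hφ H.hF H.lt_one H.neg H.neg_lt R hR
  exact ⟨P * M, by positivity, (h1 hM hb).1 hc⟩

lemma Mild.congr (H : Admissible F α β) {M h : ℝ} (hM : 0 ≤ M) {b u v : ℝ → Distr d}
    {u₀ : Distr d} (hb : Drift hφ β b M) (hu : Mild hφ α F b u₀ h u) (e : EqOn u v (Icc 0 h)) :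
    Mild hφ α F b u₀ h v := by
  obtain ⟨M', hM', hadm⟩ := hu.adm H hM hb
  obtain ⟨⟨R, hR, hc⟩, he⟩ := hu
  refine ⟨⟨R, hR, hc.congr e⟩, fun t ht => ?_⟩
  rw [← e ht, he t ht, (hadm.mono le_rfl ht.2).duh_congr H.neg_one_lt hM' (fun s hs => ?_)
    ht.1 le_rfl]
  rw [nl, nl, e ⟨hs.1, hs.2.trans ht.2⟩]

lemma Mild.apply_zero (H : Admissible F α β) {M h : ℝ} (hM : 0 ≤ M) {b u : ℝ → Distr d}
    {u₀ : Distr d} (hb : Drift hφ β b M) (hh : 0 ≤ h) (hu : Mild hφ α F b u₀ h u) : u 0 = u₀ := by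
  obtain ⟨M', hM', hadm⟩ := hu.adm H hM hb
  rw [hu.eq 0 ⟨le_rfl, hh⟩, heat_zero]
  ext ψ
  rw [add_apply, (hadm.mono le_rfl hh).duh_apply H.neg_one_lt hM' le_rfl le_rfl]
  simp

/-- Mild solutions are unique. -/
lemma Mild.unique (H : Admissible F α β) {M h : ℝ} (hM : 0 ≤ M) {b u v : ℝ → Distr d}
    {u₀ : Distr d} (hb : Drift hφ β b M) (hh : 0 < h) (hu : Mild hφ α F b u₀ h u)
    (hv : Mild hφ α F b u₀ h v) : EqOn u v (Icc 0 h) := by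
  obtain ⟨R, hR, hcu, hcv⟩ : ∃ R, 0 ≤ R ∧ Curve hφ (α + 1) u h R ∧ Curve hφ (α + 1) v h R := by
    obtain ⟨R, hR, hc⟩ := hu.curve
    obtain ⟨R', hR', hc'⟩ := hv.curve
    exact ⟨max R R', le_max_of_le_left hR, hc.mono le_rfl (le_max_left _ _),
      hc'.mono le_rfl (le_max_right _ _)⟩
  obtain ⟨P, hP, h1⟩ := exists_adm_nl hφ H.hF H.lt_one H.neg H.neg_lt R hR
  obtain ⟨hadm, hlip⟩ := h1 hM hb
  obtain ⟨K, hK, h2⟩ := exists_bb_duh hφ h hh H.theta_nonneg H.theta_lt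
  have hβ := H.neg_one_lt
  have hPM : 0 ≤ P * M := by positivity
  set θ := (α + 1 - β) / 2 with hθ
  obtain ⟨η, hη, -, hsmall⟩ := exists_small (K * (P * M)) (c := 1 - θ)
    (by linarith [H.theta_lt]) one_pos
  -- Agreement propagates by a time `η` that does not depend on `x`, so finitely many steps cover
  -- `[0, h]`.
  have step : ∀ x, 0 ≤ x → (∀ t ∈ Icc 0 h, t ≤ x → u t = v t) →
      ∀ t ∈ Icc 0 h, t ≤ x + η → u t = v t := by
    intro x hx hxe
    -- Each use of the equation halves the bound on the difference, starting from the trivial bound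
    -- `2 * R`.
    have hk : ∀ k : ℕ, ∀ t ∈ Icc 0 h, t ≤ x + η → BB hφ (α + 1) (u t - v t) (2 * R / 2 ^ k) := by
      intro k
      induction k with
      | zero =>
        intro t ht _
        refine ((hcu.bb t ht).sub (hcv.bb t ht)).mono (le_of_eq ?_)
        ring
      | succ k ih =>
        intro t ht htx
        rcases le_total t x with htx' | htx'
        · rw [hxe t ht htx', sub_self]
          exact bb_zero (by positivity)
        have hD : 0 ≤ 2 * R / 2 ^ k := by positivity
        have hsubset : ∀ s ∈ Icc 0 t, s ∈ Icc 0 h := fun s hs => ⟨hs.1, hs.2.trans ht.2⟩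
        have hd : ∀ s ∈ Icc 0 t, BB hφ β (nl φ₀ F b u s - nl φ₀ F b v s)
            (P * M * (2 * R / 2 ^ k)) := fun s hs =>
          hlip hD (hcu.bb s (hsubset s hs)) (hcv.bb s (hsubset s hs))
            (ih s (hsubset s hs) (hs.2.trans htx))
        have au := (hadm hcu).mono le_rfl ht.2
        have av := (hadm hcv).mono le_rfl ht.2
        have hPD : 0 ≤ P * M * (2 * R / 2 ^ k) := by positivity
        have hsub := au.sub av hd
        have e : u t - v t = duh (fun s => nl φ₀ F b u s - nl φ₀ F b v s) x t t := by
          rw [hu.eq t ht, hv.eq t ht, add_sub_add_left_eq_sub,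
            au.duh_sub hβ hPM hPM av hPD hd ht.1 le_rfl, hsub.duh_split hβ hPD hx htx']
          -- Up to time `x` the solutions agree, so the Duhamel integral of the difference starts at
          -- `x`, over a length of at most `η`.
          have hz : Adm hφ β (fun s => nl φ₀ F b u s - nl φ₀ F b v s) 0 x 0 := by
            refine ⟨fun s hs => ?_, (hsub.mono le_rfl htx').meas⟩
            rw [nl, nl, hxe s (hsubset s ⟨hs.1, hs.2.trans htx'⟩) hs.2, sub_self]
            exact bb_zero le_rfl
          have := h2 hβ le_rfl hz hx le_rfl (by linarith [ht.2])
          rw [mul_zero, zero_mul] at this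
          rw [this.eq_zero, show heat (t - x) (0 : Distr d) = 0 from map_zero _, zero_add]
        have := h2 hβ hPD (hsub.mono hx le_rfl) htx' le_rfl (by linarith [ht.2])
        rw [hθ, theta_eq, ← e] at this
        refine this.mono ?_
        have h3 := hsmall (t - x) (by linarith) (by linarith)
        calc _ = K * (P * M) * (t - x) ^ (1 - θ) * (2 * R / 2 ^ k) := by rw [hθ]; ring
          _ ≤ 1 / 2 * (2 * R / 2 ^ k) := by gcongr
          _ = _ := by rw [pow_succ]; field_simp
    intro t ht htx
    have hlim : Tendsto (fun k : ℕ => 2 * R / 2 ^ k) atTop (𝓝 0) :=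
      tendsto_const_nhds.div_atTop (tendsto_pow_atTop_atTop_of_one_lt one_lt_two)
    exact sub_eq_zero.1 (BB.of_tendsto hlim fun k => hk k t ht htx).eq_zero
  have hall : ∀ n : ℕ, ∀ t ∈ Icc 0 h, t ≤ n * η → u t = v t := by
    intro n
    induction n with
    | zero =>
      intro t ht ht0
      have : t = 0 := le_antisymm (by simpa using ht0) ht.1
      rw [this, hu.apply_zero H hM hb hh.le, hv.apply_zero H hM hb hh.le]
    | succ n ih =>
      intro t ht ht0
      refine step (n * η) (by positivity) ih t ht ?_
      push_cast at ht0
      linarith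
  intro t ht
  obtain ⟨n, hn⟩ := exists_nat_ge (t / η)
  exact hall n t ht ((div_le_iff₀ hη).1 hn)

/-- Two mild solutions can be joined. -/
lemma Mild.append (H : Admissible F α β) {M h h' R₀ : ℝ} (hM : 0 ≤ M) {b u v : ℝ → Distr d}
    {u₀ : Distr d} (hb : Drift hφ β b M) (hR₀ : 0 ≤ R₀) (hu₀ : BB hφ (α + 1) u₀ R₀)
    (hu₀r : IsReal u₀) (hh : 0 ≤ h) (hh' : 0 < h')
    (hu : Mild hφ α F b u₀ h u) (hv : Mild hφ α F (fun s => b (s + h)) (u h) h' v) :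
    ∃ w, Mild hφ α F b u₀ (h + h') w := by
  set w : ℝ → Distr d := fun s => if s ≤ h then u s else v (s - h) with hw
  have hv0 := hv.apply_zero H hM (hb.shift h) hh'.le
  have hwu : EqOn u w (Icc 0 h) := fun s hs => by simp only [hw, if_pos hs.2]
  have hwv : ∀ s ∈ Icc 0 h', v s = w (s + h) := fun s hs => by
    rcases hs.1.eq_or_lt with h0 | h0
    · rw [← h0, hv0]; simp [hw]
    · simp only [hw]
      rw [if_neg (by linarith), add_sub_cancel_right]
  obtain ⟨R, hR, hcu, hcv⟩ : ∃ R, 0 ≤ R ∧ Curve hφ (α + 1) u h R ∧ Curve hφ (α + 1) v h' R := by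
    obtain ⟨R, hR, hc⟩ := hu.curve
    obtain ⟨R', hR', hc'⟩ := hv.curve
    exact ⟨max R R', le_max_of_le_left hR, hc.mono le_rfl (le_max_left _ _),
      hc'.mono le_rfl (le_max_right _ _)⟩
  have hwR : ∀ s ∈ Icc 0 (h + h'), BB hφ (α + 1) (w s) R := fun s hs => by
    rcases le_total s h with hsh | hsh
    · rw [← hwu ⟨hs.1, hsh⟩]; exact hcu.bb s ⟨hs.1, hsh⟩
    · have hs' : s - h ∈ Icc 0 h' := ⟨by linarith, by linarith [hs.2]⟩
      have := hwv _ hs'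
      rw [sub_add_cancel] at this
      rw [← this]; exact hcv.bb _ hs'
  obtain ⟨P, hP, h1⟩ := exists_adm_nl hφ H.hF H.lt_one H.neg H.neg_lt R hR
  have hPM : 0 ≤ P * M := by positivity
  have hβ := H.neg_one_lt
  have a1 : Adm hφ β (nl φ₀ F b w) 0 h (P * M) :=
    ((h1 hM hb).1 hcu).congr fun s hs => by rw [nl, nl, hwu hs]
  have av := (h1 hM (hb.shift h)).1 hcv
  have ev : EqOn (nl φ₀ F (fun s => b (s + h)) v) (fun s => nl φ₀ F b w (s + h)) (Icc 0 h') :=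
    fun s hs => by simp only [nl, hwv s hs]
  have a2 : Adm hφ β (nl φ₀ F b w) h (h + h') (P * M) := by
    simpa [add_comm] using (av.congr ev).unshift
  have aw := a1.append a2
  have heq : ∀ t ∈ Icc 0 (h + h'), w t = heat t u₀ + duh (nl φ₀ F b w) 0 t t := by
    intro t ht
    rcases le_total t h with hth | hth
    · rw [← hwu ⟨ht.1, hth⟩, hu.eq t ⟨ht.1, hth⟩]
      rw [(((h1 hM hb).1 hcu).mono le_rfl hth).duh_congr hβ hPM (fun s hs => ?_) ht.1 le_rfl]
      rw [nl, nl, hwu ⟨hs.1, hs.2.trans hth⟩]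
    · have hr : t - h ∈ Icc 0 h' := ⟨by linarith, by linarith [ht.2]⟩
      have e1 := hwv _ hr
      rw [sub_add_cancel] at e1
      have at' : Adm hφ β (nl φ₀ F b w) (0 + h) (t - h + h) (P * M) := by
        simpa using aw.mono hh ht.2
      have e2 := at'.duh_shift hβ hPM (t := t - h) hr.1 le_rfl
      rw [zero_add, sub_add_cancel] at e2
      have e3 := (av.mono le_rfl hr.2).duh_congr hβ hPM
        (fun s hs => ev ⟨hs.1, hs.2.trans hr.2⟩) (t := t - h) hr.1 le_rfl
      have e4 := (((h1 hM hb).1 hcu).duh_congr hβ hPM (N' := nl φ₀ F b w)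
        (fun s hs => by rw [nl, nl, hwu hs]) (t := h) hh le_rfl)
      rw [← e1, hv.eq _ hr, hu.eq h ⟨hh, le_rfl⟩, heat_add, heat_heat hr.1 hh, sub_add_cancel, e3, e2,
        (aw.mono le_rfl ht.2).duh_split hβ hPM hh hth, e4, add_assoc]
  -- Continuity across the junction is not checked by gluing: it follows from the integral equation
  -- on the whole interval.
  obtain ⟨K, hK, h2⟩ := exists_curve_duh hφ (h + h') (by linarith) H.theta_nonneg H.theta_lt
  have hcw := h2 hβ hPM hR₀ aw (fun s hs => isReal_nl hφ H.hF H.lt_one H.neg H.neg_lt hR hM hb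
    (hwR s hs)) le_rfl (by rwa [theta_eq]) hu₀r
  rw [theta_eq] at hcw
  have : (0 : ℝ) ≤ h + h' := by linarith
  exact ⟨w, ⟨_, by positivity, hcw.congr fun t ht => (heq t ht).symm⟩, heq⟩

end mild

/-! ### Local existence -/

section existence

variable {φ₀ : Space d → ℝ} {hφ : IsDyadicGenerator φ₀}

variable (hφ) in
/-- Geometrically convergent sequences in `𝒞^γ`, `γ > 0`, have limits. -/
lemma exists_limit {γ : ℝ} (hγ : 0 < γ) {f : ℕ → Distr d} {C : ℝ}
    (h : ∀ n, BB hφ γ (f (n + 1) - f n) (C / 2 ^ n)) :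
    ∃ g : Distr d, (∀ n, BB hφ γ (g - f n) (2 * C / 2 ^ n)) ∧
      ∀ ψ, Tendsto (fun n => f n ψ) atTop (𝓝 (g ψ)) := by
  obtain ⟨K, hK, hl⟩ := exists_lb_of_bb hφ hγ
  have hd : ∀ ψ n, ‖f (n + 1) ψ - f n ψ‖ ≤ 2 * (K * C * l1 ψ) / 2 / 2 ^ n := fun ψ n => by
    refine (hl _ _ (h n) ψ).trans_eq ?_
    ring
  have hs : ∀ ψ, Summable fun n => f (n + 1) ψ - f n ψ := fun ψ =>
    Summable.of_norm_bounded (summable_geometric_two' _) (hd ψ)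
  let P : Test d →ₗ[ℂ] ℂ :=
    { toFun := fun ψ => ∑' n, (f (n + 1) ψ - f n ψ)
      map_add' := fun φ ψ => by
        rw [← (hs φ).tsum_add (hs ψ)]
        refine tsum_congr fun n => ?_
        rw [map_add, map_add]; ring
      map_smul' := fun c ψ => by
        simp only [map_smul, smul_eq_mul, RingHom.id_apply, ← mul_sub, tsum_mul_left] }
  obtain ⟨N, hN⟩ := exists_distr P (q := fun ψ => 2 * (K * C * l1 ψ))
    (continuous_const.mul (continuous_const.mul continuous_l1)) (by simp [l1_zero]) fun ψ => by
      have := tsum_of_norm_bounded (hasSum_geometric_two' (2 * (K * C * l1 ψ))) (hd ψ)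
      exact this
  have hlim : ∀ ψ, Tendsto (fun n => f n ψ) atTop (𝓝 ((f 0 + N) ψ)) := fun ψ => by
    have h1 := (hs ψ).hasSum.tendsto_sum_nat.const_add (f 0 ψ)
    rw [add_apply, hN]
    refine h1.congr fun n => ?_
    rw [Finset.sum_range_sub (fun n => f n ψ)]
    ring
  refine ⟨f 0 + N, fun n j u => ?_, hlim⟩
  have h1 : ∀ m, dist (f m (lp hφ j u)) (f (m + 1) (lp hφ j u)) ≤
      2 * (C * 2 ^ (-γ * j) * l1 u) / 2 / 2 ^ m := fun m => by
    rw [dist_comm, dist_eq_norm]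
    refine (h m j u).trans_eq ?_
    ring
  have h2 := dist_le_of_le_geometric_two_of_tendsto h1 (hlim _) n
  rw [dist_comm, dist_eq_norm] at h2
  refine h2.trans_eq ?_
  ring

/-- The Picard iteration. -/
def picard (φ₀ : Space d → ℝ) (F : Space d → ℝ) (b : ℝ → Distr d) (u₀ : Distr d) :
    ℕ → ℝ → Distr d
  | 0 => fun _ => 0
  | n + 1 => fun t => heat t u₀ + duh (nl φ₀ F b (picard φ₀ F b u₀ n)) 0 t t

lemma tendsto_div_two_pow (C : ℝ) : Tendsto (fun k : ℕ => C / 2 ^ k) atTop (𝓝 0) :=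
  tendsto_const_nhds.div_atTop (tendsto_pow_atTop_atTop_of_one_lt one_lt_two)

/-- The limit of a sequence of curves that converges uniformly. -/
lemma Curve.of_tendsto {γ h R C : ℝ} {f : ℕ → ℝ → Distr d} {u : ℝ → Distr d}
    (hf : ∀ n, Curve hφ γ (f n) h R)
    (hu : ∀ t ∈ Icc 0 h, ∀ n, BB hφ γ (u t - f n t) (C / 2 ^ n))
    (hlim : ∀ t ∈ Icc 0 h, ∀ ψ, Tendsto (fun n => f n t ψ) atTop (𝓝 (u t ψ))) :
    Curve hφ γ u h R := by
  refine ⟨fun t ht => ?_, fun t ht ψ hψ => ?_, fun s hs ε hε => ?_⟩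
  · refine BB.of_tendsto (c := fun n => C / 2 ^ n + R) ?_ fun n => ?_
    · simpa using (tendsto_div_two_pow C).add_const R
    · have := (hu t ht n).add ((hf n).bb t ht)
      rwa [sub_add_cancel] at this
  · refine tendsto_nhds_unique ((Complex.continuous_im.tendsto _).comp (hlim t ht ψ))
      (tendsto_const_nhds.congr fun n => ?_)
    rw [Function.comp_apply, (hf n).real t ht ψ hψ]
  · obtain ⟨n, hn⟩ := ((tendsto_div_two_pow C).eventually_le_const
      (show 0 < ε / 3 by linarith)).exists
    obtain ⟨δ, hδ, hc⟩ := (hf n).cont s hs (ε / 3) (by linarith)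
    refine ⟨δ, hδ, fun s' hs' hd => ?_⟩
    have e : u s' - u s = (u s' - f n s') + (f n s' - f n s) + (f n s - u s) := by abel
    rw [e]
    exact (((hu s' hs' n).add (hc s' hs' hd)).add (hu s ⟨hs.1.le, hs.2⟩ n).neg_sub).mono
      (by linarith)

variable (hφ) in
/-- Local existence, on a time interval that only depends on the size of the data. -/
lemma exists_mild {F : Space d → ℝ} {α β : ℝ} (H : Admissible F α β) (hα : 0 < α) {M R : ℝ}
    (hM : 0 ≤ M) (hR : 0 ≤ R) :
    ∃ h, 0 < h ∧ ∀ {b : ℝ → Distr d} {u₀ : Distr d}, Drift hφ β b M → BB hφ (α + 1) u₀ R →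
      IsReal u₀ → ∃ u, Mild hφ α F b u₀ h u := by
  -- The iteration stays in the ball of radius `R + 1`: the heat evolution contributes at most `R`,
  -- and the Duhamel integral at most `1/2` once `h` is small.
  obtain ⟨P, hP, h1⟩ := exists_adm_nl hφ H.hF H.lt_one H.neg H.neg_lt (R + 1) (by linarith)
  obtain ⟨K₁, hK₁, h2⟩ := exists_curve_duh hφ 1 one_pos H.theta_nonneg H.theta_lt
  obtain ⟨K₂, hK₂, h3⟩ := exists_bb_duh hφ 1 one_pos H.theta_nonneg H.theta_lt
  have hβ := H.neg_one_lt
  have hPM : 0 ≤ P * M := by positivity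
  set θ := (α + 1 - β) / 2 with hθ
  -- One threshold both for invariance of the ball (`K₁`) and for the contraction by `1/2` (`K₂`).
  -- It involves only `M`, `R` and fixed data.
  obtain ⟨h, hh, hh1, hsmall⟩ := exists_small ((K₁ + K₂) * (P * M)) (c := 1 - θ)
    (by linarith [H.theta_lt]) one_pos
  have hsmall1 : ∀ r, 0 ≤ r → r ≤ h → K₁ * (P * M) * r ^ (1 - θ) ≤ 1 / 2 := fun r hr hr' => by
    refine le_trans ?_ (hsmall r hr hr')
    gcongr; linarith
  have hsmall2 : ∀ r, 0 ≤ r → r ≤ h → K₂ * (P * M) * r ^ (1 - θ) ≤ 1 / 2 := fun r hr hr' => by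
    refine le_trans ?_ (hsmall r hr hr')
    gcongr; linarith
  refine ⟨h, hh, fun {b u₀} hb hu₀ hu₀r => ?_⟩
  obtain ⟨hadm, hlip⟩ := h1 hM hb
  set f := picard φ₀ F b u₀ with hf
  have hcurve : ∀ n, Curve hφ (α + 1) (f n) h (R + 1) := by
    intro n
    induction n with
    | zero =>
      refine ⟨fun s _ => bb_zero (by linarith), fun s _ ψ _ => rfl, fun s _ ε hε =>
        ⟨1, one_pos, fun s' _ _ => ?_⟩⟩
      change BB hφ (α + 1) ((0 : Distr d) - 0) ε
      rw [sub_zero]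
      exact bb_zero hε.le
    | succ n ih =>
      have := h2 hβ hPM hR (hadm ih) (fun s hs => isReal_nl hφ H.hF H.lt_one H.neg H.neg_lt
        (by linarith) hM hb (ih.bb s hs)) hh1 (by rwa [hθ, theta_eq]) hu₀r
      rw [hθ, theta_eq] at this
      exact this.mono le_rfl (by linarith [hsmall1 h hh.le le_rfl])
  have hcontr : ∀ (u v : ℝ → Distr d) (D : ℝ), 0 ≤ D → Curve hφ (α + 1) u h (R + 1) →
      Curve hφ (α + 1) v h (R + 1) → (∀ t ∈ Icc 0 h, BB hφ (α + 1) (u t - v t) D) →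
      ∀ t ∈ Icc 0 h, BB hφ (α + 1) (duh (nl φ₀ F b u) 0 t t - duh (nl φ₀ F b v) 0 t t)
        (D / 2) := by
    intro u v D hD hu hv huv t ht
    have hd : ∀ s ∈ Icc 0 t, BB hφ β (nl φ₀ F b u s - nl φ₀ F b v s) (P * M * D) := fun s hs =>
      hlip hD (hu.bb s ⟨hs.1, hs.2.trans ht.2⟩) (hv.bb s ⟨hs.1, hs.2.trans ht.2⟩)
        (huv s ⟨hs.1, hs.2.trans ht.2⟩)
    have au := (hadm hu).mono le_rfl ht.2
    have av := (hadm hv).mono le_rfl ht.2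
    have hPD : 0 ≤ P * M * D := by positivity
    rw [au.duh_sub hβ hPM hPM av hPD hd ht.1 le_rfl]
    have := h3 hβ hPD (au.sub av hd) ht.1 le_rfl (by linarith [ht.2])
    rw [hθ, theta_eq, sub_zero] at this
    refine this.mono ?_
    calc _ = K₂ * (P * M) * t ^ (1 - θ) * D := by rw [hθ]; ring
      _ ≤ 1 / 2 * D := by gcongr; exact hsmall2 t ht.1 ht.2
      _ = _ := by ring
  have hstep : ∀ n, ∀ t ∈ Icc 0 h, BB hφ (α + 1) (f (n + 1) t - f n t) ((R + 1) / 2 ^ n) := by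
    intro n
    induction n with
    | zero =>
      intro t ht
      have e : f (0 + 1) t - f 0 t = f 1 t := sub_zero _
      rw [e, pow_zero, div_one]
      exact (hcurve 1).bb t ht
    | succ n ih =>
      intro t ht
      have e : f (n + 1 + 1) t - f (n + 1) t =
          duh (nl φ₀ F b (f (n + 1))) 0 t t - duh (nl φ₀ F b (f n)) 0 t t :=
        add_sub_add_left_eq_sub _ _ _
      rw [e]
      refine (hcontr _ _ _ (by positivity) (hcurve (n + 1)) (hcurve n) ih t ht).mono (le_of_eq ?_)
      rw [pow_succ]; field_simp
  choose! u hu hulim using fun t (ht : t ∈ Icc 0 h) =>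
    exists_limit hφ (by linarith : 0 < α + 1) (f := fun n => f n t) fun n => hstep n t ht
  have hcu : Curve hφ (α + 1) u h (R + 1) := Curve.of_tendsto hcurve hu hulim
  refine ⟨u, ⟨R + 1, by linarith, hcu⟩, fun t ht => ?_⟩
  rw [← sub_eq_zero]
  refine (BB.of_tendsto (hφ := hφ) (γ := α + 1)
    (tendsto_div_two_pow (2 * (2 * (R + 1)))) fun n => ?_).eq_zero
  have h4 := hcontr _ _ _ (by positivity) (hcurve n) hcu (fun t ht => (hu t ht n).neg_sub) t ht
  have h5 := (hu t ht (n + 1)).add h4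
  have e : (u t - f (n + 1) t) + (duh (nl φ₀ F b (f n)) 0 t t - duh (nl φ₀ F b u) 0 t t) =
      u t - (heat t u₀ + duh (nl φ₀ F b u) 0 t t) := by
    have : f (n + 1) t = heat t u₀ + duh (nl φ₀ F b (f n)) 0 t t := rfl
    rw [this]; abel
  rw [e] at h5
  refine h5.mono ?_
  have hR1 : 0 ≤ (R + 1) / 2 ^ n := by positivity
  rw [pow_succ]
  have e1 : 2 * (R + 1) / (2 ^ n * 2) + 2 * (R + 1) / 2 ^ n / 2 = 2 * ((R + 1) / 2 ^ n) := by
    field_simp; ring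
  have e2 : 2 * (2 * (R + 1)) / 2 ^ n = 4 * ((R + 1) / 2 ^ n) := by ring
  rw [e1, e2]
  linarith

end existence

/-! ### Mild solutions on intervals -/

section glue

variable {φ₀ : Space d → ℝ} (hφ : IsDyadicGenerator φ₀)

lemma besovNorm_le_coe_iff {γ : ℝ} {f : Distr d} (C : NNReal) :
    besovNorm φ₀ γ f ≤ C ↔ BB hφ γ f C := by
  rw [← ENNReal.ofReal_coe_nnreal]
  exact besovNorm_le_iff hφ C.2

lemma exists_bb_of_mem {γ : ℝ} {f : Distr d} (hf : f ∈ besovSpace φ₀ γ) :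
    ∃ R, 0 ≤ R ∧ BB hφ γ f R :=
  ⟨_, ENNReal.toReal_nonneg, (besovNorm_le_iff hφ ENNReal.toReal_nonneg).1
    (ENNReal.ofReal_toReal hf.2.ne).ge⟩

lemma mem_besovSpace {γ C : ℝ} {f : Distr d} (hr : IsReal f) (hC : 0 ≤ C) (hf : BB hφ γ f C) :
    f ∈ besovSpace φ₀ γ :=
  ⟨hr, ((besovNorm_le_iff hφ hC).2 hf).trans_lt ENNReal.ofReal_lt_top⟩

lemma tendsto_besovNorm_zero_iff {γ : ℝ} {l : Filter ℝ} {f : ℝ → Distr d} :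
    Tendsto (fun s => besovNorm φ₀ γ (f s)) l (𝓝 0) ↔
      ∀ ε > 0, ∀ᶠ s in l, BB hφ γ (f s) ε := by
  rw [ENNReal.tendsto_nhds_zero]
  constructor
  · intro h ε hε
    filter_upwards [h (ENNReal.ofReal ε) (ENNReal.ofReal_pos.2 hε)] with s hs
    exact (besovNorm_le_iff hφ hε.le).1 hs
  · intro h ε hε
    obtain ⟨r, hr0, hr⟩ := ENNReal.lt_iff_exists_nnreal_btwn.1 hε
    filter_upwards [h r (by exact_mod_cast hr0)] with s hs
    exact ((besovNorm_le_coe_iff hφ r).2 hs).trans hr.le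

lemma normContinuousAt_iff {γ t : ℝ} {I : Set ℝ} {u : ℝ → Distr d} :
    NormContinuousAt φ₀ γ I u t ↔
      ∀ ε > 0, ∃ δ > 0, ∀ s ∈ I, |s - t| < δ → BB hφ γ (u s - u t) ε := by
  rw [NormContinuousAt, tendsto_besovNorm_zero_iff hφ]
  refine forall₂_congr fun ε _ => ?_
  rw [eventually_nhdsWithin_iff, Metric.eventually_nhds_iff]
  exact ⟨fun ⟨δ, hδ, h⟩ => ⟨δ, hδ, fun s hs hd => h (by simpa [Real.dist_eq] using hd) hs⟩,
    fun ⟨δ, hδ, h⟩ => ⟨δ, hδ, fun s hd hs => h s hs (by simpa [Real.dist_eq] using hd)⟩⟩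

/-- A drift in `L^∞(0,T; 𝒞^β)` has a version that is bounded at all times. -/
lemma exists_drift {β T : ℝ} {b : ℝ → Distr d} (hb : IsLinfty φ₀ β T b) :
    ∃ (b' : ℝ → Distr d) (M : ℝ), 0 ≤ M ∧ Drift hφ β b' M ∧
      ∀ᵐ s ∂(volume.restrict (Icc 0 T)), b' s = b s := by
  classical
  obtain ⟨hm, M, hM⟩ := hb
  -- Cutting off to `0` outside `[0, T]` and where the bound fails gives a drift that is good at
  -- every time, so that it can be shifted freely.
  set b' : ℝ → Distr d := fun s =>
    if s ∈ Icc 0 T ∧ b s ∈ besovSpace φ₀ β ∧ besovNorm φ₀ β (b s) ≤ M then b s else 0 with hb'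
  have hae : ∀ᵐ s ∂(volume.restrict (Icc 0 T)), b' s = b s := by
    filter_upwards [hM, ae_restrict_mem measurableSet_Icc] with s hs hs2
    exact if_pos ⟨hs2, hs⟩
  refine ⟨b', M, M.2, ⟨fun s => ?_, fun s => ?_, fun ψ => ?_⟩, hae⟩
  · by_cases h : s ∈ Icc 0 T ∧ b s ∈ besovSpace φ₀ β ∧ besovNorm φ₀ β (b s) ≤ M
    · simp only [hb', if_pos h]
      exact (besovNorm_le_coe_iff hφ M).1 h.2.2
    · simp only [hb', if_neg h]
      exact bb_zero M.2
  · by_cases h : s ∈ Icc 0 T ∧ b s ∈ besovSpace φ₀ β ∧ besovNorm φ₀ β (b s) ≤ M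
    · simp only [hb', if_pos h]
      exact h.2.1.1
    · simp only [hb', if_neg h]
      exact fun ψ _ => rfl
  · have h1 : AEStronglyMeasurable ((Icc 0 T).indicator fun s => b s ψ) volume :=
      (aestronglyMeasurable_indicator_iff measurableSet_Icc).2 (hm ψ)
    refine h1.congr ?_
    rw [ae_restrict_iff' measurableSet_Icc] at hae
    filter_upwards [hae] with s hs
    by_cases h : s ∈ Icc 0 T
    · rw [indicator_of_mem h, hs h]
    · rw [indicator_of_notMem h]
      simp only [hb']
      rw [if_neg fun h' => h h'.1]
      rfl

variable {hφ} {F : Space d → ℝ} {α β : ℝ}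

/-- The product is unique, so the function `N` in the definition of a mild solution leaves no
freedom: it is the nonlinear term at almost every time. -/
lemma isProduct_nl_iff (H : Admissible F α β) {M R : ℝ} (hα : 0 < α) (hM : 0 ≤ M) (hR : 0 ≤ R)
    {b u : ℝ → Distr d} (hb : Drift hφ β b M) {s : ℝ} (hu : BB hφ (α + 1) (u s) R) {w N : Distr d}
    (hw : IsFGrad F (u s) w) : IsProduct φ₀ w (b s) N ↔ N = nl φ₀ F b u s := by
  have h1 := H.neg_lt
  have h2 := H.lt_one
  have h3 := H.neg
  have ha0 : 0 < (α - β) / 2 := by linarith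
  have ha1 : (α - β) / 2 ≤ 1 := by linarith
  have haα : (α - β) / 2 < α := by linarith
  obtain ⟨A, hA, hh, -⟩ := exists_hol_fgrad hφ H.hF ha0 ha1 haα R hR
  exact isProduct_iff hφ ha0 ha1 (by linarith) (hb.bb s) hM (hh _ hu)
    (hw.apply_eq hφ hα hR hu) N

lemma IsTimeInterval.Icc_subset {T h : ℝ} {I : Set ℝ} (hI : IsTimeInterval T I) (hh : h ∈ I) :
    Icc 0 h ⊆ I := hI.2.1.out hI.1 hh

/-- Compactness of `[0, h]`: the solution is locally bounded at positive times by continuity, and at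
`0` by the boundedness condition. -/
lemma IsMildSolution.exists_bound {b u : ℝ → Distr d} {u₀ : Distr d} {T h : ℝ} {I : Set ℝ}
    (hI : IsTimeInterval T I) (hu : IsMildSolution φ₀ α F b u₀ I u) (hh : h ∈ I) :
    ∃ R, 0 ≤ R ∧ ∀ s ∈ Icc 0 h, BB hφ (α + 1) (u s) R := by
  have hsub := hI.Icc_subset hh
  refine isCompact_Icc.induction_on
    (p := fun S => ∃ R, 0 ≤ R ∧ ∀ s ∈ S, BB hφ (α + 1) (u s) R) ?_ ?_ ?_ ?_
  · exact ⟨0, le_rfl, fun s hs => hs.elim⟩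
  · rintro S S' hS ⟨R, hR, h⟩
    exact ⟨R, hR, fun s hs => h s (hS hs)⟩
  · rintro S S' ⟨R, hR, h⟩ ⟨R', hR', h'⟩
    refine ⟨max R R', le_max_of_le_left hR, fun s hs => ?_⟩
    rcases hs with hs | hs
    · exact (h s hs).mono (le_max_left _ _)
    · exact (h' s hs).mono (le_max_right _ _)
  · intro s hs
    rcases hs.1.eq_or_lt with rfl | h0
    · obtain ⟨δ, hδ, M, hM⟩ := hu.bounded
      refine ⟨Icc 0 h ∩ Iio δ, inter_mem self_mem_nhdsWithin
        (nhdsWithin_le_nhds (Iio_mem_nhds hδ)), M, M.2, fun s hs => ?_⟩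
      exact (besovNorm_le_coe_iff hφ M).1 (hM s (hsub hs.1) hs.2)
    · obtain ⟨R, hR, hRs⟩ := exists_bb_of_mem hφ (hu.mem s (hsub hs))
      obtain ⟨δ, hδ, hc⟩ := (normContinuousAt_iff hφ).1 (hu.continuous s (hsub hs) h0) 1 one_pos
      refine ⟨Icc 0 h ∩ Metric.ball s δ, inter_mem self_mem_nhdsWithin
        (nhdsWithin_le_nhds (Metric.ball_mem_nhds s hδ)), 1 + R, by linarith, fun s' hs' => ?_⟩
      have := (hc s' (hsub hs'.1) (by simpa [Real.dist_eq] using hs'.2)).add hRs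
      rwa [sub_add_cancel] at this

/-- Mild solutions are mild solutions on all compact subintervals. -/
lemma IsMildSolution.mild (H : Admissible F α β) (hα : 0 < α) {b b' u : ℝ → Distr d}
    {u₀ : Distr d} {T h M : ℝ} {I : Set ℝ} (hM : 0 ≤ M) (hb : Drift hφ β b' M)
    (hbb : ∀ᵐ s ∂(volume.restrict (Icc 0 T)), b' s = b s)
    (hI : IsTimeInterval T I) (hu : IsMildSolution φ₀ α F b u₀ I u) (hh : h ∈ I) :
    Mild hφ α F b' u₀ h u := by
  have hsub := hI.Icc_subset hh
  obtain ⟨R, hR, hbd⟩ := hu.exists_bound (hφ := hφ) hI hh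
  have hc : Curve hφ (α + 1) u h R := by
    refine ⟨hbd, fun s hs => (hu.mem s (hsub hs)).1, fun s hs ε hε => ?_⟩
    obtain ⟨δ, hδ, hc⟩ := (normContinuousAt_iff hφ).1
      (hu.continuous s (hsub ⟨hs.1.le, hs.2⟩) hs.1) ε hε
    exact ⟨δ, hδ, fun s' hs' => hc s' (hsub hs')⟩
  refine ⟨⟨R, hR, hc⟩, fun t ht => ?_⟩
  obtain ⟨P, hP, h1⟩ := exists_adm_nl hφ H.hF H.lt_one H.neg H.neg_lt R hR
  have hadm := ((h1 hM hb).1 hc).mono le_rfl ht.2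
  obtain ⟨N, hN, heq⟩ := hu.equation
  ext ψ
  rw [(heq t (hsub ht) ψ).2, add_apply,
    hadm.duh_apply H.neg_one_lt (by positivity) ht.1 le_rfl]
  congr 1
  refine intervalIntegral.integral_congr_ae_restrict ?_
  rw [uIoc_of_le ht.1]
  have hsub' : Ioc 0 t ⊆ I := fun s hs => hsub ⟨hs.1.le, hs.2.trans ht.2⟩
  filter_upwards [ae_restrict_mem measurableSet_Ioc, ae_restrict_of_ae_restrict_of_subset hsub' hN,
    ae_restrict_of_ae_restrict_of_subset (hsub'.trans hI.2.2) hbb] with s hs hs1 hs2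
  obtain ⟨w, hw, hp⟩ := hs1
  rw [← hs2] at hp
  rw [heat_apply (by linarith [hs.2]),
    (isProduct_nl_iff H hα hM hR hb (hbd s ⟨hs.1.le, hs.2.trans ht.2⟩) hw).1 hp]

/-- A curve that is a mild solution on all compact subintervals is a mild solution. -/
lemma isMildSolution_of_mild (H : Admissible F α β) (hα : 0 < α) {b b' u : ℝ → Distr d}
    {u₀ : Distr d} {T M : ℝ} {I : Set ℝ} (hM : 0 ≤ M) (hb : Drift hφ β b' M)
    (hbb : ∀ᵐ s ∂(volume.restrict (Icc 0 T)), b' s = b s)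
    (hI : IsTimeInterval T I) (hu : ∀ h ∈ I, Mild hφ α F b' u₀ h u) :
    IsMildSolution φ₀ α F b u₀ I u := by
  have hnn : ∀ {t}, t ∈ I → 0 ≤ t := fun ht => (hI.2.2 ht).1
  have hmeas : MeasurableSet I := hI.2.1.measurableSet
  refine ⟨fun t ht => ?_, fun t ht h0 => ?_, ?_, nl φ₀ F b' u, ?_, fun t ht ψ => ?_⟩
  · obtain ⟨R, hR, hc⟩ := (hu t ht).curve
    exact mem_besovSpace hφ (hc.real t ⟨hnn ht, le_rfl⟩) hR (hc.bb t ⟨hnn ht, le_rfl⟩)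
  · rw [normContinuousAt_iff hφ]
    intro ε hε
    -- If `I` continues beyond `t`, a longer compact interval is needed to see times to the right of
    -- `t`; otherwise `t` is the last point of `I`.
    by_cases hex : ∃ h ∈ I, t < h
    · obtain ⟨h, hh, hth⟩ := hex
      obtain ⟨R, hR, hc⟩ := (hu h hh).curve
      obtain ⟨δ, hδ, hc'⟩ := hc.cont t ⟨h0, hth.le⟩ ε hε
      refine ⟨min δ (h - t), lt_min hδ (by linarith), fun s hs hd => hc' s ⟨hnn hs, ?_⟩
        (hd.trans_le (min_le_left _ _))⟩
      have := (abs_lt.1 (hd.trans_le (min_le_right _ _))).2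
      linarith
    · push Not at hex
      obtain ⟨R, hR, hc⟩ := (hu t ht).curve
      obtain ⟨δ, hδ, hc'⟩ := hc.cont t ⟨h0, le_rfl⟩ ε hε
      exact ⟨δ, hδ, fun s hs hd => hc' s ⟨hnn hs, hex s hs⟩ hd⟩
  · obtain ⟨h, hh, δ, hδ, hI'⟩ : ∃ h ∈ I, ∃ δ > 0, ∀ t ∈ I, t < δ → t ≤ h := by
      by_cases hex : ∃ h ∈ I, 0 < h
      · obtain ⟨h, hh, h0⟩ := hex
        exact ⟨h, hh, h, h0, fun t _ ht => ht.le⟩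
      · push Not at hex
        exact ⟨0, hI.1, 1, one_pos, fun t ht _ => hex t ht⟩
    obtain ⟨R, hR, hc⟩ := (hu h hh).curve
    exact ⟨δ, hδ, ⟨R, hR⟩, fun t ht htδ => (besovNorm_le_coe_iff hφ ⟨R, hR⟩).2
      (hc.bb t ⟨hnn ht, hI' t ht htδ⟩)⟩
  · filter_upwards [ae_restrict_mem hmeas, ae_restrict_of_ae_restrict_of_subset hI.2.2 hbb]
      with s hs hs2
    obtain ⟨R, hR, hc⟩ := (hu s hs).curve
    have hbd := hc.bb s ⟨hnn hs, le_rfl⟩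
    obtain ⟨w, hw⟩ := exists_isFGrad hφ H.hF hα hR hbd
    exact ⟨w, hw, by rw [← hs2]; exact (isProduct_nl_iff H hα hM hR hb hbd hw).2 rfl⟩
  · obtain ⟨M', hM', hadm⟩ := (hu t ht).adm H hM hb
    have h0 := hnn ht
    have hii := hadm.intervalIntegrable H.neg_one_lt hM' h0 le_rfl ψ
    have e : EqOn (fun s => heat (t - s) (nl φ₀ F b' u s) ψ)
        (fun s => nl φ₀ F b' u s (hts (t - s) ψ)) (uIcc 0 t) := fun s hs => by
      rw [uIcc_of_le h0] at hs
      exact heat_apply (by linarith [hs.2]) _ _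
    constructor
    · exact hii.congr fun s hs => (e (uIoc_subset_uIcc hs)).symm
    · rw [intervalIntegral.integral_congr e, ← hadm.duh_apply H.neg_one_lt hM' h0 le_rfl ψ,
        ← add_apply, ← (hu t ht).eq t ⟨h0, le_rfl⟩]

/-! ### The maximal solution -/

lemma mild_zero (H : Admissible F α β) {b : ℝ → Distr d} {u₀ : Distr d} {M R : ℝ} (hM : 0 ≤ M)
    (hb : Drift hφ β b M) (hR : 0 ≤ R) (hu₀ : BB hφ (α + 1) u₀ R) (hu₀r : IsReal u₀) :
    Mild hφ α F b u₀ 0 fun _ => u₀ := by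
  have hc : Curve hφ (α + 1) (fun _ => u₀) 0 R :=
    ⟨fun _ _ => hu₀, fun _ _ => hu₀r, fun s hs => absurd hs.1 hs.2.not_gt⟩
  obtain ⟨P, hP, h1⟩ := exists_adm_nl hφ H.hF H.lt_one H.neg H.neg_lt R hR
  have hadm := (h1 hM hb).1 hc
  refine ⟨⟨R, hR, hc⟩, fun t ht => ?_⟩
  have : t = 0 := le_antisymm ht.2 ht.1
  subst this
  rw [heat_zero]
  ext ψ
  rw [add_apply, hadm.duh_apply H.neg_one_lt (by positivity) le_rfl le_rfl]
  simp

lemma Mild.eq_at (H : Admissible F α β) {b u v : ℝ → Distr d} {u₀ : Distr d} {M h h' : ℝ}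
    (hM : 0 ≤ M) (hb : Drift hφ β b M) (hu : Mild hφ α F b u₀ h u) (hv : Mild hφ α F b u₀ h' v)
    {s : ℝ} (hs : 0 ≤ s) (hsh : s ≤ h) (hsh' : s ≤ h') : u s = v s := by
  rcases hs.eq_or_lt with rfl | h0
  · rw [hu.apply_zero H hM hb hsh, hv.apply_zero H hM hb hsh']
  · exact (hu.mono hsh).unique H hM hb h0 (hv.mono hsh') ⟨hs, le_rfl⟩

/-- There is a maximal solution. It can be extended by a time that only depends on its size. -/
lemma exists_maximal (H : Admissible F α β) (hα : 0 < α) {b : ℝ → Distr d} {u₀ : Distr d}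
    {M R₀ T : ℝ} (hM : 0 ≤ M) (hb : Drift hφ β b M) (hR₀ : 0 ≤ R₀) (hu₀ : BB hφ (α + 1) u₀ R₀)
    (hu₀r : IsReal u₀) (hT : 0 ≤ T) :
    ∃ (I : Set ℝ) (u : ℝ → Distr d), IsTimeInterval T I ∧ (∀ h ∈ I, Mild hφ α F b u₀ h u) ∧
      (∀ h ∈ Icc 0 T, ∀ v, Mild hφ α F b u₀ h v → h ∈ I) ∧
      ∀ R, 0 ≤ R → ∃ h, 0 < h ∧ ∀ t₀ ∈ I, BB hφ (α + 1) (u t₀) R → ∀ t ∈ Icc t₀ (t₀ + h),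
        t ≤ T → t ∈ I := by
  -- `V t` is some solution on `[0, t]`. The maximal solution is the diagonal `t ↦ V t t`, which
  -- agrees with each `V h` on `[0, h]` by uniqueness.
  choose! V hV using fun (t : ℝ) (ht : ∃ v, Mild hφ α F b u₀ t v) => ht
  set I : Set ℝ := {t | t ∈ Icc 0 T ∧ ∃ v, Mild hφ α F b u₀ t v} with hI
  have hmild : ∀ h ∈ I, Mild hφ α F b u₀ h fun t => V t t := by
    intro h hh
    refine (hV h hh.2).congr H hM hb fun s hs => ?_
    exact (hV h hh.2).eq_at H hM hb (hV s ⟨_, (hV h hh.2).mono hs.2⟩) hs.1 hs.2 le_rfl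
  refine ⟨I, fun t => V t t, ⟨⟨⟨le_rfl, hT⟩, _, mild_zero H hM hb hR₀ hu₀ hu₀r⟩,
    ⟨fun x hx y hy z hz => ⟨⟨hx.1.1.trans hz.1, hz.2.trans hy.1.2⟩, _, (hV y hy.2).mono hz.2⟩⟩,
    fun t ht => ht.1⟩, hmild, fun h hh v hv => ⟨hh, v, hv⟩, fun R hR => ?_⟩
  obtain ⟨h, hh, hex⟩ := exists_mild hφ H hα hM hR
  refine ⟨h, hh, fun t₀ ht₀ hbd t ht htT => ⟨⟨ht₀.1.1.trans ht.1, htT⟩, ?_⟩⟩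
  have hm := hmild t₀ ht₀
  obtain ⟨R', hR', hc⟩ := hm.curve
  obtain ⟨v, hv⟩ := hex (hb.shift t₀) hbd (hc.real t₀ ⟨ht₀.1.1, le_rfl⟩)
  obtain ⟨w, hw⟩ := hm.append H hM hb hR₀ hu₀ hu₀r ht₀.1.1 hh hv
  exact ⟨w, hw.mono ht.2⟩

/-- The norm blows up at the end of a half-open maximal interval. -/
lemma tendsto_besovNorm_top {I : Set ℝ} {u : ℝ → Distr d} {T tstar : ℝ}
    (hext : ∀ R, 0 ≤ R → ∃ h, 0 < h ∧ ∀ t₀ ∈ I, BB hφ (α + 1) (u t₀) R → ∀ t ∈ Icc t₀ (t₀ + h),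
        t ≤ T → t ∈ I)
    (ht : tstar ∈ Ioc 0 T) (hsub : Ico 0 tstar ⊆ I) (hnot : tstar ∉ I) :
    Tendsto (fun s => besovNorm φ₀ (α + 1) (u s)) (𝓝[<] tstar) (𝓝 ∞) := by
  rw [ENNReal.tendsto_nhds_top_iff_nnreal]
  intro R
  -- Norm at most `R` at any single time after `tstar - h` would carry the solution to `tstar`. So
  -- the norm exceeds `R` at all these times.
  obtain ⟨h, hh, hex⟩ := hext R R.2
  have h1 : Ioo (max 0 (tstar - h)) tstar ∈ 𝓝[<] tstar :=
    Ioo_mem_nhdsLT (max_lt ht.1 (by linarith))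
  filter_upwards [h1] with s hs
  by_contra hle
  have hs1 := (le_max_left _ _).trans_lt hs.1
  have hs2 := (le_max_right _ _).trans_lt hs.1
  exact hnot (hex s (hsub ⟨hs1.le, hs.2⟩) ((besovNorm_le_coe_iff hφ R).1 (not_lt.1 hle)) tstar
    ⟨hs.2.le, by linarith⟩ ht.2)

/-- Continuity at time `0`. -/
lemma normContinuousAt_zero (H : Admissible F α β) {b u : ℝ → Distr d} {u₀ : Distr d}
    {M T : ℝ} {I : Set ℝ} (hM : 0 ≤ M) (hb : Drift hφ β b M) (hI : IsTimeInterval T I)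
    (hu : ∀ h ∈ I, Mild hφ α F b u₀ h u)
    (h0 : Tendsto (fun t => besovNorm φ₀ (α + 1) (heat t u₀ - u₀)) (𝓝[>] 0) (𝓝 0)) :
    NormContinuousAt φ₀ (α + 1) I u 0 := by
  have hnn : ∀ {t}, t ∈ I → 0 ≤ t := fun ht => (hI.2.2 ht).1
  have hu0 : u 0 = u₀ := (hu 0 hI.1).apply_zero H hM hb le_rfl
  rw [normContinuousAt_iff hφ]
  intro ε hε
  by_cases hex : ∃ h ∈ I, 0 < h
  · obtain ⟨h, hh, h0'⟩ := hex
    obtain ⟨M', hM', hadm⟩ := (hu h hh).adm H hM hb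
    obtain ⟨K, hK, h2⟩ := exists_bb_duh hφ h h0' H.theta_nonneg H.theta_lt
    -- Dividing by `ε` makes the Duhamel term at most `ε / 2` up to time `η`.
    obtain ⟨η, hη, hηh, hsmall⟩ := exists_small (K * M' / ε)
      (c := 1 - (α + 1 - β) / 2) (by linarith [H.theta_lt]) h0'
    have h3 := (tendsto_besovNorm_zero_iff hφ).1 h0 (ε / 2) (by linarith)
    obtain ⟨δ, hδ, h4⟩ := Metric.eventually_nhds_iff.1 (eventually_nhdsWithin_iff.1 h3)
    refine ⟨min δ η, lt_min hδ hη, fun s hs hd => ?_⟩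
    rw [sub_zero, abs_of_nonneg (hnn hs)] at hd
    rcases (hnn hs).eq_or_lt with rfl | hs0
    · rw [sub_self]; exact bb_zero hε.le
    have hsh : s ≤ h := (hd.trans_le (min_le_right _ _)).le.trans hηh
    have e : u s - u 0 = (heat s u₀ - u₀) + duh (nl φ₀ F b u) 0 s s := by
      rw [hu0, (hu h hh).eq s ⟨hs0.le, hsh⟩]; abel
    rw [e]
    have g1 := h4 (y := s) (by
      simpa [Real.dist_eq, abs_of_pos hs0] using hd.trans_le (min_le_left _ _)) hs0
    have g2 := h2 H.neg_one_lt hM' (hadm.mono le_rfl hsh) hs0.le le_rfl (by linarith)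
    rw [theta_eq, sub_zero] at g2
    refine (g1.add g2).mono ?_
    have g3 := hsmall s hs0.le (hd.trans_le (min_le_right _ _)).le
    have g4 : K * M' * s ^ (1 - (α + 1 - β) / 2) =
        ε * (K * M' / ε * s ^ (1 - (α + 1 - β) / 2)) := by field_simp
    rw [g4]
    nlinarith
  · push Not at hex
    refine ⟨1, one_pos, fun s hs _ => ?_⟩
    rw [le_antisymm (hex s hs) (hnn hs), sub_self]
    exact bb_zero hε.le

end glue

end

end RoughHeat

/-! ### The theorem. -/

theorem mainTheorem6 (d : ℕ) (hd : 1 ≤ d)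
    (φ₀ : RoughHeat.Space d → ℝ) (hφ₀ : RoughHeat.IsDyadicGenerator φ₀)
    (F : RoughHeat.Space d → ℝ) (hF : RoughHeat.IsC1LipschitzPartials F)
    (α β : ℝ) (hα₀ : 0 < α) (hα₁ : α < 1) (hβ₀ : β < 0) (hβ : max (-α) (α - 1) < β)
    (T : ℝ) (hT : 0 < T)
    (b : ℝ → RoughHeat.Distr d) (hb : RoughHeat.IsLinfty φ₀ β T b)
    (u₀ : RoughHeat.Distr d) (hu₀ : u₀ ∈ RoughHeat.besovSpace φ₀ (α + 1)) :
    ∃ (I : Set ℝ) (u : ℝ → RoughHeat.Distr d),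
      RoughHeat.IsTheSolution φ₀ α F b u₀ T I u ∧
      -- either the norm blows up at some time, or the solution exists on all of `[0,T]`
      ((∃ tstar ∈ Ioc 0 T, I = Ico 0 tstar ∧
          Tendsto (fun s => RoughHeat.besovNorm φ₀ (α + 1) (u s)) (𝓝[<] tstar) (𝓝 ∞)) ∨
        I = Icc 0 T) ∧
      -- an infinite upper limit of the norm is a limit
      (∀ tstar ∈ Ioc 0 T, Ico 0 tstar ⊆ I →
        limsup (fun s => RoughHeat.besovNorm φ₀ (α + 1) (u s)) (𝓝[<] tstar) = ∞ →
        Tendsto (fun s => RoughHeat.besovNorm φ₀ (α + 1) (u s)) (𝓝[<] tstar) (𝓝 ∞)) ∧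
      -- the solution is continuous at time `0`, too, whenever `P_t u₀ → u₀` in `𝒞^{α+1}`
      (Tendsto (fun t => RoughHeat.besovNorm φ₀ (α + 1) (RoughHeat.heat t u₀ - u₀))
          (𝓝[>] 0) (𝓝 0) →
        ∀ t ∈ I, RoughHeat.NormContinuousAt φ₀ (α + 1) I u t) := by
  obtain ⟨hβ₁, hβ₂⟩ := max_lt_iff.1 hβ
  have H : RoughHeat.Admissible F α β := ⟨hF, hα₁, hβ₀, hβ₁, hβ₂⟩
  obtain ⟨b', M, hM, hb', hbb⟩ := RoughHeat.exists_drift hφ₀ hb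
  obtain ⟨R₀, hR₀, hu₀b⟩ := RoughHeat.exists_bb_of_mem hφ₀ hu₀
  obtain ⟨I, u, hI, hu, hmax, hext⟩ :=
    RoughHeat.exists_maximal H hα₀ hM hb' hR₀ hu₀b hu₀.1 hT.le
  have hsol := RoughHeat.isMildSolution_of_mild H hα₀ hM hb' hbb hI hu
  have hnn : ∀ {t}, t ∈ I → 0 ≤ t := fun ht => (hI.2.2 ht).1
  refine ⟨I, u, ⟨hI, hsol, fun J v hJ hv => ?_⟩, ?_, fun tstar ht hsub hlim => ?_,
    fun h0 t ht => ?_⟩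
  · have hvm := fun h hh => hv.mild H hα₀ hM hb' hbb hJ (h := h) hh
    have hJI : J ⊆ I := fun h hh => hmax h (hJ.2.2 hh) v (hvm h hh)
    exact ⟨hJI, fun t ht => (hvm t ht).eq_at H hM hb' (hu t (hJI ht)) (hJ.2.2 ht).1 le_rfl le_rfl⟩
  · by_cases hTI : T ∈ I
    · exact Or.inr (hI.2.2.antisymm (hI.Icc_subset hTI))
    · left
      have hbdd : BddAbove I := ⟨T, fun t ht => (hI.2.2 ht).2⟩
      have hne : I.Nonempty := ⟨0, hI.1⟩
      have hsT : sSup I ≤ T := csSup_le hne fun t ht => (hI.2.2 ht).2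
      -- A solution that attains its final time before `T` could be continued, so the maximal
      -- interval is open on the right unless it contains `T`.
      have hnot : sSup I ∉ I := fun hmem => by
        obtain ⟨R, hR, hc⟩ := (hu _ hmem).curve
        obtain ⟨h, hh, hex⟩ := hext R hR
        have hlt : sSup I < T := lt_of_le_of_ne hsT fun h => hTI (h ▸ hmem)
        have hmin : 0 < min h (T - sSup I) := lt_min hh (by linarith)
        have := le_csSup hbdd (hex _ hmem (hc.bb _ ⟨hnn hmem, le_rfl⟩)
          (sSup I + min h (T - sSup I)) ⟨by linarith, by linarith [min_le_left h (T - sSup I)]⟩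
          (by linarith [min_le_right h (T - sSup I)]))
        linarith
      have hpos : 0 < sSup I :=
        lt_of_le_of_ne (le_csSup hbdd hI.1) fun h => hnot (h ▸ hI.1)
      have hIco : I = Ico 0 (sSup I) := by
        refine subset_antisymm (fun t ht => ⟨hnn ht, lt_of_le_of_ne (le_csSup hbdd ht)
          fun h => hnot (h ▸ ht)⟩) fun t ht => ?_
        obtain ⟨s, hs, hts⟩ := exists_lt_of_lt_csSup hne ht.2
        exact hI.Icc_subset hs ⟨ht.1, hts.le⟩
      exact ⟨sSup I, ⟨hpos, hsT⟩, hIco,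
        RoughHeat.tendsto_besovNorm_top hext ⟨hpos, hsT⟩ hIco.ge hnot⟩
  -- If `tstar` belonged to `I`, the solution would be bounded on `[0, tstar]`, against the infinite
  -- upper limit.
  · refine RoughHeat.tendsto_besovNorm_top hext ht hsub fun hmem => ?_
    obtain ⟨R, hR, hc⟩ := (hu _ hmem).curve
    have hle : limsup (fun s => RoughHeat.besovNorm φ₀ (α + 1) (u s)) (𝓝[<] tstar) ≤
        ENNReal.ofReal R := by
      refine limsup_le_of_le (by isBoundedDefault) ?_
      filter_upwards [Ioo_mem_nhdsLT ht.1] with s hs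
      exact (RoughHeat.besovNorm_le_iff hφ₀ hR).2 (hc.bb s ⟨hs.1.le, hs.2.le⟩)
    rw [hlim] at hle
    exact ENNReal.ofReal_ne_top (top_le_iff.1 hle)
  · rcases (hnn ht).eq_or_lt with rfl | h
    · exact RoughHeat.normContinuousAt_zero H hM hb' hI hu h0
    · exact hsol.continuous t ht h
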